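/- **Setting.** Let $\mathbb T^n=(\mathbb R/\mathbb Z)^n$ with its Haar probability measure $dx$, let $|k|$ be the Euclidean length of $k\in\mathbb Z^n$, and for multi-indices $\alpha,\beta,\gamma\in\mathbb N_0^n$ write $|\alpha|=\sum_j\alpha_j$, $k^\gamma=\prod_j k_j^{\gamma_j}$, $\Delta_k^\alpha=\Delta_{k_1}^{\alpha_1}\cdots\Delta_{k_n}^{\alpha_n}$ with $\Delta_{k_j}f(k)=f(k+e_j)-f(k)$, and $D_x^{(\beta)}=D_{x_1}^{(\beta_1)}\cdots D_{x_n}^{(\beta_n)}$ with $D_{x_j}^{(\ell)}=\prod_{p=0}^{\ell-1}\bigl(\tfrac1{2\pi i}\tfrac{\partial}{\partial x_j}-p\bigr)$, $D_{x_j}^{(0)}=I$. A function $\Lambda:\mathbb Z^n\to\mathbb R$ is a *weight function* with exponent $\mu$ if there are positive constants $\mu_0\le\mu_1\le\mu$ and $C_0,C_1$ with $C_0(1+|k|)^{\mu_0}\le\Lambda(k)\le C_1(1+|k|)^{\mu_1}$ for all $k$, and if for all $\alpha\in\mathbb N_0^n$, $\gamma\in\{0,1\}^n$ there is $C_{\alpha,\gamma}>0$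 with $|k^\gamma\Delta_k^{\alpha+\gamma}\Lambda(k)|\le C_{\alpha,\gamma}\Lambda(k)^{1-|\alpha|/\mu}$ for all $k$. Fix such $\Lambda,\mu$ and $\rho\in(0,1/\mu]$. For $m\in\mathbb R$, $S^m_{\rho,\Lambda}$ is the set of $\sigma:\mathbb Z^n\times\mathbb T^n\to\mathbb C$ with $\sigma(k,\cdot)\in C^\infty(\mathbb T^n)$ for every $k$ such that for all $\alpha,\beta$ there is $C_{\alpha,\beta}>0$ with $|D_x^{(\beta)}\Delta_k^\alpha\sigma(k,x)|\le C_{\alpha,\beta}\Lambda(k)^{m-\rho|\alpha|}$ for all $(k,x)$. The class $M^m_{\rho,\Lambda}$ is the set of $\sigma$, smooth in $x$, with $k^\gamma\Delta_k^\gamma\sigma\in S^m_{\rho,\Lambda}$ for all $\gamma\in\{0,1\}^n$, and $M^{-\infty}_{\rho,\Lambda}=\bigcap_{m\in\mathbb R}M^m_{\rho,\Lambda}$. A symbol $\sigma\in M^m_{\rho,\Lambda}$ is *$M$-elliptic* if there are $C,R_1>0$ with $|\sigma(k,x)|\ge C\Lambda(k)^m$ for all $x$ and all $k$ with $|k|\ge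 R_1$. Let $\mathcal S(\mathbb Z^n)$ be the space of rapidly decreasing functions on $\mathbb Z^n$. The pseudo-difference operator with symbol $\sigma$ acts on $f\in\mathcal S(\mathbb Z^n)$ by $$T_\sigma f(k)=\int_{\mathbb T^n}e^{2\pi i k\cdot x}\sigma(k,x)\widehat f(x)\,dx,\qquad \widehat f(x)=\sum_{k\in\mathbb Z^n}e^{-2\pi i k\cdot x}f(k).$$ **Theorem.** Let $m\in\mathbb R$ and let $\sigma\in M^m_{\rho,\Lambda}$ be $M$-elliptic. Then there are a symbol $\tau\in M^{-m}_{\rho,\Lambda}$ and symbols $r,s\in M^{-\infty}_{\rho,\Lambda}$ such that, with $R=T_r$ and $S=T_s$, the operators $T_\sigma$ and $T_\tau$ map $\mathcal S(\mathbb Z^n)$ into itself and, on $\mathcal S(\mathbb Z^n)$, $$T_\tau T_\sigma=I+R,\qquad T_\sigma T_\tau=I+S .$$ -/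

import Mathlib

open scoped ContDiff

noncomputable section

namespace LatticePDO

/-- The lattice `ℤⁿ`. -/
abbrev Lattice (n : ℕ) : Type := Fin n → ℤ

/-- The torus `𝕋ⁿ = (ℝ/ℤ)ⁿ`. -/
abbrev Torus (n : ℕ) : Type := UnitAddTorus (Fin n)

/-- Haar probability measure on `𝕋ⁿ`. -/
def torusMeasure (n : ℕ) : MeasureTheory.Measure (Torus n) :=
  MeasureTheory.Measure.pi (fun _ : Fin n =>
    (AddCircle.haarAddCircle : MeasureTheory.Measure UnitAddCircle))

/-- The Euclidean length `|k|` of a lattice point. -/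
def latticeNorm {n : ℕ} (k : Lattice n) : ℝ := Real.sqrt (∑ i, (k i : ℝ) ^ 2)

/-- The length `|α| = α₁ + ⋯ + αₙ` of a multi-index. -/
def multiLength {n : ℕ} (α : Fin n → ℕ) : ℕ := ∑ i, α i

/-- The monomial `k^γ = k₁^γ₁ ⋯ kₙ^γₙ`. -/
def latticeMonomial {n : ℕ} (γ : Fin n → ℕ) (k : Lattice n) : ℤ := ∏ i, k i ^ γ i

/-- The iterated difference operator `Δ^α = Δ₁^α₁ ⋯ Δₙ^αₙ` on `ℤⁿ`, where
`Δⱼ f (k) = f (k + eⱼ) - f k`. -/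
def diffOp {n : ℕ} {G : Type*} [AddCommGroup G] (α : Fin n → ℕ) (f : Lattice n → G) :
    Lattice n → G :=
  (List.finRange n).foldr (fun j g => (fwdDiff (Pi.single j (1 : ℤ)))^[α j] g) f

/-- `Dⱼ = (2πi)⁻¹ ∂/∂xⱼ` on functions on the torus. -/
def torusD {n : ℕ} (j : Fin n) (f : Torus n → ℂ) : Torus n → ℂ := fun x =>
  (2 * (Real.pi : ℂ) * Complex.I)⁻¹ *
    deriv (fun t : ℝ => f (x + Pi.single j (t : UnitAddCircle))) 0

/-- `Dⱼ^{(ℓ)} = (Dⱼ - 0)(Dⱼ - 1) ⋯ (Dⱼ - (ℓ - 1))`, and `Dⱼ^{(0)}` is the identity. -/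
def torusDFactorial {n : ℕ} (j : Fin n) : ℕ → (Torus n → ℂ) → (Torus n → ℂ)
  | 0, f => f
  | l + 1, f => fun x =>
      torusD j (torusDFactorial j l f) x - (l : ℂ) * torusDFactorial j l f x

/-- `D^{(β)} = D₁^{(β₁)} ⋯ Dₙ^{(βₙ)}`. -/
def torusDMulti {n : ℕ} (β : Fin n → ℕ) (f : Torus n → ℂ) : Torus n → ℂ :=
  (List.finRange n).foldr (fun j g => torusDFactorial j (β j) g) f

/-- `f ∈ C^∞(𝕋ⁿ)`: the periodic lift of `f` to `ℝⁿ` is smooth. -/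
def IsSmoothOnTorus {n : ℕ} (f : Torus n → ℂ) : Prop :=
  ContDiff ℝ ∞ (fun t : Fin n → ℝ => f (fun i => (t i : UnitAddCircle)))

/-- `Λ` is a weight function on `ℤⁿ` with exponent `μ`. -/
def IsWeight {n : ℕ} (Λ : Lattice n → ℝ) (μ : ℝ) : Prop :=
  ∃ μ₀ μ₁ C₀ C₁ : ℝ, 0 < μ₀ ∧ μ₀ ≤ μ₁ ∧ μ₁ ≤ μ ∧ 0 < C₀ ∧ 0 < C₁ ∧
    (∀ k, C₀ * (1 + latticeNorm k) ^ μ₀ ≤ Λ k ∧ Λ k ≤ C₁ * (1 + latticeNorm k) ^ μ₁) ∧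
    ∀ α γ : Fin n → ℕ, (∀ i, γ i ≤ 1) → ∃ C : ℝ, 0 < C ∧ ∀ k,
      |(latticeMonomial γ k : ℝ) * diffOp (α + γ) Λ k| ≤
        C * Λ k ^ (1 - (1 / μ) * (multiLength α : ℝ))

/-- The class `S^m_{ρ,Λ}(ℤⁿ × 𝕋ⁿ)`. -/
def SymbolS {n : ℕ} (Λ : Lattice n → ℝ) (ρ m : ℝ) : Set (Lattice n → Torus n → ℂ) :=
  {σ | (∀ k, IsSmoothOnTorus (σ k)) ∧
    ∀ α β : Fin n → ℕ, ∃ C : ℝ, 0 < C ∧ ∀ k x,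
      ‖torusDMulti β (diffOp α σ k) x‖ ≤ C * Λ k ^ (m - ρ * (multiLength α : ℝ))}

/-- The class `M^m_{ρ,Λ}(ℤⁿ × 𝕋ⁿ)`: all `k^γ Δ^γ σ` with `γ ∈ {0,1}ⁿ` lie in `S^m_{ρ,Λ}`. -/
def SymbolM {n : ℕ} (Λ : Lattice n → ℝ) (ρ m : ℝ) : Set (Lattice n → Torus n → ℂ) :=
  {σ | (∀ k, IsSmoothOnTorus (σ k)) ∧
    ∀ γ : Fin n → ℕ, (∀ i, γ i ≤ 1) →
      (fun k x => (latticeMonomial γ k : ℂ) * diffOp γ σ k x) ∈ SymbolS Λ ρ m}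

/-- The class `M^{-∞}_{ρ,Λ}(ℤⁿ × 𝕋ⁿ)`. -/
def SymbolMNegInf {n : ℕ} (Λ : Lattice n → ℝ) (ρ : ℝ) : Set (Lattice n → Torus n → ℂ) :=
  ⋂ m : ℝ, SymbolM Λ ρ m

/-- The lower bound that makes a symbol of order `m` an `M`-elliptic one. -/
def IsMElliptic {n : ℕ} (Λ : Lattice n → ℝ) (m : ℝ) (σ : Lattice n → Torus n → ℂ) : Prop :=
  ∃ C R₁ : ℝ, 0 < C ∧ 0 < R₁ ∧ ∀ k, R₁ ≤ latticeNorm k → ∀ x, C * Λ k ^ m ≤ ‖σ k x‖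

/-- The space `𝒮(ℤⁿ)` of rapidly decreasing functions. -/
def SchwartzLattice (n : ℕ) : Set (Lattice n → ℂ) :=
  {f | ∀ N : ℕ, ∃ C : ℝ, ∀ k, (1 + latticeNorm k) ^ N * ‖f k‖ ≤ C}

/-- The Fourier transform `f̂(x) = ∑ₖ e^{-2πi k·x} f(k)`. -/
def latticeFourier {n : ℕ} (f : Lattice n → ℂ) : Torus n → ℂ := fun x =>
  ∑' k : Lattice n, UnitAddTorus.mFourier (-k) x * f k

/-- The pseudo-difference operator `T_σ f(k) = ∫ e^{2πi k·x} σ(k,x) f̂(x) dx`. -/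
def pdo {n : ℕ} (σ : Lattice n → Torus n → ℂ) (f : Lattice n → ℂ) : Lattice n → ℂ := fun k =>
  ∫ x, UnitAddTorus.mFourier k x * σ k x * latticeFourier f x ∂(torusMeasure n)

end LatticePDO

end

/-! A symbol is replaced by its kernel: `a k η` is the `η`-th Fourier coefficient of `σ(k,·)`. Then
`T_σ f(k) = ∑ a k η * f (k + η)` (`pdo_kernelSymbol`), smoothness in `x` becomes rapid decay in `η`,
and membership in `M^m` becomes `EulerOrder`, a condition on sizes of differences only
(`kernelSymbol_mem_symbolM_iff`). Operators compose through the absolutely convergent sum `comp`, so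
no asymptotic expansion of a composed symbol is needed.

Products of symbols correspond to `conv`, and `comp a b - conv a b` is `defect a b`, which contains
`b (k + η) - b k`. Telescoping along a lattice path from `k` to `k + η` bounds this by first
differences of `b`, at the cost of powers of `η` that the decay of `a` absorbs. Hence the defect
gains `ρ` (`EulerOrder.defect`). Uniformity along the path comes from moderate growth of the weight,
`Λ(k + η) ≤ C ⟨η⟩^q Λ(k)` (`IsWeight.exists_shift`).

An elliptic symbol, altered at finitely many `k`, is bounded below everywhere, and its pointwise
inverse lies in `M^{-m}` (`exists_conv_inverse`, `EulerOrder.inverse`); the alteration is smoothing.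
The inverse symbol therefore inverts the operator on both sides up to errors of order `-ρ`. An
asymptotically summed Neumann series (`exists_neumann`) improves it to a right and a left
parametrix. In the ring of kernels of finite order these agree modulo smoothing, so one kernel
serves on both sides (`exists_kernel_parametrix`).

Asymptotic summation can use sharp cutoffs, by `EulerOrder.of_approx`: a kernel approximated merely
in size, to arbitrarily low order, by kernels of a class belongs to the class. Indeed a difference
costs nothing in size, and each `kⱼ Δⱼ` costs a fixed power of `Λ`. -/

noncomputable section

namespace LatticePDO

/-! ### Lattice brackets, path telescoping and moderate growth of weights. -/

section

variable {n : ℕ}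

/-- The bracket `1 + |k₁| + ⋯ + |kₙ|` of a lattice point. -/
def bracket (k : Lattice n) : ℝ := 1 + ∑ i, |(k i : ℝ)|

lemma one_le_bracket (k : Lattice n) : 1 ≤ bracket k :=
  le_add_of_nonneg_right (Finset.sum_nonneg fun _ _ => abs_nonneg _)

lemma bracket_pos (k : Lattice n) : 0 < bracket k := zero_lt_one.trans_le (one_le_bracket k)

@[simp] lemma bracket_neg (k : Lattice n) : bracket (-k) = bracket k := by
  simp [bracket]

lemma bracket_add_le_add (k l : Lattice n) : bracket (k + l) ≤ bracket k + ∑ i, |(l i : ℝ)| := by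
  rw [bracket, bracket, add_assoc, ← Finset.sum_add_distrib]
  gcongr with i
  simpa using abs_add_le (k i : ℝ) (l i)

/-- Peetre-type inequality: it lets decay in `η` and in `ζ - η` be traded for decay in `ζ`. -/
lemma bracket_add_le (k l : Lattice n) : bracket (k + l) ≤ bracket k * bracket l := by
  refine (bracket_add_le_add k l).trans ?_
  have h1 := one_le_bracket k
  have h2 : 0 ≤ ∑ i, |(l i : ℝ)| := Finset.sum_nonneg fun _ _ => abs_nonneg _
  rw [show bracket l = 1 + ∑ i, |(l i : ℝ)| from rfl]
  nlinarith

lemma bracket_single (j : Fin n) : bracket (Pi.single j (1 : ℤ)) = 2 := by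
  have : ∀ i, |((Pi.single j (1 : ℤ) : Lattice n) i : ℝ)| = if i = j then 1 else 0 := by
    intro i
    by_cases h : i = j
    · subst h; simp
    · simp [h]
  simp only [bracket, this, Finset.sum_ite_eq', Finset.mem_univ, if_true]
  norm_num

lemma abs_coord_le_bracket (k : Lattice n) (j : Fin n) : |(k j : ℝ)| ≤ bracket k :=
  (Finset.single_le_sum (f := fun i => |(k i : ℝ)|) (fun _ _ => abs_nonneg _)
    (Finset.mem_univ j)).trans (le_add_of_nonneg_left zero_le_one)

lemma latticeNorm_nonneg (k : Lattice n) : 0 ≤ latticeNorm k := Real.sqrt_nonneg _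

lemma abs_coord_le_latticeNorm (k : Lattice n) (j : Fin n) : |(k j : ℝ)| ≤ latticeNorm k := by
  rw [latticeNorm]
  apply Real.abs_le_sqrt
  exact Finset.single_le_sum (f := fun i => (k i : ℝ) ^ 2) (fun _ _ => sq_nonneg _)
    (Finset.mem_univ j)

lemma bracket_le_latticeNorm (k : Lattice n) :
    bracket k ≤ (n + 1) * (1 + latticeNorm k) := by
  have h : ∑ i, |(k i : ℝ)| ≤ n * latticeNorm k := by
    calc ∑ i, |(k i : ℝ)| ≤ ∑ _i : Fin n, latticeNorm k :=
          Finset.sum_le_sum fun i _ => abs_coord_le_latticeNorm k i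
      _ = n * latticeNorm k := by simp
  have := latticeNorm_nonneg k
  rw [bracket]
  have : (0 : ℝ) ≤ n := n.cast_nonneg
  nlinarith

lemma latticeNorm_le_bracket (k : Lattice n) : 1 + latticeNorm k ≤ bracket k := by
  rw [bracket, latticeNorm]
  gcongr
  have h0 : 0 ≤ ∑ i, |(k i : ℝ)| := Finset.sum_nonneg fun _ _ => abs_nonneg _
  rw [Real.sqrt_le_left h0]
  calc ∑ i, (k i : ℝ) ^ 2 = ∑ i, |(k i : ℝ)| ^ 2 := by simp
    _ ≤ (∑ i, |(k i : ℝ)|) ^ 2 := Finset.sum_sq_le_sq_sum_of_nonneg fun _ _ => abs_nonneg _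

lemma finite_latticeNorm_lt (R : ℝ) : {k : Lattice n | latticeNorm k < R}.Finite := by
  refine (Set.Finite.pi (fun _ : Fin n => Set.finite_Icc (-⌈R⌉) ⌈R⌉)).subset ?_
  intro k hk
  rw [Set.mem_univ_pi]
  intro i
  have h : |(k i : ℝ)| ≤ R := (abs_coord_le_latticeNorm k i).trans (le_of_lt hk)
  have h2 := abs_le.1 (h.trans (Int.le_ceil R))
  exact ⟨by exact_mod_cast h2.1, by exact_mod_cast h2.2⟩

lemma summable_pi_prod {f : ℤ → ℝ} (hf : Summable f) (h0 : ∀ i, 0 ≤ f i) :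
    Summable fun k : Lattice n => ∏ i, f (k i) := by
  classical
  refine summable_of_sum_le (c := ∏ _i : Fin n, ∑' z, f z)
    (fun k => Finset.prod_nonneg fun i _ => h0 _) fun u => ?_
  calc ∑ k ∈ u, ∏ i, f (k i)
      ≤ ∑ k ∈ Fintype.piFinset fun i => u.image fun k => k i, ∏ i, f (k i) := by
        refine Finset.sum_le_sum_of_subset_of_nonneg ?_
          fun k _ _ => Finset.prod_nonneg fun i _ => h0 _
        intro k hk
        simp only [Fintype.mem_piFinset]
        exact fun i => Finset.mem_image_of_mem _ hk
    _ = ∏ i, ∑ z ∈ u.image fun k => k i, f z := by rw [Finset.prod_univ_sum]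
    _ ≤ _ := Finset.prod_le_prod (fun i _ => Finset.sum_nonneg fun _ _ => h0 _)
        fun i _ => hf.sum_le_tsum _ fun _ _ => h0 _

/-- Each of the `n` factors `1 + |kᵢ|` is at most the bracket, so the power `2n` dominates the
product of their squares, and the sum splits into one-dimensional ones. -/
lemma summable_bracket : Summable fun k : Lattice n => (bracket k ^ (2 * n))⁻¹ := by
  have h1 : Summable fun z : ℤ => ((1 + |(z : ℝ)|) ^ 2)⁻¹ := by
    -- The comparison series `1 / z ^ 2` takes the value `0` at `z = 0`, hence the extra summand
    -- supported there.
    refine Summable.of_nonneg_of_le (fun z => by positivity) (fun z => ?_)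
      ((Real.summable_one_div_int_pow (p := 2)).2 one_lt_two |>.add
        (summable_of_ne_finset_zero (s := {0}) (f := fun z : ℤ => if z = 0 then (1 : ℝ) else 0)
          (by intro b hb; simpa using hb)))
    by_cases hz : z = 0
    · simp [hz]
    · have : 0 < |(z : ℝ)| := abs_pos.2 (by exact_mod_cast hz)
      simp only [hz, if_false, add_zero, one_div]
      rw [← sq_abs (z : ℝ)]
      gcongr
      linarith
  refine Summable.of_nonneg_of_le (fun k => inv_nonneg.2 (pow_nonneg (bracket_pos k).le _))
    (fun k => ?_) (summable_pi_prod (n := n) h1 fun z => by positivity)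
  rw [Finset.prod_inv_distrib, Finset.prod_pow, mul_comm 2 n, pow_mul]
  have hp : 0 < ∏ i, (1 + |(k i : ℝ)|) := Finset.prod_pos fun i _ => by positivity
  refine inv_anti₀ (pow_pos hp 2) (pow_le_pow_left₀ hp.le ?_ 2)
  · calc ∏ i, (1 + |(k i : ℝ)|) ≤ ∏ _i : Fin n, bracket k := by
          refine Finset.prod_le_prod (fun i _ => by positivity) fun i _ => ?_
          rw [bracket]
          gcongr
          exact Finset.single_le_sum (f := fun i => |(k i : ℝ)|) (fun _ _ => abs_nonneg _)
            (Finset.mem_univ i)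
      _ = bracket k ^ n := by simp

/-- Telescoping along lattice paths. -/
lemma norm_sub_le_of_step {E : Type*} [SeminormedAddCommGroup E] (F : Lattice n → E)
    (k : Lattice n) (G : ℝ) (η : Lattice n)
    (h : ∀ j (κ : Lattice n), bracket κ ≤ bracket η →
      ‖F (k + κ + Pi.single j 1) - F (k + κ)‖ ≤ G) :
    ‖F (k + η) - F k‖ ≤ (∑ i, |(η i : ℝ)|) * G := by
  obtain ⟨N, hN⟩ : ∃ N : ℕ, N = ∑ i, (η i).natAbs := ⟨_, rfl⟩
  induction N generalizing η with
  | zero =>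
    have : η = 0 := by
      ext i
      have := (Finset.sum_eq_zero_iff.1 hN.symm) i (Finset.mem_univ i)
      simpa using this
    simp [this]
  | succ N ih =>
    obtain ⟨i, hi⟩ : ∃ i, η i ≠ 0 := by
      by_contra! hc
      simp [hc] at hN
    -- `θ` is a neighbour of `η` one unit step closer to the origin; whichever sign `η i` has, such
    -- a neighbour reduces the claim to length `N`.
    have key : ∀ θ : Lattice n, (∀ l ≠ i, θ l = η l) → (θ i).natAbs + 1 = (η i).natAbs →
        ‖F (k + η) - F (k + θ)‖ ≤ G → ‖F (k + η) - F k‖ ≤ (∑ i, |(η i : ℝ)|) * G := by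
      intro θ h1 h2 h3
      have e1 : ∑ l, (θ l).natAbs + 1 = ∑ l, (η l).natAbs := by
        rw [← Finset.add_sum_erase _ _ (Finset.mem_univ i),
          ← Finset.add_sum_erase (a := i) Finset.univ (fun l => (η l).natAbs) (Finset.mem_univ i),
          ← h2, Finset.sum_congr rfl fun l hl => by rw [h1 l (Finset.ne_of_mem_erase hl)]]
        ring
      have e2 : ∑ l, |(θ l : ℝ)| + 1 = ∑ l, |(η l : ℝ)| := by
        have := congrArg (Nat.cast : ℕ → ℝ) e1
        push_cast [Nat.cast_natAbs] at this
        exact this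
      have hb : bracket θ ≤ bracket η := by
        rw [bracket, bracket, ← e2]; linarith
      have := ih θ (fun j κ hκ => h j κ (hκ.trans hb)) (by omega)
      calc ‖F (k + η) - F k‖ = ‖(F (k + η) - F (k + θ)) + (F (k + θ) - F k)‖ := by
            rw [sub_add_sub_cancel]
        _ ≤ G + (∑ i, |(θ i : ℝ)|) * G := (norm_add_le _ _).trans (add_le_add h3 this)
        _ = _ := by rw [← e2]; ring
    rcases lt_or_gt_of_ne hi with hneg | hpos
    · refine key (η + Pi.single i 1) (fun l hl => by simp [hl]) (by simp; omega) ?_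
      rw [norm_sub_rev, ← add_assoc]
      exact h i η le_rfl
    · refine key (η - Pi.single i 1) (fun l hl => by simp [hl]) (by simp; omega) ?_
      have := h i (η - Pi.single i 1) ?_
      · rwa [show k + (η - Pi.single i 1) + Pi.single i 1 = k + η by abel] at this
      · rw [bracket, bracket]
        refine add_le_add le_rfl (Finset.sum_le_sum fun l _ => ?_)
        by_cases hl : l = i
        · subst hl
          have : (1 : ℝ) ≤ η l := by exact_mod_cast hpos
          simp only [Pi.sub_apply, Pi.single_eq_same, Int.cast_sub, Int.cast_one]
          rw [abs_of_nonneg (by linarith), abs_of_nonneg (by linarith)]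
          linarith
        · simp [hl]

/-- The growth properties of a weight that the calculus uses. -/
structure TameWeight (Λ : Lattice n → ℝ) : Prop where
  pos : ∀ k, 0 < Λ k
  lower : ∃ c : ℝ, 0 < c ∧ ∀ k, c ≤ Λ k
  shift : ∀ s : ℝ, ∃ (C : ℝ) (q : ℕ), 0 < C ∧
    ∀ k η, Λ (k + η) ^ s ≤ C * bracket η ^ q * Λ k ^ s
  bracket_le : ∃ C t : ℝ, 0 < C ∧ ∀ k, bracket k ≤ C * Λ k ^ t
  le_bracket : ∀ s : ℝ, ∃ (C : ℝ) (q : ℕ), 0 < C ∧ ∀ k, Λ k ^ s ≤ C * bracket k ^ q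

/-- Discrete form of `d(Λ^ε) = ε Λ^(ε-1) dΛ`. Since `x = x^(1-ε) x^ε ≤ y^(1-ε) x^ε`, the product
`y^(1-ε) (y^ε - x^ε)` is at most `y - x`, and `y^(1-ε)` cancels. -/
lemma rpow_sub_rpow_le_of_sub_le {x y C ε : ℝ} (hx : 0 < x) (hxy : x ≤ y) (hε1 : ε ≤ 1)
    (h : y - x ≤ C * y ^ (1 - ε)) : y ^ ε - x ^ ε ≤ C := by
  have hy := hx.trans_le hxy
  have e1 : y = y ^ (1 - ε) * y ^ ε := by
    rw [← Real.rpow_add hy]; simp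
  have e2 : x = x ^ (1 - ε) * x ^ ε := by
    rw [← Real.rpow_add hx]; simp
  have h3 : x ^ (1 - ε) ≤ y ^ (1 - ε) := Real.rpow_le_rpow hx.le hxy (by linarith)
  have h4 : 0 < y ^ (1 - ε) := Real.rpow_pos_of_pos hy _
  have h5 : 0 < x ^ ε := Real.rpow_pos_of_pos hx _
  have : y ^ (1 - ε) * (y ^ ε - x ^ ε) ≤ y ^ (1 - ε) * C := by
    have : x ^ (1 - ε) * x ^ ε ≤ y ^ (1 - ε) * x ^ ε := by gcongr
    rw [mul_sub, ← e1]
    linarith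
  exact le_of_mul_le_mul_left this h4

lemma diffOp_single {G : Type*} [AddCommGroup G] (j : Fin n) (f : Lattice n → G) :
    diffOp (Pi.single j 1) f = fwdDiff (Pi.single j (1 : ℤ)) f := by
  have key : ∀ l : List (Fin n), l.Nodup →
      l.foldr (fun i g => (fwdDiff (Pi.single i (1 : ℤ)))^[(Pi.single j 1 : Fin n → ℕ) i] g) f =
        if j ∈ l then fwdDiff (Pi.single j (1 : ℤ)) f else f := by
    intro l hl
    induction l with
    | nil => simp
    | cons i l ih =>
      rw [List.foldr_cons, ih (List.nodup_cons.1 hl).2]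
      by_cases h : i = j
      · subst h
        simp [(List.nodup_cons.1 hl).1]
      · simp [h, Ne.symm h]
  rw [diffOp, key _ (List.nodup_finRange n), if_pos (List.mem_finRange j)]

/-- The weight condition with `α = eⱼ` and `γ = 0` bounds `Δⱼ Λ` by `Λ^(1-1/μ)`; a small power of
`Λ` is therefore Lipschitz on the lattice. -/
lemma IsWeight.exists_step {Λ : Lattice n → ℝ} {μ : ℝ} (h : IsWeight Λ μ) :
    ∃ ε C : ℝ, 0 < ε ∧ 0 < C ∧ (∀ k, 0 < Λ k) ∧
      ∀ j k, |Λ (k + Pi.single j 1) ^ ε - Λ k ^ ε| ≤ C := by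
  obtain ⟨μ₀, μ₁, C₀, C₁, hμ₀, h01, h1, hC₀, hC₁, hΛ, hd⟩ := h
  have hbase : ∀ k : Lattice n, 1 ≤ 1 + latticeNorm k := fun k => by
    linarith [latticeNorm_nonneg k]
  have hlow : ∀ k, C₀ ≤ Λ k := fun k => by
    refine le_trans ?_ (hΛ k).1
    have := Real.one_le_rpow (hbase k) hμ₀.le
    nlinarith
  have hpos : ∀ k, 0 < Λ k := fun k => hC₀.trans_le (hlow k)
  have hμ : 0 < μ := by linarith
  -- Capping at `1` keeps `1 - ε` nonnegative, so that `Λ^(1-ε)` is monotone in `Λ` even if `μ < 1`.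
  set ε : ℝ := min (1 / μ) 1 with hε
  have hε0 : 0 < ε := lt_min (by positivity) one_pos
  have hε1 : ε ≤ 1 := min_le_right _ _
  have hj : ∀ j : Fin n, ∃ C : ℝ, 0 < C ∧ ∀ k,
      |Λ (k + Pi.single j 1) - Λ k| ≤ C * Λ k ^ (1 - ε) := by
    intro j
    obtain ⟨C, hC, hk⟩ := hd (Pi.single j 1) 0 (fun i => by simp)
    -- The exponent `ε - 1/μ` is nonpositive and `Λ ≥ C₀`, so the surplus power of `Λ` is at most
    -- this constant.
    refine ⟨C * C₀ ^ (ε - 1 / μ), by positivity, fun k => ?_⟩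
    have h2 := hk k
    have e1 : multiLength (Pi.single j 1 : Fin n → ℕ) = 1 := by
      simp [multiLength]
    have e2 : latticeMonomial (0 : Fin n → ℕ) k = 1 := by simp [latticeMonomial]
    rw [add_zero, diffOp_single, e1, e2] at h2
    simp only [fwdDiff, Int.cast_one, one_mul, Nat.cast_one, mul_one] at h2
    refine h2.trans ?_
    rw [mul_assoc]
    gcongr
    have : Λ k ^ (1 - 1 / μ) = Λ k ^ (ε - 1 / μ) * Λ k ^ (1 - ε) := by
      rw [← Real.rpow_add (hpos k)]; congr 1; ring
    rw [this]
    refine mul_le_mul_of_nonneg_right ?_ (Real.rpow_nonneg (hpos k).le _)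
    exact Real.rpow_le_rpow_of_nonpos hC₀ (hlow k) (sub_nonpos.2 (min_le_left _ _))
  choose C hC hCk using hj
  refine ⟨ε, 1 + ∑ j, C j, hε0, ?_, hpos, fun j k => ?_⟩
  · have := Finset.sum_nonneg fun j (_ : j ∈ Finset.univ) => (hC j).le
    linarith
  · have hCj : C j ≤ 1 + ∑ j, C j := by
      have := Finset.single_le_sum (f := C) (fun i _ => (hC i).le) (Finset.mem_univ j)
      linarith
    refine le_trans ?_ hCj
    have hb := abs_le.1 (hCk j k)
    rcases le_total (Λ k) (Λ (k + Pi.single j 1)) with hle | hle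
    · rw [abs_of_nonneg (sub_nonneg.2 (Real.rpow_le_rpow (hpos _).le hle hε0.le))]
      refine rpow_sub_rpow_le_of_sub_le (hpos _) hle hε1 (hb.2.trans ?_)
      have := hC j
      gcongr
      · exact (hpos _).le
    · rw [abs_sub_comm, abs_of_nonneg (sub_nonneg.2 (Real.rpow_le_rpow (hpos _).le hle hε0.le))]
      exact rpow_sub_rpow_le_of_sub_le (hpos _) hle hε1 (by linarith [hb.1])

/-- A Lipschitz function that stays above a positive constant grows by at most a factor linear in
the bracket of the shift. Applied to `Λ^ε`; taking the `1/ε`-th power gives a polynomial factor. -/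
lemma IsWeight.exists_shift {Λ : Lattice n → ℝ} {μ : ℝ} (h : IsWeight Λ μ) :
    ∃ (C : ℝ) (q : ℕ), 1 ≤ C ∧ ∀ k η, Λ (k + η) ≤ C * bracket η ^ q * Λ k := by
  obtain ⟨ε, C, hε, hC, hpos, hstep⟩ := h.exists_step
  obtain ⟨μ₀, μ₁, C₀, C₁, hμ₀, h01, h1, hC₀, hC₁, hΛ, hd⟩ := h
  have hlow : ∀ k, C₀ ≤ Λ k := fun k => by
    refine le_trans ?_ (hΛ k).1
    have := Real.one_le_rpow (show 1 ≤ 1 + latticeNorm k by linarith [latticeNorm_nonneg k]) hμ₀.le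
    nlinarith
  set K : ℝ := 1 + C / C₀ ^ ε with hK
  have hC₀ε : 0 < C₀ ^ ε := Real.rpow_pos_of_pos hC₀ _
  have hK1 : 1 ≤ K := by rw [hK]; have : 0 ≤ C / C₀ ^ ε := by positivity
                         linarith
  have hv : ∀ k η, Λ (k + η) ^ ε ≤ K * bracket η * Λ k ^ ε := by
    intro k η
    have ht := norm_sub_le_of_step (fun k => Λ k ^ ε) k C η fun j κ _ => hstep j _
    have h2 := (abs_le.1 ht).2
    have h3 : C₀ ^ ε ≤ Λ k ^ ε := Real.rpow_le_rpow hC₀.le (hlow k) hε.le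
    have h4 : C ≤ C / C₀ ^ ε * Λ k ^ ε := by
      rw [div_mul_eq_mul_div, le_div_iff₀ hC₀ε]; gcongr
    have h5 : 0 ≤ ∑ i, |(η i : ℝ)| := Finset.sum_nonneg fun _ _ => abs_nonneg _
    have h6 : 0 ≤ C / C₀ ^ ε := by positivity
    have h7 : 0 < Λ k ^ ε := Real.rpow_pos_of_pos (hpos k) _
    rw [hK, bracket]
    have h8 : (∑ i, |(η i : ℝ)|) * C ≤ (∑ i, |(η i : ℝ)|) * (C / C₀ ^ ε * Λ k ^ ε) := by gcongr
    nlinarith [mul_nonneg h5 h7.le, mul_nonneg h6 h7.le]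
  obtain ⟨q, hq⟩ := exists_nat_ge (1 / ε)
  refine ⟨K ^ (1 / ε), q, Real.one_le_rpow hK1 (by positivity), fun k η => ?_⟩
  have hroot : ∀ k, Λ k = (Λ k ^ ε) ^ (1 / ε) := fun k => by
    rw [← Real.rpow_mul (hpos k).le, mul_one_div_cancel hε.ne', Real.rpow_one]
  have hb := one_le_bracket η
  calc Λ (k + η) = (Λ (k + η) ^ ε) ^ (1 / ε) := hroot _
    _ ≤ (K * bracket η * Λ k ^ ε) ^ (1 / ε) :=
        Real.rpow_le_rpow (Real.rpow_nonneg (hpos _).le _) (hv k η) (by positivity)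
    _ = K ^ (1 / ε) * bracket η ^ (1 / ε) * Λ k := by
        rw [Real.mul_rpow (by positivity) (Real.rpow_nonneg (hpos _).le _),
          Real.mul_rpow (by positivity) (by positivity), ← hroot]
    _ ≤ _ := by
        have := hpos k
        gcongr
        rw [← Real.rpow_natCast]
        exact Real.rpow_le_rpow_of_exponent_le hb hq

lemma IsWeight.tame {Λ : Lattice n → ℝ} {μ : ℝ} (h : IsWeight Λ μ) : TameWeight Λ := by
  obtain ⟨C, q, hC1, hsh⟩ := h.exists_shift
  obtain ⟨μ₀, μ₁, C₀, C₁, hμ₀, h01, h1, hC₀, hC₁, hΛ, hd⟩ := h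
  have hbase : ∀ k : Lattice n, 1 ≤ 1 + latticeNorm k := fun k => by
    linarith [latticeNorm_nonneg k]
  have hlow : ∀ k, C₀ ≤ Λ k := fun k => by
    refine le_trans ?_ (hΛ k).1
    have := Real.one_le_rpow (hbase k) hμ₀.le
    nlinarith
  have hpos : ∀ k, 0 < Λ k := fun k => hC₀.trans_le (hlow k)
  have hC0 : 0 < C := by linarith
  refine ⟨hpos, ⟨C₀, hC₀, hlow⟩, fun s => ?_, ?_, fun s => ?_⟩
  · obtain ⟨p, hp⟩ := exists_nat_ge (q * |s|)
    have hbs : ∀ η : Lattice n, (C * bracket η ^ q) ^ |s| ≤ C ^ |s| * bracket η ^ p := by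
      intro η
      have hb := one_le_bracket η
      rw [Real.mul_rpow hC0.le (by positivity), ← Real.rpow_natCast (bracket η) q,
        ← Real.rpow_mul (by positivity), ← Real.rpow_natCast]
      gcongr
    refine ⟨C ^ |s|, p, by positivity, fun k η => ?_⟩
    have hb := one_le_bracket η
    refine le_trans ?_ (mul_le_mul_of_nonneg_right (hbs η) (Real.rpow_nonneg (hpos k).le _))
    rcases le_total 0 s with hs | hs
    · rw [abs_of_nonneg hs, ← Real.mul_rpow (by positivity) (hpos k).le]
      exact Real.rpow_le_rpow (hpos _).le (hsh k η) hs
    -- For negative `s` the inequality is needed in reverse: shift back from `k + η` to `k`.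
    · have h2 := hsh (k + η) (-η)
      rw [add_neg_cancel_right, bracket_neg] at h2
      have h3 := Real.rpow_le_rpow (hpos _).le h2 (abs_nonneg s)
      rw [Real.mul_rpow (by positivity) (hpos _).le] at h3
      have e1 : ∀ k, Λ k ^ s = (Λ k ^ |s|)⁻¹ := fun k => by
        rw [abs_of_nonpos hs, Real.rpow_neg (hpos k).le, inv_inv]
      have p1 := Real.rpow_pos_of_pos (hpos k) |s|
      have p2 := Real.rpow_pos_of_pos (hpos (k + η)) |s|
      rw [e1, e1, ← div_eq_mul_inv, le_div_iff₀ p1, inv_mul_le_iff₀ p2, mul_comm]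
      exact h3
  · refine ⟨(n + 1) * C₀⁻¹ ^ (1 / μ₀), 1 / μ₀, by positivity, fun k => ?_⟩
    refine (bracket_le_latticeNorm k).trans ?_
    rw [mul_assoc]
    gcongr
    rw [← Real.mul_rpow (by positivity) (hpos k).le]
    have h3 : (1 + latticeNorm k) ^ μ₀ ≤ C₀⁻¹ * Λ k := by
      rw [← div_eq_inv_mul, le_div_iff₀ hC₀, mul_comm]
      exact (hΛ k).1
    have h0 : 0 ≤ 1 + latticeNorm k := by linarith [hbase k]
    calc 1 + latticeNorm k = ((1 + latticeNorm k) ^ μ₀) ^ (1 / μ₀) := by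
          rw [← Real.rpow_mul h0, mul_one_div_cancel hμ₀.ne', Real.rpow_one]
      _ ≤ _ := Real.rpow_le_rpow (Real.rpow_nonneg h0 _) h3 (by positivity)
  · rcases le_total 0 s with hs | hs
    · obtain ⟨p, hp⟩ := exists_nat_ge (μ₁ * s)
      refine ⟨C₁ ^ s, p, by positivity, fun k => ?_⟩
      have hb := one_le_bracket k
      calc Λ k ^ s ≤ (C₁ * bracket k ^ μ₁) ^ s := by
            refine Real.rpow_le_rpow (hpos k).le ((hΛ k).2.trans ?_) hs
            gcongr
            · linarith [hbase k]
            · exact hμ₀.le.trans h01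
            · exact latticeNorm_le_bracket k
        _ = C₁ ^ s * bracket k ^ (μ₁ * s) := by
            rw [Real.mul_rpow hC₁.le (by positivity), Real.rpow_mul (by positivity)]
        _ ≤ _ := by
            rw [← Real.rpow_natCast]
            gcongr
    · refine ⟨C₀ ^ s, 0, by positivity, fun k => ?_⟩
      rw [pow_zero, mul_one]
      exact Real.rpow_le_rpow_of_nonpos hC₀ (hlow k) hs

end

/-! ### Kernels, their order, and sums twisted by a shift. -/

section

variable {n : ℕ}

/-- A kernel `a k η`, to be thought of as the `η`-th Fourier coefficient of a symbol at `k`. -/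
abbrev Kernel (n : ℕ) : Type := Lattice n → Lattice n → ℂ

/-- The first difference in the direction `j`. -/
abbrev coordDiff {G : Type*} [AddCommGroup G] (j : Fin n) (f : Lattice n → G) : Lattice n → G :=
  fwdDiff (Pi.single j (1 : ℤ)) f

/-- The translate by the `j`-th basis vector. -/
def coordShift {G : Type*} (j : Fin n) (f : Lattice n → G) : Lattice n → G :=
  fun k => f (k + Pi.single j 1)

/-- The operator `kⱼ Δⱼ` on kernels. -/
def eulerDiff (j : Fin n) (a : Kernel n) : Kernel n := fun k η => (k j : ℂ) * coordDiff j a k η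

/-- Multiplication by the `j`-th frequency. -/
def freqMul (j : Fin n) (a : Kernel n) : Kernel n := fun k η => (η j : ℂ) * a k η

lemma coordDiff_eq {G : Type*} [AddCommGroup G] (j : Fin n) (f : Lattice n → G) :
    coordDiff j f = coordShift j f - f := rfl

lemma coordDiff_sub {G : Type*} [AddCommGroup G] (j : Fin n) (f g : Lattice n → G) :
    coordDiff j (f - g) = coordDiff j f - coordDiff j g := by
  ext k; simp only [coordDiff, fwdDiff, Pi.sub_apply]; abel

lemma coordDiff_coordShift {G : Type*} [AddCommGroup G] (i j : Fin n) (f : Lattice n → G) :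
    coordDiff i (coordShift j f) = coordShift j (coordDiff i f) := by
  ext k
  simp only [coordDiff, fwdDiff, coordShift]
  rw [add_right_comm]

lemma coordDiff_comm {G : Type*} [AddCommGroup G] (i j : Fin n) (f : Lattice n → G) :
    coordDiff i (coordDiff j f) = coordDiff j (coordDiff i f) := by
  rw [coordDiff_eq j f, coordDiff_sub, coordDiff_coordShift, ← coordDiff_eq]

lemma coordDiff_freqMul (i j : Fin n) (a : Kernel n) :
    coordDiff i (freqMul j a) = freqMul j (coordDiff i a) := by
  ext k η
  simp only [coordDiff, fwdDiff, freqMul, Pi.sub_apply]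
  ring

lemma eulerDiff_add (j : Fin n) (a b : Kernel n) :
    eulerDiff j (a + b) = eulerDiff j a + eulerDiff j b := by
  ext k η
  simp only [eulerDiff, coordDiff, fwdDiff, Pi.add_apply, Pi.sub_apply]
  ring

lemma eulerDiff_sub (j : Fin n) (a b : Kernel n) :
    eulerDiff j (a - b) = eulerDiff j a - eulerDiff j b := by
  ext k η
  simp only [eulerDiff, coordDiff, fwdDiff, Pi.sub_apply]
  ring

lemma eulerDiff_freqMul (i j : Fin n) (a : Kernel n) :
    eulerDiff i (freqMul j a) = freqMul j (eulerDiff i a) := by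
  ext k η
  simp only [eulerDiff, coordDiff, fwdDiff, freqMul, Pi.sub_apply]
  ring

lemma eulerDiff_coordShift_of_ne {i j : Fin n} (h : i ≠ j) (a : Kernel n) :
    eulerDiff i (coordShift j a) = coordShift j (eulerDiff i a) := by
  ext k η
  simp only [eulerDiff, coordDiff, fwdDiff, coordShift, Pi.sub_apply, Pi.add_apply,
    Pi.single_eq_of_ne h, add_zero]
  rw [add_right_comm]

/-- The commutator term arises because the shift also moves the coefficient `kⱼ` to `kⱼ + 1`. -/
lemma eulerDiff_coordShift_self (j : Fin n) (a : Kernel n) :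
    eulerDiff j (coordShift j a) =
      coordShift j (eulerDiff j a) - coordShift j (coordDiff j a) := by
  ext k η
  simp only [eulerDiff, coordDiff, fwdDiff, coordShift, Pi.sub_apply, Pi.add_apply,
    Pi.single_eq_same, Int.cast_add, Int.cast_one]
  ring

lemma eulerDiff_coordDiff_of_ne {i j : Fin n} (h : i ≠ j) (a : Kernel n) :
    eulerDiff i (coordDiff j a) = coordDiff j (eulerDiff i a) := by
  rw [coordDiff_eq, eulerDiff_sub, eulerDiff_coordShift_of_ne h, coordDiff_eq]

lemma eulerDiff_coordDiff_self (j : Fin n) (a : Kernel n) :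
    eulerDiff j (coordDiff j a) =
      coordDiff j (eulerDiff j a) - coordShift j (coordDiff j a) := by
  ext k η
  simp only [eulerDiff, coordDiff, fwdDiff, coordShift, Pi.sub_apply, Pi.add_apply,
    Pi.single_eq_same, Int.cast_add, Int.cast_one]
  ring

/-- `a` has order `m`: it is `O(Λ(k)^m)` with rapid decay in the frequency. -/
def HasOrder (Λ : Lattice n → ℝ) (m : ℝ) (a : Kernel n) : Prop :=
  ∀ N : ℕ, ∃ C : ℝ, ∀ k η, ‖a k η‖ * bracket η ^ N ≤ C * Λ k ^ m

/-- `b` has order `m` up to a polynomial loss in the second variable. -/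
def HasTwistedOrder (Λ : Lattice n → ℝ) (m : ℝ) (b : Lattice n → Kernel n) : Prop :=
  ∃ q : ℕ, ∀ N : ℕ, ∃ C : ℝ, ∀ k η ζ,
    ‖b k η ζ‖ * bracket ζ ^ N ≤ C * bracket η ^ q * Λ k ^ m

/-- `Σ_η a(k,η) b(k,η,ζ-η)`. -/
def twist (a : Kernel n) (b : Lattice n → Kernel n) : Kernel n :=
  fun k ζ => ∑' η, a k η * b k η (ζ - η)

section order

variable {Λ : Lattice n → ℝ} {m m₁ m₂ : ℝ} {a b : Kernel n}

lemma HasOrder.exists_pos (T : TameWeight Λ) (h : HasOrder Λ m a) (N : ℕ) :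
    ∃ C : ℝ, 0 < C ∧ ∀ k η, ‖a k η‖ * bracket η ^ N ≤ C * Λ k ^ m := by
  obtain ⟨C, hC⟩ := h N
  refine ⟨max C 1, by positivity, fun k η => (hC k η).trans ?_⟩
  have := Real.rpow_nonneg (T.pos k).le m
  gcongr
  exact le_max_left _ _

lemma HasOrder.zero : HasOrder Λ m (0 : Kernel n) :=
  fun N => ⟨0, fun k η => by simp⟩

lemma HasOrder.add (ha : HasOrder Λ m a) (hb : HasOrder Λ m b) : HasOrder Λ m (a + b) := by
  intro N
  obtain ⟨A, hA⟩ := ha N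
  obtain ⟨B, hB⟩ := hb N
  refine ⟨A + B, fun k η => ?_⟩
  have h0 : 0 ≤ bracket η ^ N := pow_nonneg (bracket_pos η).le N
  calc ‖a k η + b k η‖ * bracket η ^ N
      ≤ (‖a k η‖ + ‖b k η‖) * bracket η ^ N := by gcongr; exact norm_add_le _ _
    _ ≤ _ := by linarith [hA k η, hB k η]

lemma HasOrder.neg (ha : HasOrder Λ m a) : HasOrder Λ m (-a) := by
  intro N
  obtain ⟨A, hA⟩ := ha N
  exact ⟨A, fun k η => by simpa using hA k η⟩

lemma HasOrder.sub (ha : HasOrder Λ m a) (hb : HasOrder Λ m b) : HasOrder Λ m (a - b) := by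
  rw [sub_eq_add_neg]; exact ha.add hb.neg

lemma HasOrder.mono (T : TameWeight Λ) (hm : m₁ ≤ m₂) (ha : HasOrder Λ m₁ a) :
    HasOrder Λ m₂ a := by
  intro N
  obtain ⟨c, hc, hcΛ⟩ := T.lower
  obtain ⟨A, hA0, hA⟩ := ha.exists_pos T N
  refine ⟨A * c ^ (m₁ - m₂), fun k η => (hA k η).trans ?_⟩
  have e : Λ k ^ m₁ = Λ k ^ (m₁ - m₂) * Λ k ^ m₂ := by
    rw [← Real.rpow_add (T.pos k)]; congr 1; ring
  rw [e, mul_assoc]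
  refine mul_le_mul_of_nonneg_left (mul_le_mul_of_nonneg_right ?_
    (Real.rpow_nonneg (T.pos k).le _)) hA0.le
  exact Real.rpow_le_rpow_of_nonpos hc (hcΛ k) (by linarith)

lemma HasOrder.of_norm_le (ha : HasOrder Λ m a)
    (h : ∀ k η, ‖b k η‖ ≤ ‖a k η‖) : HasOrder Λ m b := by
  intro N
  obtain ⟨A, hA⟩ := ha N
  refine ⟨A, fun k η => le_trans ?_ (hA k η)⟩
  have h0 : 0 ≤ bracket η ^ N := pow_nonneg (bracket_pos η).le N
  gcongr
  exact h k η

lemma HasOrder.shift (T : TameWeight Λ) (j : Fin n) (ha : HasOrder Λ m a) :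
    HasOrder Λ m (coordShift j a) := by
  intro N
  obtain ⟨A, hA0, hA⟩ := ha.exists_pos T N
  obtain ⟨C, q, hC, h⟩ := T.shift m
  refine ⟨A * (C * 2 ^ q), fun k η => (hA _ η).trans ?_⟩
  have := h k (Pi.single j 1)
  rw [bracket_single] at this
  calc A * Λ (k + Pi.single j 1) ^ m ≤ A * (C * 2 ^ q * Λ k ^ m) := by gcongr
    _ = _ := by ring

lemma HasOrder.diff (T : TameWeight Λ) (j : Fin n) (ha : HasOrder Λ m a) :
    HasOrder Λ m (coordDiff j a) := (ha.shift T j).sub ha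

lemma HasOrder.freq (j : Fin n) (ha : HasOrder Λ m a) :
    HasOrder Λ m (freqMul j a) := by
  intro N
  obtain ⟨A, hA⟩ := ha (N + 1)
  refine ⟨A, fun k η => le_trans ?_ (hA k η)⟩
  have h0 : 0 ≤ bracket η ^ N := pow_nonneg (bracket_pos η).le N
  have h1 : ‖(η j : ℂ)‖ ≤ bracket η := by
    simpa using abs_coord_le_bracket η j
  calc ‖(η j : ℂ) * a k η‖ * bracket η ^ N ≤ bracket η * ‖a k η‖ * bracket η ^ N := by
        rw [norm_mul]; gcongr
    _ = _ := by ring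

/-- Crude bound: `|kⱼ|` is dominated by a power of `Λ`. The loss `t` does not depend on `m` or `a`,
which is all that approximation to arbitrarily low order requires. -/
lemma TameWeight.exists_eulerDiff_loss (T : TameWeight Λ) :
    ∃ t : ℝ, ∀ (m : ℝ) (a : Kernel n) (j : Fin n), HasOrder Λ m a →
      HasOrder Λ (m + t) (eulerDiff j a) := by
  obtain ⟨C, t, hC, h⟩ := T.bracket_le
  refine ⟨t, fun m a j ha N => ?_⟩
  obtain ⟨A, hA0, hA⟩ := (ha.diff T j).exists_pos T N
  refine ⟨C * A, fun k η => ?_⟩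
  have h1 : ‖(k j : ℂ)‖ ≤ C * Λ k ^ t := by
    refine le_trans ?_ (h k)
    simpa using abs_coord_le_bracket k j
  have h0 : 0 ≤ bracket η ^ N := pow_nonneg (bracket_pos η).le N
  have h2 := Real.rpow_nonneg (T.pos k).le t
  calc ‖(k j : ℂ) * coordDiff j a k η‖ * bracket η ^ N
      = ‖(k j : ℂ)‖ * (‖coordDiff j a k η‖ * bracket η ^ N) := by
        rw [norm_mul, mul_assoc]
    _ ≤ (C * Λ k ^ t) * (A * Λ k ^ m) := mul_le_mul h1 (hA k η) (by positivity) (by positivity)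
    _ = C * A * Λ k ^ (m + t) := by rw [Real.rpow_add (T.pos k)]; ring

lemma twist_term_bound (T : TameWeight Λ) {b : Lattice n → Kernel n}
    (ha : HasOrder Λ m₁ a) (hb : HasTwistedOrder Λ m₂ b) (N : ℕ) :
    ∃ C : ℝ, 0 ≤ C ∧ ∀ k ζ η, ‖a k η * b k η (ζ - η)‖ ≤
      C * Λ k ^ (m₁ + m₂) * (bracket ζ ^ N)⁻¹ * (bracket η ^ (2 * n))⁻¹ := by
  obtain ⟨q, hb⟩ := hb
  obtain ⟨B, hB⟩ := hb N
  -- `N` powers pass to `ζ` through the Peetre inequality, `q` pay for the loss in `b`, and `2n`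
  -- make the sum over `η` converge.
  obtain ⟨A, hA0, hA⟩ := ha.exists_pos T (N + q + 2 * n)
  have hB0 : 0 ≤ B := by
    by_contra! hneg
    have h1 := hB 0 0 0
    have h2 : 0 < bracket (0 : Lattice n) ^ q * Λ 0 ^ m₂ :=
      mul_pos (pow_pos (bracket_pos _) _) (Real.rpow_pos_of_pos (T.pos _) _)
    have h3 : 0 ≤ ‖b 0 0 0‖ * bracket (0 : Lattice n) ^ N :=
      mul_nonneg (norm_nonneg _) (pow_nonneg (bracket_pos _).le _)
    nlinarith
  refine ⟨A * B, by positivity, fun k ζ η => ?_⟩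
  have p1 := bracket_pos η
  have p2 := bracket_pos ζ
  have p3 := bracket_pos (ζ - η)
  have hk1 := Real.rpow_pos_of_pos (T.pos k) m₁
  have hk2 := Real.rpow_pos_of_pos (T.pos k) m₂
  have hsub : bracket ζ ^ N ≤ bracket η ^ N * bracket (ζ - η) ^ N := by
    rw [← mul_pow]
    refine pow_le_pow_left₀ p2.le ?_ N
    simpa using bracket_add_le η (ζ - η)
  rw [← div_eq_mul_inv, ← div_eq_mul_inv, le_div_iff₀ (by positivity), le_div_iff₀ (by positivity),
    norm_mul, Real.rpow_add (T.pos k)]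
  have h1 := hA k η
  have h2 := hB k η (ζ - η)
  have hq : 0 < bracket η ^ q := by positivity
  refine le_of_mul_le_mul_right ?_ hq
  calc ‖a k η‖ * ‖b k η (ζ - η)‖ * bracket η ^ (2 * n) * bracket ζ ^ N * bracket η ^ q
      ≤ ‖a k η‖ * ‖b k η (ζ - η)‖ * bracket η ^ (2 * n) *
          (bracket η ^ N * bracket (ζ - η) ^ N) * bracket η ^ q := by gcongr
    _ = (‖a k η‖ * bracket η ^ (N + q + 2 * n)) *
          (‖b k η (ζ - η)‖ * bracket (ζ - η) ^ N) := by rw [pow_add, pow_add]; ring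
    _ ≤ (A * Λ k ^ m₁) * (B * bracket η ^ q * Λ k ^ m₂) := by gcongr
    _ = A * B * (Λ k ^ m₁ * Λ k ^ m₂) * bracket η ^ q := by ring

lemma summable_twist (T : TameWeight Λ) {b : Lattice n → Kernel n}
    (ha : HasOrder Λ m₁ a) (hb : HasTwistedOrder Λ m₂ b) (k ζ : Lattice n) :
    Summable fun η => a k η * b k η (ζ - η) := by
  obtain ⟨C, -, hC⟩ := twist_term_bound T ha hb 0
  exact Summable.of_norm_bounded (summable_bracket.mul_left _) (hC k ζ)

lemma HasOrder.twisted_sum (T : TameWeight Λ) {b : Lattice n → Kernel n}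
    (ha : HasOrder Λ m₁ a) (hb : HasTwistedOrder Λ m₂ b) :
    HasOrder Λ (m₁ + m₂) (twist a b) := by
  intro N
  obtain ⟨C, hC0, hC⟩ := twist_term_bound T ha hb N
  refine ⟨C * ∑' η : Lattice n, (bracket η ^ (2 * n))⁻¹, fun k ζ => ?_⟩
  have p2 : 0 < bracket ζ ^ N := pow_pos (bracket_pos ζ) N
  have := tsum_of_norm_bounded (summable_bracket.hasSum.mul_left _) (hC k ζ)
  calc ‖twist a b k ζ‖ * bracket ζ ^ N
      ≤ (C * Λ k ^ (m₁ + m₂) * (bracket ζ ^ N)⁻¹ * ∑' η : Lattice n, (bracket η ^ (2 * n))⁻¹) *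
          bracket ζ ^ N := by gcongr; exact this
    _ = _ := by field_simp

lemma HasOrder.twisted_comp (T : TameWeight Λ) (hb : HasOrder Λ m b) :
    HasTwistedOrder Λ m fun k η => b (k + η) := by
  obtain ⟨C, q, hC, h⟩ := T.shift m
  refine ⟨q, fun N => ?_⟩
  obtain ⟨B, hB0, hB⟩ := hb.exists_pos T N
  refine ⟨B * C, fun k η ζ => (hB _ ζ).trans ?_⟩
  calc B * Λ (k + η) ^ m ≤ B * (C * bracket η ^ q * Λ k ^ m) := by gcongr; exact h k η
    _ = _ := by ring

lemma HasOrder.twisted_const (hb : HasOrder Λ m b) :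
    HasTwistedOrder Λ m fun k _ => b k :=
  ⟨0, fun N => (hb N).imp fun B hB k _ ζ => by simpa using hB k ζ⟩

/-- Telescoping from `k` to `k + η`: each step is a first difference of `b` at a point `k + κ` with
`bracket κ ≤ bracket η`, where moderate growth applies. The path length costs one further power of
`bracket η`. This is the source of the gain `ρ` in the calculus. -/
lemma HasOrder.twisted_defect (T : TameWeight Λ) (hb : ∀ j, HasOrder Λ m (coordDiff j b)) :
    HasTwistedOrder Λ m fun k η => b (k + η) - b k := by
  obtain ⟨C, q, hC, h⟩ := T.shift m
  refine ⟨q + 1, fun N => ?_⟩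
  choose B hB0 hB using fun j => (hb j).exists_pos T N
  refine ⟨(∑ j, B j) * C, fun k η ζ => ?_⟩
  have p1 : 0 < bracket ζ ^ N := pow_pos (bracket_pos ζ) N
  have hη := bracket_pos η
  have hk := Real.rpow_pos_of_pos (T.pos k) m
  have hS : 0 ≤ ∑ j, B j := Finset.sum_nonneg fun j _ => (hB0 j).le
  have := norm_sub_le_of_step (fun k => b k ζ) k
    ((∑ j, B j) * (C * bracket η ^ q * Λ k ^ m) / bracket ζ ^ N) η fun j κ hκ => by
      rw [le_div_iff₀ p1]
      refine (hB j (k + κ) ζ).trans ?_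
      have h1 : B j ≤ ∑ j, B j :=
        Finset.single_le_sum (f := B) (fun i _ => (hB0 i).le) (Finset.mem_univ j)
      have h2 := Real.rpow_nonneg (T.pos (k + κ)).le m
      refine mul_le_mul h1 ((h k κ).trans ?_) h2 hS
      have := bracket_pos κ
      gcongr
  have h3 : ∑ i, |(η i : ℝ)| ≤ bracket η := le_add_of_nonneg_left zero_le_one
  calc ‖(b (k + η) - b k) ζ‖ * bracket ζ ^ N
      ≤ (∑ i, |(η i : ℝ)|) * ((∑ j, B j) * (C * bracket η ^ q * Λ k ^ m) / bracket ζ ^ N) *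
          bracket ζ ^ N := by gcongr; exact this
    _ = (∑ i, |(η i : ℝ)|) * ((∑ j, B j) * (C * bracket η ^ q * Λ k ^ m)) := by field_simp
    _ ≤ bracket η * ((∑ j, B j) * (C * bracket η ^ q * Λ k ^ m)) := by gcongr
    _ = _ := by ring

end order

/-- Composition of kernels. -/
def comp (a b : Kernel n) : Kernel n := twist a fun k η => b (k + η)

/-- Convolution of kernels in the frequency. -/
def conv (a b : Kernel n) : Kernel n := twist a fun k _ => b k

/-- The difference between composition and convolution. -/
def defect (a b : Kernel n) : Kernel n := twist a fun k η => b (k + η) - b k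

/-- The discrete Leibniz rule `Δ(ab) = (Δa) b + (shift a) Δb`, summed over `η`. -/
lemma coordDiff_twist {Λ : Lattice n → ℝ} {m₁ m₂ m₃ : ℝ} {a : Kernel n} {b : Lattice n → Kernel n}
    (T : TameWeight Λ) (j : Fin n) (ha : HasOrder Λ m₁ a) (hb : HasTwistedOrder Λ m₂ b)
    (hb' : HasTwistedOrder Λ m₃ (coordDiff j b)) :
    coordDiff j (twist a b) =
      twist (coordDiff j a) b + twist (coordShift j a) (coordDiff j b) := by
  ext k ζ
  have s1 := summable_twist T (ha.diff T j) hb k ζ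
  have s2 := summable_twist T (ha.shift T j) hb' k ζ
  have s3 := summable_twist T ha hb k ζ
  have s4 : Summable fun η =>
      a (k + Pi.single j 1) η * b (k + Pi.single j 1) η (ζ - η) :=
    summable_twist T ha hb _ ζ
  simp only [Pi.add_apply, twist]
  rw [← s1.tsum_add s2]
  simp only [coordDiff, fwdDiff, Pi.sub_apply, coordShift]
  simp only [twist]
  rw [← s4.tsum_sub s3]
  congr 1
  ext η
  ring

end

/-! ### Calculus of kernels with differences and with the operators `kⱼ Δⱼ`. -/

section

variable {n : ℕ}

/-- Up to `p` differences of `a` have the expected order, each difference gaining `ρ`. -/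
def DiffOrder (Λ : Lattice n → ℝ) (ρ : ℝ) : ℕ → ℝ → Kernel n → Prop
  | 0, m, a => HasOrder Λ m a
  | p + 1, m, a => HasOrder Λ m a ∧ ∀ j, DiffOrder Λ ρ p (m - ρ) (coordDiff j a)

/-- All products of distinct operators `kⱼ Δⱼ` with `j` in the list send `a` to kernels all of
whose differences have the order expected of a kernel of order `m`. -/
def EulerOrder (Λ : Lattice n → ℝ) (ρ : ℝ) : List (Fin n) → ℝ → Kernel n → Prop
  | [], m, a => ∀ p, DiffOrder Λ ρ p m a
  | j :: L, m, a => EulerOrder Λ ρ L m a ∧ EulerOrder Λ ρ L m (eulerDiff j a)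

section diffOrder

variable {Λ : Lattice n → ℝ} {ρ : ℝ}

lemma DiffOrder.hasOrder {p : ℕ} {m : ℝ} {a : Kernel n} (h : DiffOrder Λ ρ p m a) :
    HasOrder Λ m a := by
  cases p with
  | zero => exact h
  | succ p => exact h.1

lemma DiffOrder.of_succ {p : ℕ} {m : ℝ} {a : Kernel n} (h : DiffOrder Λ ρ (p + 1) m a) :
    DiffOrder Λ ρ p m a := by
  induction p generalizing m a with
  | zero => exact h.1
  | succ p ih => exact ⟨h.1, fun j => ih (h.2 j)⟩

lemma DiffOrder.of_le {p q : ℕ} (hpq : p ≤ q) {m : ℝ} {a : Kernel n}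
    (h : DiffOrder Λ ρ q m a) : DiffOrder Λ ρ p m a := by
  induction hpq with
  | refl => exact h
  | step _ ih => exact ih h.of_succ

lemma DiffOrder.mono (T : TameWeight Λ) {p : ℕ} {m₁ m₂ : ℝ} (hm : m₁ ≤ m₂) {a : Kernel n}
    (h : DiffOrder Λ ρ p m₁ a) : DiffOrder Λ ρ p m₂ a := by
  induction p generalizing m₁ m₂ a with
  | zero => exact HasOrder.mono T hm h
  | succ p ih => exact ⟨h.1.mono T hm, fun j => ih (by linarith) (h.2 j)⟩

lemma DiffOrder.add {p : ℕ} {m : ℝ} {a b : Kernel n} (ha : DiffOrder Λ ρ p m a)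
    (hb : DiffOrder Λ ρ p m b) : DiffOrder Λ ρ p m (a + b) := by
  induction p generalizing m a b with
  | zero => exact HasOrder.add ha hb
  | succ p ih =>
    refine ⟨ha.1.add hb.1, fun j => ?_⟩
    rw [coordDiff, fwdDiff_add]
    exact ih (ha.2 j) (hb.2 j)

lemma DiffOrder.neg {p : ℕ} {m : ℝ} {a : Kernel n} (ha : DiffOrder Λ ρ p m a) :
    DiffOrder Λ ρ p m (-a) := by
  induction p generalizing m a with
  | zero => exact HasOrder.neg ha
  | succ p ih =>
    refine ⟨ha.1.neg, fun j => ?_⟩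
    rw [show coordDiff j (-a) = -coordDiff j a by
      ext k η; simp only [coordDiff, fwdDiff, Pi.neg_apply, Pi.sub_apply]; ring]
    exact ih (ha.2 j)

lemma DiffOrder.coordShift (T : TameWeight Λ) (i : Fin n) {p : ℕ} {m : ℝ} {a : Kernel n}
    (ha : DiffOrder Λ ρ p m a) : DiffOrder Λ ρ p m (coordShift i a) := by
  induction p generalizing m a with
  | zero => exact HasOrder.shift T i ha
  | succ p ih =>
    refine ⟨ha.1.shift T i, fun j => ?_⟩
    rw [coordDiff_coordShift]
    exact ih (ha.2 j)

lemma DiffOrder.freqMul (i : Fin n) {p : ℕ} {m : ℝ} {a : Kernel n}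
    (ha : DiffOrder Λ ρ p m a) : DiffOrder Λ ρ p m (freqMul i a) := by
  induction p generalizing m a with
  | zero => exact HasOrder.freq i ha
  | succ p ih =>
    refine ⟨ha.1.freq i, fun j => ?_⟩
    rw [coordDiff_freqMul]
    exact ih (ha.2 j)

/-- Common induction for `comp`, `conv` and `defect`. The map `Φ` commutes with differences,
consumes `r` differences of `b` and gains `δ`: `r = 0`, `δ = 0` for the first two, `r = 1`, `δ = ρ`
for the defect. -/
lemma DiffOrder.twisted_sum (T : TameWeight Λ) {Φ : Kernel n → Lattice n → Kernel n} {r : ℕ}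
    {δ : ℝ} (hΦd : ∀ j b, coordDiff j (Φ b) = Φ (coordDiff j b))
    (hΦ : ∀ m b, DiffOrder Λ ρ r m b → HasTwistedOrder Λ (m - δ) (Φ b))
    {p : ℕ} {m₁ m₂ : ℝ} {a b : Kernel n} (ha : DiffOrder Λ ρ p m₁ a)
    (hb : DiffOrder Λ ρ (p + r) m₂ b) : DiffOrder Λ ρ p (m₁ + m₂ - δ) (twist a (Φ b)) := by
  induction p generalizing m₁ m₂ a b with
  | zero =>
    rw [add_sub_assoc]
    exact HasOrder.twisted_sum T ha (hΦ _ _ (hb.of_le (by omega)))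
  | succ p ih =>
    have h0 := hΦ _ _ (hb.of_le (show r ≤ p + 1 + r by omega))
    rw [show p + 1 + r = p + r + 1 by omega] at hb
    refine ⟨?_, fun j => ?_⟩
    · rw [add_sub_assoc]
      exact HasOrder.twisted_sum T ha.hasOrder h0
    · have h1 := hΦ _ _ ((hb.2 j).of_le (show r ≤ p + r by omega))
      rw [coordDiff_twist T j ha.hasOrder h0 (by rw [hΦd]; exact h1), hΦd]
      refine DiffOrder.add ?_ ?_
      · rw [show m₁ + m₂ - δ - ρ = (m₁ - ρ) + m₂ - δ by ring]
        exact ih (ha.2 j) hb.of_succ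
      · rw [show m₁ + m₂ - δ - ρ = m₁ + (m₂ - ρ) - δ by ring]
        exact ih (ha.of_succ.coordShift T j) (hb.2 j)

lemma coordDiff_twisted_comp (j : Fin n) (b : Kernel n) :
    coordDiff j (fun k η => b (k + η)) = fun k η => coordDiff j b (k + η) := by
  ext k η ζ
  simp only [coordDiff, fwdDiff, Pi.sub_apply]
  rw [add_right_comm]

lemma coordDiff_twisted_const (j : Fin n) (b : Kernel n) :
    coordDiff j (fun k (_ : Lattice n) => b k) = fun k _ => coordDiff j b k := rfl

lemma coordDiff_twisted_defect (j : Fin n) (b : Kernel n) :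
    coordDiff j (fun k η => b (k + η) - b k) =
      fun k η => coordDiff j b (k + η) - coordDiff j b k := by
  ext k η ζ
  simp only [coordDiff, fwdDiff, Pi.sub_apply]
  rw [add_right_comm k]
  ring

lemma DiffOrder.comp (T : TameWeight Λ) {p : ℕ} {m₁ m₂ : ℝ} {a b : Kernel n}
    (ha : DiffOrder Λ ρ p m₁ a) (hb : DiffOrder Λ ρ p m₂ b) :
    DiffOrder Λ ρ p (m₁ + m₂) (comp a b) := by
  simpa using! DiffOrder.twisted_sum (r := 0) (δ := 0) (Φ := fun b k η => b (k + η)) T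
    coordDiff_twisted_comp (fun m b hb => by simpa using hb.hasOrder.twisted_comp T) ha hb

lemma DiffOrder.conv (T : TameWeight Λ) {p : ℕ} {m₁ m₂ : ℝ} {a b : Kernel n}
    (ha : DiffOrder Λ ρ p m₁ a) (hb : DiffOrder Λ ρ p m₂ b) :
    DiffOrder Λ ρ p (m₁ + m₂) (conv a b) := by
  simpa using! DiffOrder.twisted_sum (r := 0) (δ := 0) (Φ := fun b k _ => b k) T
    coordDiff_twisted_const (fun m b hb => by simpa using hb.hasOrder.twisted_const) ha hb

lemma DiffOrder.defect (T : TameWeight Λ) {p : ℕ} {m₁ m₂ : ℝ} {a b : Kernel n}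
    (ha : DiffOrder Λ ρ p m₁ a) (hb : DiffOrder Λ ρ (p + 1) m₂ b) :
    DiffOrder Λ ρ p (m₁ + m₂ - ρ) (defect a b) :=
  DiffOrder.twisted_sum (r := 1) (Φ := fun b k η => b (k + η) - b k) T
    coordDiff_twisted_defect (fun _ _ hb => HasOrder.twisted_defect T hb.2) ha hb

end diffOrder

section eulerOrder

variable {Λ : Lattice n → ℝ} {ρ : ℝ}

lemma EulerOrder.diffOrder {L : List (Fin n)} {m : ℝ} {a : Kernel n}
    (h : EulerOrder Λ ρ L m a) (p : ℕ) : DiffOrder Λ ρ p m a := by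
  induction L with
  | nil => exact h p
  | cons j L ih => exact ih h.1

lemma EulerOrder.hasOrder {L : List (Fin n)} {m : ℝ} {a : Kernel n}
    (h : EulerOrder Λ ρ L m a) : HasOrder Λ m a := h.diffOrder 0

lemma EulerOrder.mono (T : TameWeight Λ) {L : List (Fin n)} {m₁ m₂ : ℝ} (hm : m₁ ≤ m₂)
    {a : Kernel n} (h : EulerOrder Λ ρ L m₁ a) : EulerOrder Λ ρ L m₂ a := by
  induction L generalizing a with
  | nil => exact fun p => (h p).mono T hm
  | cons j L ih => exact ⟨ih h.1, ih h.2⟩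

lemma EulerOrder.add {L : List (Fin n)} {m : ℝ} {a b : Kernel n}
    (ha : EulerOrder Λ ρ L m a) (hb : EulerOrder Λ ρ L m b) : EulerOrder Λ ρ L m (a + b) := by
  induction L generalizing a b with
  | nil => exact fun p => (ha p).add (hb p)
  | cons j L ih => exact ⟨ih ha.1 hb.1, by rw [eulerDiff_add]; exact ih ha.2 hb.2⟩

lemma eulerDiff_neg (j : Fin n) (a : Kernel n) : eulerDiff j (-a) = -eulerDiff j a := by
  ext k η
  simp only [eulerDiff, coordDiff, fwdDiff, Pi.neg_apply, Pi.sub_apply]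
  ring

lemma EulerOrder.neg {L : List (Fin n)} {m : ℝ} {a : Kernel n}
    (ha : EulerOrder Λ ρ L m a) : EulerOrder Λ ρ L m (-a) := by
  induction L generalizing a with
  | nil => exact fun p => (ha p).neg
  | cons j L ih => exact ⟨ih ha.1, by rw [eulerDiff_neg]; exact ih ha.2⟩

lemma EulerOrder.sub {L : List (Fin n)} {m : ℝ} {a b : Kernel n}
    (ha : EulerOrder Λ ρ L m a) (hb : EulerOrder Λ ρ L m b) : EulerOrder Λ ρ L m (a - b) := by
  rw [sub_eq_add_neg]; exact ha.add hb.neg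

lemma EulerOrder.freqMul (i : Fin n) {L : List (Fin n)} {m : ℝ} {a : Kernel n}
    (ha : EulerOrder Λ ρ L m a) : EulerOrder Λ ρ L m (freqMul i a) := by
  induction L generalizing a with
  | nil => exact fun p => (ha p).freqMul i
  | cons j L ih => exact ⟨ih ha.1, by rw [eulerDiff_freqMul]; exact ih ha.2⟩

/-- The commutators of `kⱼ Δⱼ` with the `j`-th shift and with `Δⱼ` both contain the shifted
difference, so the two statements are proved by one induction. -/
lemma EulerOrder.shift_and_diff (T : TameWeight Λ) (hρ : 0 ≤ ρ) (i : Fin n) (L : List (Fin n)) :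
    (∀ (m : ℝ) (a : Kernel n), EulerOrder Λ ρ L m a → EulerOrder Λ ρ L m (coordShift i a)) ∧
    ∀ (m : ℝ) (a : Kernel n), EulerOrder Λ ρ L m a → EulerOrder Λ ρ L (m - ρ) (coordDiff i a) := by
  induction L with
  | nil =>
    exact ⟨fun m a ha p => (ha p).coordShift T i, fun m a ha p => (ha (p + 1)).2 i⟩
  | cons j L ih =>
    obtain ⟨ihs, ihd⟩ := ih
    refine ⟨fun m a ha => ⟨ihs m a ha.1, ?_⟩, fun m a ha => ⟨ihd m a ha.1, ?_⟩⟩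
    · by_cases h : j = i
      · subst h
        rw [eulerDiff_coordShift_self]
        exact (ihs _ _ ha.2).sub (ihs _ _ ((ihd _ _ ha.1).mono T (by linarith)))
      · rw [eulerDiff_coordShift_of_ne h]
        exact ihs _ _ ha.2
    · by_cases h : j = i
      · subst h
        rw [eulerDiff_coordDiff_self]
        exact (ihd _ _ ha.2).sub (ihs _ _ (ihd _ _ ha.1))
      · rw [eulerDiff_coordDiff_of_ne h]
        exact ihd _ _ ha.2

lemma EulerOrder.coordShift (T : TameWeight Λ) (hρ : 0 ≤ ρ) (i : Fin n) {L : List (Fin n)}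
    {m : ℝ} {a : Kernel n} (ha : EulerOrder Λ ρ L m a) : EulerOrder Λ ρ L m (coordShift i a) :=
  (EulerOrder.shift_and_diff T hρ i L).1 m a ha

lemma EulerOrder.coordDiff (T : TameWeight Λ) (hρ : 0 ≤ ρ) (i : Fin n) {L : List (Fin n)}
    {m : ℝ} {a : Kernel n} (ha : EulerOrder Λ ρ L m a) :
    EulerOrder Λ ρ L (m - ρ) (coordDiff i a) :=
  (EulerOrder.shift_and_diff T hρ i L).2 m a ha

/-- The Leibniz rule for `kⱼ Δⱼ`, given the rule for moving `kⱼ` past the first factor. -/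
lemma eulerDiff_twist (T : TameWeight Λ) {m₁ m₂ m₃ m₄ m₅ : ℝ} (j : Fin n) {a : Kernel n}
    {b b₁ b₂ : Lattice n → Kernel n} (ha : HasOrder Λ m₁ a) (hb : HasTwistedOrder Λ m₂ b)
    (hb' : HasTwistedOrder Λ m₃ (coordDiff j b)) (hb₁ : HasTwistedOrder Λ m₄ b₁)
    (hb₂ : HasTwistedOrder Λ m₅ b₂)
    (h : ∀ k η ζ, (k j : ℂ) * coordDiff j b k η ζ = b₁ k η ζ - (η j : ℂ) * b₂ k η ζ) :
    eulerDiff j (twist a b) = twist (eulerDiff j a) b + twist (coordShift j a) b₁ -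
      twist (freqMul j (coordShift j a)) b₂ := by
  ext k ζ
  have s2 := summable_twist T (ha.shift T j) hb₁ k ζ
  have s3 := summable_twist T ((ha.shift T j).freq j) hb₂ k ζ
  rw [eulerDiff, coordDiff_twist T j ha hb hb']
  simp only [Pi.add_apply, Pi.sub_apply, mul_add, add_sub_assoc]
  congr 1
  · simp only [twist, eulerDiff, ← tsum_mul_left, mul_assoc]
  · simp only [twist]
    rw [← s2.tsum_sub s3, ← tsum_mul_left]
    congr 1
    ext η
    rw [mul_left_comm, h, freqMul]
    ring

/-- The coefficient `kⱼ` is moved onto the shifted factor by `kⱼ = (kⱼ + ηⱼ) - ηⱼ`: the first part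
forms `kⱼ Δⱼ b` at `k + η`, and `ηⱼ` is absorbed by the frequency decay of `a`. -/
lemma EulerOrder.comp (T : TameWeight Λ) (hρ : 0 ≤ ρ) {L : List (Fin n)} {m₁ m₂ : ℝ}
    {a b : Kernel n} (ha : EulerOrder Λ ρ L m₁ a) (hb : EulerOrder Λ ρ L m₂ b) :
    EulerOrder Λ ρ L (m₁ + m₂) (comp a b) := by
  induction L generalizing a b with
  | nil => exact fun p => (ha p).comp T (hb p)
  | cons j L ih =>
    have hd := (hb.1.coordDiff T hρ j).mono T (show m₂ - ρ ≤ m₂ by linarith)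
    have key : eulerDiff j (LatticePDO.comp a b) = LatticePDO.comp (eulerDiff j a) b +
        LatticePDO.comp (LatticePDO.coordShift j a) (eulerDiff j b) -
        LatticePDO.comp (LatticePDO.freqMul j (LatticePDO.coordShift j a))
          (LatticePDO.coordDiff j b) := by
      refine eulerDiff_twist T (m₃ := m₂) j ha.1.hasOrder (hb.1.hasOrder.twisted_comp T) ?_
        (hb.2.hasOrder.twisted_comp T) (hd.hasOrder.twisted_comp T) ?_
      · rw [coordDiff_twisted_comp]
        exact hd.hasOrder.twisted_comp T
      · intro k η ζ
        rw [coordDiff_twisted_comp, eulerDiff]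
        simp only [Pi.add_apply, Int.cast_add]
        ring
    refine ⟨ih ha.1 hb.1, ?_⟩
    rw [key]
    exact ((ih ha.2 hb.1).add (ih (ha.1.coordShift T hρ j) hb.2)).sub
      (ih ((ha.1.coordShift T hρ j).freqMul j) hd)

lemma eulerDiff_conv (T : TameWeight Λ) {m₁ m₂ m₃ : ℝ} (j : Fin n) {a b : Kernel n}
    (ha : HasOrder Λ m₁ a) (hb : HasOrder Λ m₂ b) (hb' : HasOrder Λ m₃ (eulerDiff j b)) :
    eulerDiff j (conv a b) = conv (eulerDiff j a) b + conv (coordShift j a) (eulerDiff j b) := by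
  have hz : HasTwistedOrder Λ m₂ (0 : Lattice n → Kernel n) := ⟨0, fun N => ⟨0, by simp⟩⟩
  have h := eulerDiff_twist T j ha hb.twisted_const (b₁ := fun k _ => eulerDiff j b k) (b₂ := 0)
    (hb.diff T j).twisted_const hb'.twisted_const hz
    (by intro k η ζ; rw [coordDiff_twisted_const, eulerDiff]; simp)
  rw [conv, h]
  have : twist (freqMul j (coordShift j a)) (0 : Lattice n → Kernel n) = 0 := by
    ext k ζ; simp [twist]
  rw [this, sub_zero]
  rfl

lemma EulerOrder.conv (T : TameWeight Λ) (hρ : 0 ≤ ρ) {L : List (Fin n)} {m₁ m₂ : ℝ}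
    {a b : Kernel n} (ha : EulerOrder Λ ρ L m₁ a) (hb : EulerOrder Λ ρ L m₂ b) :
    EulerOrder Λ ρ L (m₁ + m₂) (conv a b) := by
  induction L generalizing a b with
  | nil => exact fun p => (ha p).conv T (hb p)
  | cons j L ih =>
    refine ⟨ih ha.1 hb.1, ?_⟩
    rw [eulerDiff_conv T j ha.1.hasOrder hb.1.hasOrder hb.2.hasOrder]
    exact (ih ha.2 hb.1).add (ih (ha.1.coordShift T hρ j) hb.2)

/-- As for `comp`, Leibniz leaves two defects and one composition. The latter has `Δⱼ b` as second
factor, so it too gains `ρ`. -/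
lemma EulerOrder.defect (T : TameWeight Λ) (hρ : 0 ≤ ρ) {L : List (Fin n)} {m₁ m₂ : ℝ}
    {a b : Kernel n} (ha : EulerOrder Λ ρ L m₁ a) (hb : EulerOrder Λ ρ L m₂ b) :
    EulerOrder Λ ρ L (m₁ + m₂ - ρ) (defect a b) := by
  induction L generalizing a b with
  | nil => exact fun p => (ha p).defect T (hb (p + 1))
  | cons j L ih =>
    have hd := hb.1.coordDiff T hρ j
    have hdd : ∀ {b : Kernel n}, EulerOrder Λ ρ L m₂ b →
        HasTwistedOrder Λ (m₂ - ρ) fun k η => b (k + η) - b k := fun hb =>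
      HasOrder.twisted_defect T fun i => (hb.coordDiff T hρ i).hasOrder
    have key : eulerDiff j (LatticePDO.defect a b) = LatticePDO.defect (eulerDiff j a) b +
        LatticePDO.defect (LatticePDO.coordShift j a) (eulerDiff j b) -
        LatticePDO.comp (LatticePDO.freqMul j (LatticePDO.coordShift j a))
          (LatticePDO.coordDiff j b) := by
      refine eulerDiff_twist T (m₃ := m₂ - ρ) j ha.1.hasOrder (hdd hb.1) ?_
        (hdd hb.2) (hd.hasOrder.twisted_comp T) ?_
      · rw [coordDiff_twisted_defect]
        exact hdd (hd.mono T (by linarith))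
      · intro k η ζ
        rw [coordDiff_twisted_defect]
        simp only [eulerDiff, Pi.add_apply, Pi.sub_apply, Int.cast_add]
        ring
    refine ⟨ih ha.1 hb.1, ?_⟩
    rw [key]
    refine ((ih ha.2 hb.1).add (ih (ha.1.coordShift T hρ j) hb.2)).sub ?_
    rw [add_sub_assoc]
    exact ((ha.1.coordShift T hρ j).freqMul j).comp T hρ hd

/-- A kernel that is approximated by kernels of order `m` up to arbitrarily low size has
order `m`. -/
lemma EulerOrder.of_approx (T : TameWeight Λ) {L : List (Fin n)} {m : ℝ} {a : Kernel n}
    (h : ∀ t : ℝ, ∃ g, EulerOrder Λ ρ L m g ∧ HasOrder Λ t (a - g)) : EulerOrder Λ ρ L m a := by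
  obtain ⟨t₀, ht₀⟩ := T.exists_eulerDiff_loss
  induction L generalizing a with
  | nil =>
    intro p
    induction p generalizing m a with
    | zero =>
      obtain ⟨g, hg, hag⟩ := h m
      simpa using! (hg 0).add (show DiffOrder Λ ρ 0 m (a - g) from hag)
    | succ p ih =>
      refine ⟨?_, fun j => ih fun t => ?_⟩
      · obtain ⟨g, hg, hag⟩ := h m
        simpa using! (hg 0).add (show DiffOrder Λ ρ 0 m (a - g) from hag)
      · obtain ⟨g, hg, hag⟩ := h t
        refine ⟨LatticePDO.coordDiff j g, fun p => (hg (p + 1)).2 j, ?_⟩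
        rw [← coordDiff_sub]
        exact hag.diff T j
  | cons j L ih =>
    refine ⟨ih fun t => (h t).imp fun g hg => ⟨hg.1.1, hg.2⟩, ih fun t => ?_⟩
    -- Approximate better by `t₀`, the loss of one `kⱼ Δⱼ`.
    obtain ⟨g, hg, hag⟩ := h (t - t₀)
    refine ⟨eulerDiff j g, hg.2, ?_⟩
    rw [← eulerDiff_sub]
    simpa using ht₀ _ _ j hag

lemma EulerOrder.zero {L : List (Fin n)} {m : ℝ} : EulerOrder Λ ρ L m (0 : Kernel n) := by
  induction L with
  | nil =>
    intro p
    induction p generalizing m with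
    | zero => exact HasOrder.zero
    | succ p ih =>
      refine ⟨HasOrder.zero, fun j => ?_⟩
      rw [show LatticePDO.coordDiff j (0 : Kernel n) = 0 by ext; simp [LatticePDO.coordDiff, fwdDiff]]
      exact ih
  | cons j L ih =>
    exact ⟨ih, by
      rw [show eulerDiff j (0 : Kernel n) = 0 by
        ext; simp [eulerDiff, LatticePDO.coordDiff, fwdDiff]]
      exact ih⟩

/-- The zero kernel is an admissible approximation to every order, so smallness alone controls all
differences. -/
lemma EulerOrder.of_forall_hasOrder (T : TameWeight Λ) {L : List (Fin n)} {a : Kernel n}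
    (h : ∀ t : ℝ, HasOrder Λ t a) (m : ℝ) : EulerOrder Λ ρ L m a :=
  EulerOrder.of_approx T fun t => ⟨0, EulerOrder.zero, by simpa using h t⟩

end eulerOrder

end

/-! ### Associativity, convolution inverses and the ring of kernels of finite order. -/

section

variable {n : ℕ}

/-- Fubini for the composition of a rapidly decreasing sequence, a family of such sequences, and
a sequence of polynomial growth. -/
lemma tsum_twist_assoc {u w : Lattice n → ℂ} {v : Lattice n → Lattice n → ℂ}
    (hu : ∀ N : ℕ, ∃ A : ℝ, ∀ η, ‖u η‖ * bracket η ^ N ≤ A)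
    (hv : ∃ q : ℕ, ∀ N : ℕ, ∃ B : ℝ, ∀ η ζ, ‖v η ζ‖ * bracket ζ ^ N ≤ B * bracket η ^ q)
    (hw : ∃ (W : ℝ) (r : ℕ), ∀ ζ, ‖w ζ‖ ≤ W * bracket ζ ^ r) :
    ∑' ζ, (∑' η, u η * v η (ζ - η)) * w ζ = ∑' η, u η * ∑' ζ, v η ζ * w (η + ζ) := by
  obtain ⟨q, hv⟩ := hv
  obtain ⟨W, r, hW⟩ := hw
  obtain ⟨B, hB⟩ := hv (r + 2 * n)
  obtain ⟨A, hA⟩ := hu (q + r + 2 * n)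
  have hs : Summable fun p : Lattice n × Lattice n => u p.1 * v p.1 p.2 * w (p.1 + p.2) := by
    refine Summable.of_norm_bounded (g := fun p : Lattice n × Lattice n => A * B * W *
      ((bracket p.1 ^ (2 * n))⁻¹ * (bracket p.2 ^ (2 * n))⁻¹))
      ((summable_bracket.mul_of_nonneg summable_bracket
        (fun k => inv_nonneg.2 (pow_nonneg (bracket_pos k).le _))
        (fun k => inv_nonneg.2 (pow_nonneg (bracket_pos k).le _))).mul_left _) ?_
    rintro ⟨η, ζ⟩
    have p1 := bracket_pos η
    have p2 := bracket_pos ζ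
    have h1 := hA η
    have h2 := hB η ζ
    have h3 : ‖w (η + ζ)‖ ≤ W * (bracket η ^ r * bracket ζ ^ r) := by
      have hW0 : 0 ≤ W := by
        have h := (norm_nonneg _).trans (hW η)
        exact nonneg_of_mul_nonneg_left h (pow_pos p1 r)
      rw [← mul_pow]
      refine (hW _).trans ?_
      have := bracket_pos (η + ζ)
      gcongr
      exact bracket_add_le _ _
    have hA0 : 0 ≤ A := le_trans (by positivity) h1
    have hAB : 0 ≤ B * bracket η ^ q := le_trans (by positivity) h2
    simp only
    rw [← mul_inv, ← div_eq_mul_inv, le_div_iff₀ (by positivity), norm_mul, norm_mul]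
    refine le_of_mul_le_mul_right ?_ (show 0 < bracket η ^ (q + r) * bracket ζ ^ r by positivity)
    calc ‖u η‖ * ‖v η ζ‖ * ‖w (η + ζ)‖ * (bracket η ^ (2 * n) * bracket ζ ^ (2 * n)) *
          (bracket η ^ (q + r) * bracket ζ ^ r)
        = (‖u η‖ * bracket η ^ (q + r + 2 * n)) * (‖v η ζ‖ * bracket ζ ^ (r + 2 * n)) *
            ‖w (η + ζ)‖ := by rw [pow_add _ (q + r), pow_add _ r]; ring
      _ ≤ A * (B * bracket η ^ q) * (W * (bracket η ^ r * bracket ζ ^ r)) := by gcongr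
      _ = _ := by rw [pow_add]; ring
  -- The shear `(η, ζ) ↦ (η, ζ - η)` turns the nested sum into a sum over independent variables.
  let e : Lattice n × Lattice n ≃ Lattice n × Lattice n :=
    { toFun := fun p => (p.1, p.2 - p.1)
      invFun := fun p => (p.1, p.2 + p.1)
      left_inv := fun p => by simp
      right_inv := fun p => by simp }
  have hs' := e.summable_iff.2 hs
  have hs'' := (Equiv.prodComm (Lattice n) (Lattice n)).summable_iff.2 hs'
  calc ∑' ζ, (∑' η, u η * v η (ζ - η)) * w ζ
      = ∑' ζ, ∑' η, u η * v η (ζ - η) * w ζ := by simp_rw [tsum_mul_right]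
    _ = ∑' p : Lattice n × Lattice n, u p.2 * v p.2 (p.1 - p.2) * w p.1 := by
        refine Eq.trans ?_ (hs''.tsum_prod.symm.trans ?_) <;>
        simp [e, Function.comp_def]
    _ = ∑' p : Lattice n × Lattice n, u p.1 * v p.1 p.2 * w (p.1 + p.2) := by
        refine Eq.trans ?_ (((Equiv.prodComm (Lattice n) (Lattice n)).trans e).tsum_eq _)
        simp [e]
    _ = ∑' η, ∑' ζ, u η * v η ζ * w (η + ζ) := hs.tsum_prod
    _ = _ := by simp_rw [mul_assoc, tsum_mul_left]

/-- The kernel of the identity. -/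
def unitKernel : Kernel n := fun _ η => if η = 0 then 1 else 0

/-- The operator with a given kernel. -/
def kernelOp (a : Kernel n) (f : Lattice n → ℂ) : Lattice n → ℂ :=
  fun k => ∑' η, a k η * f (k + η)

section order

variable {Λ : Lattice n → ℝ} {ρ : ℝ}

lemma HasOrder.rapid {m : ℝ} {a : Kernel n} (ha : HasOrder Λ m a) (k : Lattice n) (N : ℕ) :
    ∃ A : ℝ, ∀ η, ‖a k η‖ * bracket η ^ N ≤ A := by
  obtain ⟨A, hA⟩ := ha N
  exact ⟨_, hA k⟩

lemma HasTwistedOrder.rapid {m : ℝ} {b : Lattice n → Kernel n} (hb : HasTwistedOrder Λ m b)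
    (k : Lattice n) :
    ∃ q : ℕ, ∀ N : ℕ, ∃ B : ℝ, ∀ η ζ, ‖b k η ζ‖ * bracket ζ ^ N ≤ B * bracket η ^ q := by
  obtain ⟨q, hb⟩ := hb
  refine ⟨q, fun N => ?_⟩
  obtain ⟨B, hB⟩ := hb N
  exact ⟨B * Λ k ^ m, fun η ζ => (hB k η ζ).trans (le_of_eq (by ring))⟩

/-- Supplies the last factor in `tsum_twist_assoc`: at a shifted base point a kernel grows at most
polynomially in the shift, by moderate growth of `Λ`. -/
lemma HasOrder.poly (T : TameWeight Λ) {m : ℝ} {a : Kernel n} (ha : HasOrder Λ m a)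
    (k θ : Lattice n) : ∃ (W : ℝ) (r : ℕ), ∀ ζ, ‖a (k + ζ) (θ - ζ)‖ ≤ W * bracket ζ ^ r := by
  obtain ⟨A, hA0, hA⟩ := ha.exists_pos T 0
  obtain ⟨C, q, hC, h⟩ := T.shift m
  refine ⟨A * (C * Λ k ^ m), q, fun ζ => ?_⟩
  have h1 := hA (k + ζ) (θ - ζ)
  rw [pow_zero, mul_one] at h1
  refine h1.trans ?_
  calc A * Λ (k + ζ) ^ m ≤ A * (C * bracket ζ ^ q * Λ k ^ m) := by gcongr; exact h k ζ
    _ = _ := by ring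

lemma comp_assoc (T : TameWeight Λ) {m₁ m₂ m₃ : ℝ} {a b c : Kernel n} (ha : HasOrder Λ m₁ a)
    (hb : HasOrder Λ m₂ b) (hc : HasOrder Λ m₃ c) :
    comp (comp a b) c = comp a (comp b c) := by
  ext k θ
  have := tsum_twist_assoc (ha.rapid k) ((hb.twisted_comp T).rapid k) (hc.poly T k θ)
  simp only [comp, twist]
  rw [this]
  simp only [add_assoc, sub_sub]

lemma conv_assoc {m₁ m₂ m₃ : ℝ} {a b c : Kernel n} (ha : HasOrder Λ m₁ a)
    (hb : HasOrder Λ m₂ b) (hc : HasOrder Λ m₃ c) :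
    conv (conv a b) c = conv a (conv b c) := by
  ext k θ
  obtain ⟨C, hC⟩ := hc 0
  have := tsum_twist_assoc (w := fun ζ => c k (θ - ζ)) (ha.rapid k) (hb.twisted_const.rapid k)
    ⟨C * Λ k ^ m₃, 0, fun ζ => by simpa using hC k (θ - ζ)⟩
  simp only [conv, twist]
  rw [this]
  simp only [sub_sub]

lemma kernelOp_comp (T : TameWeight Λ) {m₁ m₂ : ℝ} {a b : Kernel n} (ha : HasOrder Λ m₁ a)
    (hb : HasOrder Λ m₂ b) {f : Lattice n → ℂ} {C : ℝ} (hf : ∀ k, ‖f k‖ ≤ C) :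
    kernelOp (comp a b) f = kernelOp a (kernelOp b f) := by
  ext k
  have := tsum_twist_assoc (w := fun ζ => f (k + ζ)) (ha.rapid k) ((hb.twisted_comp T).rapid k)
    ⟨C, 0, fun ζ => by simpa using hf _⟩
  simp only [kernelOp, comp, twist]
  rw [this]
  simp only [add_assoc]

lemma conv_comm (a b : Kernel n) : conv a b = conv b a := by
  ext k ζ
  simp only [conv, twist]
  rw [← (Equiv.subLeft ζ).tsum_eq]
  simp [mul_comm]

lemma unitKernel_comp (a : Kernel n) : comp unitKernel a = a := by
  ext k ζ
  simp only [comp, twist, unitKernel]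
  rw [tsum_eq_single 0 (by intro η hη; simp [hη])]
  simp

lemma comp_unitKernel (a : Kernel n) : comp a unitKernel = a := by
  ext k ζ
  simp only [comp, twist, unitKernel]
  rw [tsum_eq_single ζ (by intro η hη; simp [sub_eq_zero, Ne.symm hη])]
  simp

lemma unitKernel_conv (a : Kernel n) : conv unitKernel a = a := by
  ext k ζ
  simp only [conv, twist, unitKernel]
  rw [tsum_eq_single 0 (by intro η hη; simp [hη])]
  simp

lemma kernelOp_unitKernel (f : Lattice n → ℂ) : kernelOp unitKernel f = f := by
  ext k
  simp only [kernelOp, unitKernel]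
  rw [tsum_eq_single 0 (by intro η hη; simp [hη])]
  simp

lemma hasOrder_unitKernel : HasOrder Λ 0 (unitKernel : Kernel n) := by
  intro N
  refine ⟨1, fun k η => ?_⟩
  by_cases h : η = 0
  · subst h; simp [unitKernel, bracket]
  · simp [unitKernel, h]

lemma coordDiff_unitKernel (j : Fin n) : coordDiff j (unitKernel : Kernel n) = 0 := by
  ext; simp [coordDiff, fwdDiff, unitKernel]

lemma eulerDiff_unitKernel (j : Fin n) : eulerDiff j (unitKernel : Kernel n) = 0 := by
  ext; simp [eulerDiff, coordDiff_unitKernel]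

lemma eulerOrder_unitKernel (L : List (Fin n)) : EulerOrder Λ ρ L 0 (unitKernel : Kernel n) := by
  induction L with
  | nil =>
    intro p
    cases p with
    | zero => exact hasOrder_unitKernel
    | succ p =>
      refine ⟨hasOrder_unitKernel, fun j => ?_⟩
      rw [coordDiff_unitKernel]
      exact (EulerOrder.zero (L := [])) p
  | cons j L ih => exact ⟨ih, by rw [eulerDiff_unitKernel]; exact EulerOrder.zero⟩

lemma coordShift_conv (j : Fin n) (a b : Kernel n) :
    coordShift j (conv a b) = conv (coordShift j a) (coordShift j b) := rfl

/-- Solving the differentiated equation `a ∗ b = 1` for the derivative of `b`. -/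
lemma eq_neg_conv_of_conv_eq_unitKernel {m₁ m₂ m₃ : ℝ} {b a' b' a'' b'' : Kernel n}
    (ha : HasOrder Λ m₁ a'') (hb : HasOrder Λ m₂ b'') (hb' : HasOrder Λ m₃ b')
    (hab : conv b'' a'' = unitKernel) (h : conv a' b + conv a'' b' = 0) :
    b' = -conv b'' (conv a' b) := by
  have h1 : conv a'' b' = -conv a' b := by
    rw [eq_neg_iff_add_eq_zero, add_comm]; exact h
  have h2 : conv b'' (-conv a' b) = -conv b'' (conv a' b) := by
    ext k ζ
    simp [conv, twist, tsum_neg]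
  rw [← h2, ← h1, ← conv_assoc hb ha hb', hab, unitKernel_conv]

/-- Differencing `a ∗ b = 1` expresses `Δⱼ b` as minus the convolution of the shifted `b`, `Δⱼ a`
and `b`. Control of `p` differences of `b` thus yields control of `p + 1`. -/
lemma DiffOrder.inverse (T : TameWeight Λ) {m : ℝ} {a b : Kernel n}
    (ha : ∀ p, DiffOrder Λ ρ p m a) (hb : HasOrder Λ (-m) b)
    (hab : LatticePDO.conv a b = unitKernel) (p : ℕ) : DiffOrder Λ ρ p (-m) b := by
  induction p with
  | zero => exact hb
  | succ p ih =>
    refine ⟨hb, fun j => ?_⟩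
    have h := coordDiff_twist T j (ha 0) hb.twisted_const (hb.diff T j).twisted_const
    have h' : coordDiff j (LatticePDO.conv a b) = LatticePDO.conv (coordDiff j a) b +
      LatticePDO.conv (LatticePDO.coordShift j a) (coordDiff j b) := h
    rw [hab, coordDiff_unitKernel] at h'
    have hs : LatticePDO.conv (LatticePDO.coordShift j b) (LatticePDO.coordShift j a) =
        unitKernel := by
      rw [← coordShift_conv, conv_comm, hab]; rfl
    rw [eq_neg_conv_of_conv_eq_unitKernel (HasOrder.shift T j (ha 0)) (hb.shift T j)
      (hb.diff T j) hs h'.symm, show -m - ρ = -m + ((m - ρ) + -m) by ring]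
    exact ((ih.coordShift T j).conv T (((ha (p + 1)).2 j).conv T ih)).neg

lemma EulerOrder.inverse (T : TameWeight Λ) (hρ : 0 ≤ ρ) {L : List (Fin n)} {m : ℝ}
    {a b : Kernel n} (ha : EulerOrder Λ ρ L m a) (hb : HasOrder Λ (-m) b)
    (hab : LatticePDO.conv a b = unitKernel) : EulerOrder Λ ρ L (-m) b := by
  induction L with
  | nil => exact DiffOrder.inverse T ha hb hab
  | cons j L ih =>
    have hb1 := ih ha.1
    refine ⟨hb1, ?_⟩
    -- An a priori order for `kⱼ Δⱼ b`, however poor, justifies the rearrangements; the resulting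
    -- formula then gives the true order.
    obtain ⟨t, ht⟩ := T.exists_eulerDiff_loss
    have h := eulerDiff_conv T j ha.1.hasOrder hb (ht _ _ j hb)
    rw [hab, eulerDiff_unitKernel] at h
    have hs : LatticePDO.conv (LatticePDO.coordShift j b) (LatticePDO.coordShift j a) =
        unitKernel := by
      rw [← coordShift_conv, conv_comm, hab]; rfl
    rw [eq_neg_conv_of_conv_eq_unitKernel (HasOrder.shift T j ha.1.hasOrder) (hb.shift T j)
      (ht _ _ j hb) hs h.symm, show -m = -m + (m + -m) by ring]
    exact ((hb1.coordShift T hρ j).conv T hρ (ha.2.conv T hρ hb1)).neg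

/-- Leading term and remainder: the product of the symbols, plus a kernel to which the gain `ρ`
applies. -/
lemma comp_eq_conv_add_defect (T : TameWeight Λ) {m₁ m₂ : ℝ} {a b : Kernel n}
    (ha : HasOrder Λ m₁ a) (hb : HasOrder Λ m₂ b) : comp a b = conv a b + defect a b := by
  ext k ζ
  have s1 := summable_twist T ha (hb.twisted_comp T) k ζ
  have s2 := summable_twist T ha hb.twisted_const k ζ
  simp only [comp, conv, defect, twist, Pi.add_apply, Pi.sub_apply, mul_sub]
  rw [s1.tsum_sub s2]
  ring

lemma comp_add (T : TameWeight Λ) {m₁ m₂ m₃ : ℝ} {a b c : Kernel n}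
    (ha : HasOrder Λ m₁ a) (hb : HasOrder Λ m₂ b) (hc : HasOrder Λ m₃ c) :
    comp a (b + c) = comp a b + comp a c := by
  ext k ζ
  have s1 := summable_twist T ha (hb.twisted_comp T) k ζ
  have s2 := summable_twist T ha (hc.twisted_comp T) k ζ
  simp only [comp, twist, Pi.add_apply, mul_add]
  rw [s1.tsum_add s2]

lemma add_comp (T : TameWeight Λ) {m₁ m₂ m₃ : ℝ} {a b c : Kernel n}
    (ha : HasOrder Λ m₁ a) (hb : HasOrder Λ m₂ b) (hc : HasOrder Λ m₃ c) :
    comp (a + b) c = comp a c + comp b c := by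
  ext k ζ
  have s1 := summable_twist T ha (hc.twisted_comp T) k ζ
  have s2 := summable_twist T hb (hc.twisted_comp T) k ζ
  simp only [comp, twist, Pi.add_apply, add_mul]
  rw [s1.tsum_add s2]

/-- The additive group of kernels of finite order. -/
def finiteOrder (T : TameWeight Λ) : AddSubgroup (Kernel n) where
  carrier := {a | ∃ m, HasOrder Λ m a}
  zero_mem' := ⟨0, HasOrder.zero⟩
  add_mem' := by
    rintro a b ⟨m₁, ha⟩ ⟨m₂, hb⟩
    exact ⟨max m₁ m₂, (ha.mono T (le_max_left _ _)).add (hb.mono T (le_max_right _ _))⟩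
  neg_mem' := by
    rintro a ⟨m, ha⟩
    exact ⟨m, ha.neg⟩

/-- Kernels of finite order form a ring under composition. -/
instance finiteOrderRing (T : TameWeight Λ) : Ring (finiteOrder T) :=
  { (inferInstance : AddCommGroup (finiteOrder T)) with
    mul := fun a b => ⟨comp a.1 b.1, by
      obtain ⟨m₁, ha⟩ := a.2
      obtain ⟨m₂, hb⟩ := b.2
      exact ⟨m₁ + m₂, ha.twisted_sum T (hb.twisted_comp T)⟩⟩
    one := ⟨unitKernel, 0, hasOrder_unitKernel⟩
    mul_assoc := fun ⟨_, _, ha⟩ ⟨_, _, hb⟩ ⟨_, _, hc⟩ => Subtype.ext (comp_assoc T ha hb hc)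
    one_mul := fun a => Subtype.ext (unitKernel_comp a.1)
    mul_one := fun a => Subtype.ext (comp_unitKernel a.1)
    left_distrib := fun ⟨_, _, ha⟩ ⟨_, _, hb⟩ ⟨_, _, hc⟩ => Subtype.ext (comp_add T ha hb hc)
    right_distrib := fun ⟨_, _, ha⟩ ⟨_, _, hb⟩ ⟨_, _, hc⟩ => Subtype.ext (add_comp T ha hb hc)
    zero_mul := fun a => Subtype.ext (by
      change comp 0 a.1 = 0
      ext; simp [comp, twist])
    mul_zero := fun a => Subtype.ext (by
      change comp a.1 0 = 0
      ext; simp [comp, twist]) }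

lemma finiteOrder_coe_mul (T : TameWeight Λ) (a b : finiteOrder T) :
    ((a * b : finiteOrder T) : Kernel n) = comp a b := rfl

/-- Kernels of order `-∞`. -/
def IsSmoothing (Λ : Lattice n → ℝ) (a : Kernel n) : Prop := ∀ t : ℝ, HasOrder Λ t a

lemma IsSmoothing.add {a b : Kernel n} (ha : IsSmoothing Λ a) (hb : IsSmoothing Λ b) :
    IsSmoothing Λ (a + b) := fun t => (ha t).add (hb t)

lemma IsSmoothing.sub {a b : Kernel n} (ha : IsSmoothing Λ a) (hb : IsSmoothing Λ b) :
    IsSmoothing Λ (a - b) := fun t => (ha t).sub (hb t)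

lemma IsSmoothing.comp_left (T : TameWeight Λ) {m : ℝ} {a b : Kernel n} (ha : IsSmoothing Λ a)
    (hb : HasOrder Λ m b) : IsSmoothing Λ (comp a b) := fun t => by
  have := (ha (t - m)).twisted_sum T (hb.twisted_comp T)
  rwa [sub_add_cancel] at this

lemma IsSmoothing.comp_right (T : TameWeight Λ) {m : ℝ} {a b : Kernel n} (ha : HasOrder Λ m a)
    (hb : IsSmoothing Λ b) : IsSmoothing Λ (comp a b) := fun t => by
  have := ha.twisted_sum T ((hb (t - m)).twisted_comp T)
  rwa [add_sub_cancel] at this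

end order

end

/-! ### Asymptotic summation, Neumann series and the kernel parametrix. -/

section

variable {n : ℕ} {Λ : Lattice n → ℝ} {ρ : ℝ}

lemma EulerOrder.sum {L : List (Fin n)} {m : ℝ} {ι : Type*} (s : Finset ι) {q : ι → Kernel n}
    (h : ∀ i ∈ s, EulerOrder Λ ρ L m (q i)) : EulerOrder Λ ρ L m (∑ i ∈ s, q i) :=
  Finset.sum_induction _ (EulerOrder Λ ρ L m) (fun _ _ => EulerOrder.add) EulerOrder.zero h

lemma HasOrder.sum {m : ℝ} {ι : Type*} (s : Finset ι) {q : ι → Kernel n}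
    (h : ∀ i ∈ s, HasOrder Λ m (q i)) : HasOrder Λ m (∑ i ∈ s, q i) :=
  Finset.sum_induction _ (HasOrder Λ m) (fun _ _ => HasOrder.add) HasOrder.zero h

/-- A kernel of finite order that is supported where the weight is bounded is smoothing. -/
lemma HasOrder.isSmoothing_of_bounded (T : TameWeight Λ) {m B : ℝ} {a : Kernel n}
    (ha : HasOrder Λ m a) (h : ∀ k, B < Λ k → a k = 0) : IsSmoothing Λ a := by
  intro t
  rcases le_total m t with hmt | htm
  · exact ha.mono T hmt
  intro N
  obtain ⟨A, hA0, hA⟩ := ha.exists_pos T N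
  refine ⟨A * |B| ^ (m - t), fun k η => ?_⟩
  have hk := T.pos k
  by_cases hB : B < Λ k
  · rw [h k hB]
    have := Real.rpow_nonneg hk.le t
    simp only [Pi.zero_apply, norm_zero, zero_mul]
    positivity
  · refine (hA k η).trans ?_
    rw [mul_assoc]
    refine mul_le_mul_of_nonneg_left ?_ hA0.le
    rw [← sub_add_cancel m t, Real.rpow_add hk, add_sub_cancel_right]
    refine mul_le_mul_of_nonneg_right ?_ (Real.rpow_nonneg hk.le _)
    exact Real.rpow_le_rpow hk.le ((not_lt.1 hB).trans (le_abs_self B)) (by linarith)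

/-- Asymptotic summation of kernels of decreasing order, up to a fixed loss in size. -/
lemma exists_hasOrder_asymptotic (T : TameWeight Λ) (hρ : 0 < ρ) {q : ℕ → Kernel n}
    (hq : ∀ j : ℕ, HasOrder Λ (-(ρ * j)) (q j)) :
    ∃ Q : Kernel n, ∀ N : ℕ, HasOrder Λ (ρ - ρ * N) (Q - ∑ j ∈ Finset.range N, q j) := by
  classical
  choose C hC0 hC using fun j => (hq j).exists_pos T j
  -- On this set the constant `C j` is at most `2^(-j) Λ^ρ`: one step `ρ` of order buys geometric
  -- convergence in `j`. The condition `1 ≤ Λ` makes powers of `Λ` monotone in the exponent.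
  set A : ℕ → Lattice n → Prop := fun j k => C j * 2 ^ j ≤ Λ k ^ ρ ∧ 1 ≤ Λ k with hA
  set u : ℕ → Kernel n := fun j k η => if A j k then q j k η else 0 with hu
  have hub : ∀ (j : ℕ) k η, ‖u j k η‖ * bracket η ^ j ≤ (1 / 2) ^ j * Λ k ^ (ρ - ρ * j) := by
    intro j k η
    have hk := T.pos k
    by_cases h : A j k
    · simp only [hu, h, if_true]
      refine (hC j k η).trans ?_
      rw [sub_eq_add_neg, Real.rpow_add hk, ← mul_assoc]
      refine mul_le_mul_of_nonneg_right ?_ (Real.rpow_nonneg hk.le _)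
      rw [one_div, inv_pow, ← div_eq_inv_mul, le_div_iff₀ (by positivity)]
      exact h.1
    · simp only [hu, h, if_false, norm_zero, zero_mul]
      have := Real.rpow_nonneg hk.le (ρ - ρ * j)
      positivity
  have hub' : ∀ (j N P : ℕ) k η, N ≤ j → P ≤ j →
      ‖u j k η‖ * bracket η ^ P ≤ (1 / 2) ^ j * Λ k ^ (ρ - ρ * N) := by
    intro j N P k η hN hP
    have hk := T.pos k
    by_cases h : A j k
    · calc ‖u j k η‖ * bracket η ^ P ≤ ‖u j k η‖ * bracket η ^ j := by
            gcongr
            exact one_le_bracket η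
        _ ≤ (1 / 2) ^ j * Λ k ^ (ρ - ρ * j) := hub j k η
        _ ≤ _ := by
            gcongr
            exact h.2
    · simp only [hu, h, if_false, norm_zero, zero_mul]
      have := Real.rpow_nonneg hk.le (ρ - ρ * N)
      positivity
  have hgeo : Summable fun j : ℕ => (1 / 2 : ℝ) ^ j := summable_geometric_two
  have hsum : ∀ k η, Summable fun j => u j k η := fun k η =>
    Summable.of_norm_bounded (g := fun j : ℕ => (1 / 2 : ℝ) ^ j * Λ k ^ (ρ - ρ * (0 : ℕ)))
      (hgeo.mul_right _) fun j => by simpa using hub' j 0 0 k η (by omega) (by omega)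
  have hu1 : ∀ j : ℕ, HasOrder Λ (-(ρ * j)) (u j) := fun j => (hq j).of_norm_le fun k η => by
    simp only [hu]; split_ifs <;> simp
  have hu2 : ∀ j : ℕ, IsSmoothing Λ (u j - q j) := fun j => by
    refine (((hu1 j).sub (hq j))).isSmoothing_of_bounded T
      (B := max 1 ((C j * 2 ^ j) ^ (1 / ρ))) fun k hk => ?_
    have hpos := T.pos k
    have : A j k := by
      refine ⟨?_, (le_max_left _ _).trans hk.le⟩
      have h1 := Real.rpow_le_rpow (by have := hC0 j; positivity) ((le_max_right _ _).trans hk.le)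
        hρ.le
      rwa [← Real.rpow_mul (by have := hC0 j; positivity), one_div_mul_cancel hρ.ne',
        Real.rpow_one] at h1
    ext η
    simp [hu, this]
  refine ⟨fun k η => ∑' j, u j k η, fun N P => ?_⟩
  -- Terms beyond `N'` have both enough order (`N ≤ j`) and enough frequency decay (`P ≤ j`) for one
  -- geometric bound; the finitely many others are treated singly.
  set N' := max N P with hN'
  have hG : HasOrder Λ (ρ - ρ * N) (∑ j ∈ Finset.range N, (u j - q j) +
      ∑ j ∈ Finset.Ico N N', u j) := by
    refine (HasOrder.sum _ fun j _ => hu2 j _).add (HasOrder.sum _ fun j hj => ?_)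
    refine (hu1 j).mono T ?_
    have : (N : ℝ) ≤ j := by exact_mod_cast (Finset.mem_Ico.1 hj).1
    nlinarith
  obtain ⟨G, hG⟩ := hG P
  refine ⟨G + 2, fun k η => ?_⟩
  have hk := Real.rpow_pos_of_pos (T.pos k) (ρ - ρ * N)
  have hη : 0 < bracket η ^ P := pow_pos (bracket_pos η) P
  have htail : ‖∑' j, u (j + N') k η‖ ≤ 2 * (Λ k ^ (ρ - ρ * N) / bracket η ^ P) := by
    refine tsum_of_norm_bounded (hasSum_geometric_two.mul_right _) fun j => ?_
    rw [← mul_div_assoc, le_div_iff₀ hη]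
    refine (hub' (j + N') N P k η (by omega) (by omega)).trans ?_
    refine mul_le_mul_of_nonneg_right ?_ hk.le
    exact pow_le_pow_of_le_one (by norm_num) (by norm_num) (by omega)
  have hsplit : ((fun k η => ∑' j, u j k η) - ∑ j ∈ Finset.range N, q j : Kernel n) k η =
      (∑ j ∈ Finset.range N, (u j - q j) + ∑ j ∈ Finset.Ico N N', u j : Kernel n) k η +
        ∑' j, u (j + N') k η := by
    simp only [Pi.sub_apply, Pi.add_apply, Finset.sum_apply, Finset.sum_sub_distrib]
    rw [← (hsum k η).sum_add_tsum_nat_add N',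
      ← Finset.sum_range_add_sum_Ico _ (show N ≤ N' from le_max_left _ _)]
    ring
  rw [hsplit]
  calc _ ≤ (‖(∑ j ∈ Finset.range N, (u j - q j) + ∑ j ∈ Finset.Ico N N', u j : Kernel n) k η‖ +
        2 * (Λ k ^ (ρ - ρ * N) / bracket η ^ P)) * bracket η ^ P := by
          gcongr
          exact (norm_add_le _ _).trans (add_le_add le_rfl htail)
    _ ≤ G * Λ k ^ (ρ - ρ * N) + 2 * Λ k ^ (ρ - ρ * N) := by
          rw [add_mul]
          refine add_le_add (hG k η) (le_of_eq ?_)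
          field_simp
    _ = _ := by ring

/-- Asymptotic summation of kernels of decreasing order. -/
lemma exists_eulerOrder_asymptotic (T : TameWeight Λ) (hρ : 0 < ρ) {L : List (Fin n)}
    {q : ℕ → Kernel n} (hq : ∀ j : ℕ, EulerOrder Λ ρ L (-(ρ * j)) (q j)) :
    ∃ Q : Kernel n, ∀ N : ℕ, EulerOrder Λ ρ L (-(ρ * N)) (Q - ∑ j ∈ Finset.range N, q j) := by
  obtain ⟨Q, hQ⟩ := exists_hasOrder_asymptotic T hρ fun j => (hq j).hasOrder
  refine ⟨Q, fun N => EulerOrder.of_approx T fun t => ?_⟩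
  -- Enough terms to bring `ρ - ρ M` below `t`: the loss of `ρ` in the size estimate disappears when
  -- more terms are subtracted.
  obtain ⟨M, hM⟩ := exists_nat_ge ((ρ - t) / ρ)
  rw [div_le_iff₀ hρ] at hM
  refine ⟨∑ j ∈ Finset.Ico N (max N M), q j, EulerOrder.sum _ fun j hj => ?_, ?_⟩
  · refine (hq j).mono T ?_
    have : (N : ℝ) ≤ j := by exact_mod_cast (Finset.mem_Ico.1 hj).1
    nlinarith
  · rw [sub_sub, Finset.sum_range_add_sum_Ico _ (le_max_left _ _)]
    refine (hQ _).mono T ?_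
    have : (M : ℝ) ≤ (max N M : ℕ) := by exact_mod_cast le_max_right _ _
    nlinarith

lemma eulerOrder_pow (T : TameWeight Λ) (hρ : 0 ≤ ρ) {L : List (Fin n)} {m : ℝ}
    {r : finiteOrder T} (hr : EulerOrder Λ ρ L m r.1) (j : ℕ) :
    EulerOrder Λ ρ L (m * j) (r ^ j).1 := by
  induction j with
  | zero => simpa using! eulerOrder_unitKernel L
  | succ j ih =>
    rw [pow_succ, finiteOrder_coe_mul, show m * (j + 1 : ℕ) = m * j + m by push_cast; ring]
    exact ih.comp T hρ hr

/-- Inversion of a perturbation of the identity of negative order, modulo smoothing kernels. -/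
lemma exists_neumann (T : TameWeight Λ) (hρ : 0 < ρ) {L : List (Fin n)} {r : finiteOrder T}
    (hr : EulerOrder Λ ρ L (-ρ) r.1) :
    ∃ Q : finiteOrder T, EulerOrder Λ ρ L 0 Q.1 ∧ IsSmoothing Λ ((1 - r) * Q - 1).1 ∧
      IsSmoothing Λ (Q * (1 - r) - 1).1 := by
  have hpow : ∀ j : ℕ, EulerOrder Λ ρ L (-(ρ * j)) (r ^ j).1 := fun j => by
    have := eulerOrder_pow T hρ.le hr j
    rwa [neg_mul] at this
  obtain ⟨Q, hQ⟩ := exists_eulerOrder_asymptotic T hρ hpow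
  have hQ0 : EulerOrder Λ ρ L 0 Q := by simpa using hQ 0
  have h1r : EulerOrder Λ ρ L 0 (1 - r).1 :=
    (eulerOrder_unitKernel L).sub (hr.mono T (by linarith))
  set q : finiteOrder T := ⟨Q, 0, hQ0.hasOrder⟩ with hq
  have hdiff : ∀ N : ℕ, EulerOrder Λ ρ L (-(ρ * N)) (q - ∑ j ∈ Finset.range N, r ^ j).1 := by
    intro N
    have h := hQ N
    rwa [show (q - ∑ j ∈ Finset.range N, r ^ j).1 = Q - ∑ j ∈ Finset.range N, (r ^ j).1 by
      simp [hq]]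
  have hsm : ∀ x : finiteOrder T, (∀ N : ℕ, ∃ y : finiteOrder T,
      EulerOrder Λ ρ L (-(ρ * N)) y.1 ∧ x = y) → IsSmoothing Λ x.1 := by
    intro x h t
    obtain ⟨N, hN⟩ := exists_nat_ge (-t / ρ)
    rw [div_le_iff₀ hρ] at hN
    obtain ⟨y, hy, rfl⟩ := h N
    exact hy.hasOrder.mono T (by linarith)
  refine ⟨q, hQ0, hsm _ fun N => ?_, hsm _ fun N => ?_⟩
  -- Since `(1 - r) ∑ r^j = 1 - r^N` over `j < N`, the error equals this expression for every `N`,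
  -- and both of its terms have order `-ρ N`.
  · refine ⟨(1 - r) * (q - ∑ j ∈ Finset.range N, r ^ j) - r ^ N, ?_, ?_⟩
    · have := h1r.comp T hρ.le (hdiff N)
      rw [zero_add] at this
      exact this.sub (hpow N)
    · rw [mul_sub, mul_neg_geom_sum]; abel
  · refine ⟨(q - ∑ j ∈ Finset.range N, r ^ j) * (1 - r) - r ^ N, ?_, ?_⟩
    · have := (hdiff N).comp T hρ.le h1r
      rw [add_zero] at this
      exact this.sub (hpow N)
    · rw [sub_mul, geom_sum_mul_neg]; abel

/-- A kernel of order `m` that has a convolution inverse up to a smoothing kernel has a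
two-sided parametrix. -/
theorem exists_kernel_parametrix (T : TameWeight Λ) (hρ : 0 < ρ) {L : List (Fin n)} {m : ℝ}
    {a a₀ b₀ : Kernel n} (ha : EulerOrder Λ ρ L m a) (ha₀ : EulerOrder Λ ρ L m a₀)
    (hb₀ : EulerOrder Λ ρ L (-m) b₀) (hab : conv a₀ b₀ = unitKernel)
    (haa : IsSmoothing Λ (a - a₀)) :
    ∃ b : Kernel n, EulerOrder Λ ρ L (-m) b ∧ IsSmoothing Λ (comp a b - unitKernel) ∧
      IsSmoothing Λ (comp b a - unitKernel) := by
  have hba : conv b₀ a₀ = unitKernel := by rw [conv_comm, hab]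
  set A : finiteOrder T := ⟨a, m, ha.hasOrder⟩ with hA
  set B : finiteOrder T := ⟨b₀, -m, hb₀.hasOrder⟩ with hB
  have hsm : ∀ {x : Kernel n}, IsSmoothing Λ x → EulerOrder Λ ρ L (-ρ) x := fun hx =>
    EulerOrder.of_forall_hasOrder T hx _
  -- `a ∘ b₀` is `a₀ ∗ b₀ = 1`, plus the defect of order `-ρ`, plus the smoothing kernel `(a - a₀) ∘
  -- b₀`.
  have h1 : EulerOrder Λ ρ L (-ρ) (1 - A * B).1 := by
    have e : (1 - A * B).1 = -(comp (a - a₀) b₀ + defect a₀ b₀) := by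
      have h1 : comp a b₀ = comp a₀ b₀ + comp (a - a₀) b₀ := by
        rw [← add_comp T ha₀.hasOrder (haa 0) hb₀.hasOrder, add_sub_cancel]
      change unitKernel - comp a b₀ = _
      rw [h1, comp_eq_conv_add_defect T ha₀.hasOrder hb₀.hasOrder, hab]
      abel
    rw [e]
    have := ha₀.defect T hρ.le hb₀
    rw [add_neg_cancel, zero_sub] at this
    exact ((hsm (haa.comp_left T hb₀.hasOrder)).add this).neg
  have h2 : EulerOrder Λ ρ L (-ρ) (1 - B * A).1 := by
    have e : (1 - B * A).1 = -(comp b₀ (a - a₀) + defect b₀ a₀) := by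
      have h1 : comp b₀ a = comp b₀ a₀ + comp b₀ (a - a₀) := by
        rw [← comp_add T hb₀.hasOrder ha₀.hasOrder (haa 0), add_sub_cancel]
      change unitKernel - comp b₀ a = _
      rw [h1, comp_eq_conv_add_defect T hb₀.hasOrder ha₀.hasOrder, hba]
      abel
    rw [e]
    have := hb₀.defect T hρ.le ha₀
    rw [neg_add_cancel, zero_sub] at this
    exact ((hsm (IsSmoothing.comp_right T hb₀.hasOrder haa)).add this).neg
  obtain ⟨Q₁, hQ₁, hQ₁r, -⟩ := exists_neumann T hρ h1
  obtain ⟨Q₂, hQ₂, -, hQ₂l⟩ := exists_neumann T hρ h2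
  rw [sub_sub_cancel] at hQ₁r hQ₂l
  have hmul_left : ∀ {x : finiteOrder T} (y : finiteOrder T), IsSmoothing Λ x.1 →
      IsSmoothing Λ (x * y).1 := fun y hx => hx.comp_left T y.2.choose_spec
  have hmul_right : ∀ (x : finiteOrder T) {y : finiteOrder T}, IsSmoothing Λ y.1 →
      IsSmoothing Λ (x * y).1 := fun x _ hy => IsSmoothing.comp_right T x.2.choose_spec hy
  have hcl : EulerOrder Λ ρ L (-m) (Q₂ * B).1 := by
    have := hQ₂.comp T hρ.le hb₀
    rwa [zero_add] at this
  -- the left and the right parametrix agree modulo smoothing kernels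
  have hLR : IsSmoothing Λ (Q₂ * B - B * Q₁).1 := by
    have e : Q₂ * B - B * Q₁ = (Q₂ * (B * A) - 1) * (B * Q₁) - (Q₂ * B) * (A * B * Q₁ - 1) := by
      noncomm_ring
    rw [e]
    exact (hmul_left _ hQ₂l).sub (hmul_right _ hQ₁r)
  refine ⟨(Q₂ * B).1, hcl, ?_, ?_⟩
  · have e : A * (Q₂ * B) - 1 = A * (Q₂ * B - B * Q₁) + (A * B * Q₁ - 1) := by noncomm_ring
    change IsSmoothing Λ (A * (Q₂ * B) - 1).1
    rw [e]
    exact (hmul_right _ hLR).add hQ₁r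
  · change IsSmoothing Λ (Q₂ * B * A - 1).1
    rw [mul_assoc]
    exact hQ₂l

end

/-! ### Fourier analysis of smooth functions on the torus. -/

section

open MeasureTheory UnitAddTorus

variable {n : ℕ}

instance : IsProbabilityMeasure (torusMeasure n) := by
  unfold torusMeasure; infer_instance

instance : (torusMeasure n).IsAddHaarMeasure := by
  unfold torusMeasure; infer_instance

/-- The projection `ℝⁿ → 𝕋ⁿ`. -/
def torusMk (t : Fin n → ℝ) : Torus n := fun i => (t i : UnitAddCircle)

lemma isOpenQuotientMap_torusMk : IsOpenQuotientMap (torusMk (n := n)) :=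
  IsOpenQuotientMap.piMap fun _ => QuotientAddGroup.isOpenQuotientMap_mk

lemma torusMk_add (s t : Fin n → ℝ) : torusMk (s + t) = torusMk s + torusMk t := rfl

lemma torusMk_single (j : Fin n) (t : ℝ) :
    torusMk (Pi.single j t) = Pi.single j (t : UnitAddCircle) := by
  ext i
  by_cases h : i = j
  · subst h; simp [torusMk]
  · simp [torusMk, h]

lemma IsSmoothOnTorus.contDiff {g : Torus n → ℂ} (hg : IsSmoothOnTorus g) :
    ContDiff ℝ ∞ (g ∘ torusMk) := hg

lemma IsSmoothOnTorus.continuous {g : Torus n → ℂ} (hg : IsSmoothOnTorus g) : Continuous g :=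
  isOpenQuotientMap_torusMk.isQuotientMap.continuous_iff.2 hg.contDiff.continuous

lemma IsSmoothOnTorus.mul {f g : Torus n → ℂ} (hf : IsSmoothOnTorus f) (hg : IsSmoothOnTorus g) :
    IsSmoothOnTorus (f * g) := ContDiff.mul hf hg

lemma IsSmoothOnTorus.inv {f : Torus n → ℂ} (hf : IsSmoothOnTorus f) (h0 : ∀ x, f x ≠ 0) :
    IsSmoothOnTorus f⁻¹ := ContDiff.inv hf fun _ => h0 _

lemma two_pi_I_ne_zero : 2 * (Real.pi : ℂ) * Complex.I ≠ 0 := by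
  simp [Real.pi_ne_zero]

lemma hasDerivAt_torusMk_line {g : Torus n → ℂ} (hg : IsSmoothOnTorus g) (j : Fin n)
    (s : Fin n → ℝ) (t : ℝ) :
    HasDerivAt (fun t : ℝ => g (torusMk s + Pi.single j (t : UnitAddCircle)))
      (fderiv ℝ (g ∘ torusMk) (s + Pi.single j t) (Pi.single j 1)) t := by
  have h1 : HasFDerivAt (g ∘ torusMk) (fderiv ℝ (g ∘ torusMk) (s + Pi.single j t))
      (s + Pi.single j t) :=
    (hg.contDiff.differentiable (by simp)).differentiableAt.hasFDerivAt
  have h2 : HasDerivAt (fun t : ℝ => s + Pi.single j t) (Pi.single j (1 : ℝ)) t :=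
    (hasDerivAt_single (𝕜 := ℝ) j t).const_add s
  have := h1.comp_hasDerivAt t h2
  simpa [Function.comp_def, torusMk_add, torusMk_single] using! this

lemma torusD_torusMk {g : Torus n → ℂ} (hg : IsSmoothOnTorus g) (j : Fin n) (s : Fin n → ℝ) :
    torusD j g (torusMk s) =
      (2 * (Real.pi : ℂ) * Complex.I)⁻¹ * fderiv ℝ (g ∘ torusMk) s (Pi.single j 1) := by
  rw [torusD, (hasDerivAt_torusMk_line hg j s 0).deriv]
  simp

lemma IsSmoothOnTorus.torusD {g : Torus n → ℂ} (hg : IsSmoothOnTorus g) (j : Fin n) :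
    IsSmoothOnTorus (torusD j g) := by
  have h : ContDiff ℝ ∞ fun s => fderiv ℝ (g ∘ torusMk) s (Pi.single j (1 : ℝ)) :=
    (hg.contDiff.fderiv_right (m := ∞) (by simp)).clm_apply contDiff_const
  have h2 := (contDiff_const (c := (2 * (Real.pi : ℂ) * Complex.I)⁻¹)).mul h
  have e : (LatticePDO.torusD j g) ∘ torusMk = fun s => (2 * (Real.pi : ℂ) * Complex.I)⁻¹ *
    fderiv ℝ (g ∘ torusMk) s (Pi.single j (1 : ℝ)) := funext (torusD_torusMk hg j)
  rw [← e] at h2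
  exact h2

lemma IsSmoothOnTorus.hasDerivAt_line {g : Torus n → ℂ} (hg : IsSmoothOnTorus g) (j : Fin n)
    (x : Torus n) (t : ℝ) :
    HasDerivAt (fun t : ℝ => g (x + Pi.single j (t : UnitAddCircle)))
      (2 * Real.pi * Complex.I * LatticePDO.torusD j g (x + Pi.single j (t : UnitAddCircle))) t := by
  obtain ⟨s, rfl⟩ := isOpenQuotientMap_torusMk.surjective x
  convert hasDerivAt_torusMk_line hg j s t using 1
  rw [← torusMk_single, ← torusMk_add, torusD_torusMk hg, mul_inv_cancel_left₀ two_pi_I_ne_zero]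

lemma torusD_eq_of_hasDerivAt {g : Torus n → ℂ} {j : Fin n} {x : Torus n} {d : ℂ}
    (h : HasDerivAt (fun t : ℝ => g (x + Pi.single j (t : UnitAddCircle)))
      (2 * Real.pi * Complex.I * d) 0) : torusD j g x = d := by
  rw [torusD, h.deriv, inv_mul_cancel_left₀ two_pi_I_ne_zero]

lemma torusD_mul {f g : Torus n → ℂ} (hf : IsSmoothOnTorus f) (hg : IsSmoothOnTorus g)
    (j : Fin n) : torusD j (f * g) = torusD j f * g + f * torusD j g := by
  ext x
  refine torusD_eq_of_hasDerivAt ?_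
  refine ((hf.hasDerivAt_line j x 0).mul (hg.hasDerivAt_line j x 0)).congr_deriv ?_
  simp only [AddCircle.coe_zero, Pi.single_zero, add_zero, Pi.add_apply, Pi.mul_apply]
  ring

lemma torusD_inv {f : Torus n → ℂ} (hf : IsSmoothOnTorus f) (h0 : ∀ x, f x ≠ 0) (j : Fin n) :
    torusD j f⁻¹ = -(torusD j f * (f⁻¹ * f⁻¹)) := by
  ext x
  refine torusD_eq_of_hasDerivAt ?_
  refine ((hf.hasDerivAt_line j x 0).inv (h0 _)).congr_deriv ?_
  have := h0 x
  simp only [AddCircle.coe_zero, Pi.single_zero, add_zero, Pi.neg_apply, Pi.mul_apply,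
    Pi.inv_apply]
  field_simp

lemma mFourier_apply_add (η : Lattice n) (x y : Torus n) :
    mFourier η (x + y) = mFourier η x * mFourier η y := by
  simp [mFourier, fourier_apply, AddCircle.toCircle_add, Finset.prod_mul_distrib]

lemma mFourier_torusMk (η : Lattice n) (t : Fin n → ℝ) :
    mFourier η (torusMk t) = Complex.exp (2 * Real.pi * Complex.I * (∑ i, η i * t i : ℝ)) := by
  simp only [mFourier, ContinuousMap.coe_mk, torusMk, fourier_coe_apply]
  rw [← Complex.exp_sum]
  congr 1
  push_cast
  rw [Finset.mul_sum]
  refine Finset.sum_congr rfl fun i _ => ?_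
  simp
  ring

lemma mFourier_single_apply (η : Lattice n) (j : Fin n) (t : ℝ) :
    mFourier η (Pi.single j (t : UnitAddCircle)) =
      Complex.exp (2 * Real.pi * Complex.I * (η j * t)) := by
  rw [← torusMk_single, mFourier_torusMk]
  congr 2
  rw [Finset.sum_eq_single j (by intro i _ hi; simp [hi]) (by simp)]
  simp

lemma norm_mFourier_apply (η : Lattice n) (x : Torus n) : ‖mFourier η x‖ = 1 := by
  simp only [mFourier, ContinuousMap.coe_mk, norm_prod, fourier_apply, Circle.norm_coe,
    Finset.prod_const_one]

/-- The Fourier coefficients of a function on the torus. -/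
def torusCoeff (g : Torus n → ℂ) (η : Lattice n) : ℂ :=
  ∫ x, mFourier (-η) x * g x ∂(torusMeasure n)

/-- The Fourier series with given coefficients. -/
def fourierSeries (c : Lattice n → ℂ) : Torus n → ℂ := fun x => ∑' η, c η * mFourier η x

/-- Rapidly decreasing sequences on the lattice. -/
def Rapid (c : Lattice n → ℂ) : Prop := ∀ N : ℕ, ∃ C : ℝ, ∀ η, ‖c η‖ * bracket η ^ N ≤ C

lemma Rapid.add {c d : Lattice n → ℂ} (hc : Rapid c) (hd : Rapid d) : Rapid (c + d) := by
  intro N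
  obtain ⟨A, hA⟩ := hc N
  obtain ⟨B, hB⟩ := hd N
  refine ⟨A + B, fun η => ?_⟩
  have h0 : 0 ≤ bracket η ^ N := pow_nonneg (bracket_pos η).le N
  calc ‖c η + d η‖ * bracket η ^ N ≤ (‖c η‖ + ‖d η‖) * bracket η ^ N := by
        gcongr; exact norm_add_le _ _
    _ ≤ _ := by linarith [hA η, hB η]

lemma Rapid.const_mul {c : Lattice n → ℂ} (hc : Rapid c) (z : ℂ) : Rapid fun η => z * c η := by
  intro N
  obtain ⟨A, hA⟩ := hc N
  refine ⟨‖z‖ * A, fun η => ?_⟩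
  rw [norm_mul, mul_assoc]
  exact mul_le_mul_of_nonneg_left (hA η) (norm_nonneg z)

lemma Rapid.sub {c d : Lattice n → ℂ} (hc : Rapid c) (hd : Rapid d) : Rapid (c - d) := by
  have := hc.add (hd.const_mul (-1))
  rwa [show c + (fun η => -1 * d η) = c - d by ext; simp [sub_eq_add_neg]] at this

lemma Rapid.coord_mul {c : Lattice n → ℂ} (hc : Rapid c) (j : Fin n) :
    Rapid fun η => (η j : ℂ) * c η := by
  intro N
  obtain ⟨A, hA⟩ := hc (N + 1)
  refine ⟨A, fun η => le_trans ?_ (hA η)⟩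
  have h0 : 0 ≤ bracket η ^ N := pow_nonneg (bracket_pos η).le N
  have h1 : ‖(η j : ℂ)‖ ≤ bracket η := by simpa using abs_coord_le_bracket η j
  calc ‖(η j : ℂ) * c η‖ * bracket η ^ N ≤ bracket η * ‖c η‖ * bracket η ^ N := by
        rw [norm_mul]; gcongr
    _ = _ := by ring

lemma Rapid.summable_mul {c : Lattice n → ℂ} (hc : Rapid c) (N : ℕ) :
    Summable fun η => ‖c η‖ * bracket η ^ N := by
  obtain ⟨A, hA⟩ := hc (N + 2 * n)
  refine Summable.of_nonneg_of_le
    (fun η => mul_nonneg (norm_nonneg _) (pow_nonneg (bracket_pos η).le _)) (fun η => ?_)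
    (summable_bracket.mul_left A)
  have := bracket_pos η
  rw [← div_eq_mul_inv, le_div_iff₀ (by positivity), mul_assoc, ← pow_add]
  exact hA η

lemma Rapid.summable_norm {c : Lattice n → ℂ} (hc : Rapid c) : Summable fun η => ‖c η‖ := by
  simpa using hc.summable_mul 0

lemma summable_fourierSeries {c : Lattice n → ℂ} (hc : Rapid c) (x : Torus n) :
    Summable fun η => c η * mFourier η x :=
  Summable.of_norm_bounded hc.summable_norm fun η => by rw [norm_mul, norm_mFourier_apply, mul_one]

lemma fourierSeries_sub {c d : Lattice n → ℂ} (hc : Rapid c) (hd : Rapid d) :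
    fourierSeries (c - d) = fourierSeries c - fourierSeries d := by
  ext x
  simp only [fourierSeries, Pi.sub_apply, sub_mul]
  exact (summable_fourierSeries hc x).tsum_sub (summable_fourierSeries hd x)

lemma fourierSeries_const_mul (c : Lattice n → ℂ) (z : ℂ) :
    fourierSeries (fun η => z * c η) = fun x => z * fourierSeries c x := by
  ext x
  simp only [fourierSeries, mul_assoc, tsum_mul_left]

lemma norm_fourierSeries_le {c : Lattice n → ℂ} {C : ℝ}
    (hc : ∀ η, ‖c η‖ * bracket η ^ (2 * n) ≤ C) (x : Torus n) :
    ‖fourierSeries c x‖ ≤ C * ∑' η : Lattice n, (bracket η ^ (2 * n))⁻¹ := by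
  refine tsum_of_norm_bounded (summable_bracket.hasSum.mul_left C) fun η => ?_
  have := bracket_pos η
  rw [norm_mul, norm_mFourier_apply, mul_one, ← div_eq_mul_inv, le_div_iff₀ (by positivity)]
  exact hc η

lemma torusD_fourierSeries {c : Lattice n → ℂ} (hc : Rapid c) (j : Fin n) :
    torusD j (fourierSeries c) = fourierSeries fun η => (η j : ℂ) * c η := by
  ext x
  refine torusD_eq_of_hasDerivAt ?_
  have h := hasDerivAt_tsum (𝕜 := ℝ) (F := ℂ)
    (g := fun (η : Lattice n) (t : ℝ) => c η * mFourier η (x + Pi.single j (t : UnitAddCircle)))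
    (g' := fun (η : Lattice n) (t : ℝ) => 2 * Real.pi * Complex.I * ((η j : ℂ) * c η *
      mFourier η (x + Pi.single j (t : UnitAddCircle))))
    (u := fun η => 2 * Real.pi * ‖(η j : ℂ) * c η‖) (y₀ := 0)
    ((hc.coord_mul j).summable_norm.mul_left _) ?_ ?_ ?_ 0
  · refine h.congr_deriv ?_
    rw [tsum_mul_left]
    simp [fourierSeries]
  · intro η t
    have h1 : HasDerivAt (fun t : ℝ => 2 * (Real.pi : ℂ) * Complex.I * (η j * (t : ℂ)))
        (2 * (Real.pi : ℂ) * Complex.I * (η j * 1)) t :=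
      ((Complex.ofRealCLM.hasDerivAt (x := t)).const_mul _).const_mul _
    have h2 := (h1.cexp.const_mul (mFourier η x)).const_mul (c η)
    simp only [mFourier_apply_add, mFourier_single_apply]
    refine (h2.congr_deriv ?_)
    ring
  · intro η t
    rw [norm_mul, norm_mul _ (mFourier η _), norm_mFourier_apply, mul_one]
    simp [abs_of_pos Real.pi_pos]
  · exact summable_fourierSeries hc _

/-- Each term is a one-variable exponential composed with the linear form `t ↦ η·t`, of norm at most
`bracket η`. Its `k`-th derivative is thus at most `(2π)^k ⟨η⟩^k` times the coefficient, which is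
summable. -/
lemma isSmoothOnTorus_fourierSeries {c : Lattice n → ℂ} (hc : Rapid c) :
    IsSmoothOnTorus (fourierSeries c) := by
  let ℓ : Lattice n → (Fin n → ℝ) →L[ℝ] ℝ := fun η =>
    ∑ i, (η i : ℝ) • ContinuousLinearMap.proj (R := ℝ) (φ := fun _ : Fin n => ℝ) i
  have hℓ : ∀ η, ‖ℓ η‖ ≤ bracket η := fun η => by
    refine ContinuousLinearMap.opNorm_le_bound _ (bracket_pos η).le fun t => ?_
    have e : ℓ η t = ∑ i, (η i : ℝ) * t i := by simp [ℓ]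
    rw [e, bracket]
    calc ‖∑ i, (η i : ℝ) * t i‖ ≤ ∑ i, |(η i : ℝ)| * ‖t‖ := by
          refine norm_sum_le_of_le _ fun i _ => ?_
          rw [norm_mul, Real.norm_eq_abs]
          exact mul_le_mul_of_nonneg_left (norm_le_pi_norm t i) (abs_nonneg _)
      _ ≤ _ := by
          rw [← Finset.sum_mul]
          refine mul_le_mul_of_nonneg_right ?_ (norm_nonneg t)
          linarith
  let E : ℝ → ℂ := fun s => Complex.exp (2 * Real.pi * Complex.I * s)
  have hE : ContDiff ℝ ∞ E := by
    have : ContDiff ℝ ∞ fun s : ℝ => (s : ℂ) := Complex.ofRealCLM.contDiff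
    exact (contDiff_const.mul this).cexp
  have hEk : ∀ (k : ℕ) (s : ℝ), ‖iteratedFDeriv ℝ k E s‖ = (2 * Real.pi) ^ k := by
    intro k s
    rw [norm_iteratedFDeriv_eq_norm_iteratedDeriv]
    have : iteratedDeriv k E = fun s : ℝ => (2 * Real.pi * Complex.I) ^ k * E s := by
      induction k with
      | zero => simp
      | succ k ih =>
        rw [iteratedDeriv_succ, ih]
        ext s
        have h1 : HasDerivAt (fun t : ℝ => 2 * (Real.pi : ℂ) * Complex.I * (t : ℂ))
            (2 * (Real.pi : ℂ) * Complex.I * 1) s :=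
          (Complex.ofRealCLM.hasDerivAt (x := s)).const_mul _
        rw [(h1.cexp.const_mul _).deriv]
        simp only [E]
        ring
    rw [this]
    have h2 : ‖E s‖ = 1 := by
      have := Complex.norm_exp_ofReal_mul_I (2 * Real.pi * s)
      rw [← this]
      simp only [E]
      congr 2
      push_cast
      ring
    simp [h2, abs_of_pos Real.pi_pos]
  have hfun : (fun t : Fin n → ℝ => fourierSeries c fun i => (t i : UnitAddCircle)) =
      fun t => ∑' η, c η * (E ∘ ℓ η) t := by
    ext t
    simp only [fourierSeries]
    congr 1
    ext η
    have := mFourier_torusMk η t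
    change mFourier η (fun i => (t i : UnitAddCircle)) = _ at this
    rw [this]
    simp [E, ℓ]
  unfold IsSmoothOnTorus
  rw [hfun]
  refine contDiff_tsum (𝕜 := ℝ) (N := ⊤) (v := fun k η => (2 * Real.pi) ^ k * (‖c η‖ * bracket η ^ k))
    (fun η => contDiff_const.mul (hE.comp (ℓ η).contDiff))
    (fun k _ => (hc.summable_mul k).mul_left _) fun k η t _ => ?_
  have e1 : (fun t => c η * (E ∘ ℓ η) t) = c η • (E ∘ ℓ η) := rfl
  rw [e1, iteratedFDeriv_const_smul_apply ((hE.comp (ℓ η).contDiff).of_le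
    (by exact_mod_cast le_top)).contDiffAt, norm_smul,
    (ℓ η).iteratedFDeriv_comp_right hE t (by exact_mod_cast le_top)]
  have h3 := (iteratedFDeriv ℝ k E (ℓ η t)).norm_compContinuousLinearMap_le fun _ => ℓ η
  rw [hEk, Finset.prod_const, Finset.card_univ, Fintype.card_fin] at h3
  calc _ ≤ ‖c η‖ * ((2 * Real.pi) ^ k * bracket η ^ k) := by
        refine mul_le_mul_of_nonneg_left (h3.trans ?_) (norm_nonneg _)
        have := Real.pi_pos
        gcongr
        exact hℓ η
    _ = _ := by ring

lemma integrable_mFourier_mul {g : Torus n → ℂ} (hg : Continuous g) (η : Lattice n) :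
    Integrable (fun x => mFourier η x * g x) (torusMeasure n) :=
  ((mFourier η).continuous.mul hg).integrable_of_hasCompactSupport
    (HasCompactSupport.of_compactSpace _)

/-- Integration of a Fourier series against a continuous function. -/
lemma integral_fourierSeries_mul {c : Lattice n → ℂ} (hc : Rapid c) {g : Torus n → ℂ}
    (hg : Continuous g) :
    ∫ x, fourierSeries c x * g x ∂(torusMeasure n) =
      ∑' η, c η * ∫ x, mFourier η x * g x ∂(torusMeasure n) := by
  have h1 : ∀ η, Integrable (fun x => c η * (mFourier η x * g x)) (torusMeasure n) := fun η =>
    (integrable_mFourier_mul hg η).const_mul _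
  have h2 : Summable fun η => ∫ x, ‖c η * (mFourier η x * g x)‖ ∂(torusMeasure n) := by
    simp only [norm_mul, norm_mFourier_apply, one_mul, integral_const_mul]
    exact hc.summable_norm.mul_right _
  have h3 := integral_tsum_of_summable_integral_norm h1 h2
  simp only [integral_const_mul] at h3
  rw [h3]
  simp only [fourierSeries, ← tsum_mul_right, mul_assoc]

lemma integral_mFourier (η : Lattice n) :
    ∫ x, mFourier η x ∂(torusMeasure n) = if η = 0 then 1 else 0 := by
  simp only [mFourier, ContinuousMap.coe_mk, torusMeasure]
  rw [integral_fintype_prod_eq_prod (𝕜 := ℂ) (fun i => fun y : UnitAddCircle => fourier (η i) y)]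
  have h1 : ∀ z : ℤ, ∫ y : UnitAddCircle, fourier z y ∂AddCircle.haarAddCircle =
      if z = 0 then 1 else 0 := by
    intro z
    have := congrFun (fourierCoeff_fourier (T := 1) z) 0
    simpa [fourierCoeff, Pi.single_apply, eq_comm] using this
  simp only [h1]
  by_cases h : η = 0
  · simp [h]
  · obtain ⟨i, hi⟩ := Function.ne_iff.1 h
    rw [if_neg h]
    exact Finset.prod_eq_zero (Finset.mem_univ i) (if_neg hi)

lemma torusCoeff_fourierSeries {c : Lattice n → ℂ} (hc : Rapid c) :
    torusCoeff (fourierSeries c) = c := by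
  ext ζ
  have h := integral_fourierSeries_mul hc (mFourier (-ζ)).continuous
  simp only [torusCoeff, mul_comm (mFourier (-ζ) _)]
  rw [h, tsum_eq_single ζ]
  · simp [← mFourier_add, integral_mFourier]
  · intro η hη
    simp only [← mFourier_add, integral_mFourier]
    rw [if_neg (by rwa [← sub_eq_add_neg, sub_eq_zero]), mul_zero]

lemma norm_torusCoeff_le {g : Torus n → ℂ} {C : ℝ} (hC : ∀ x, ‖g x‖ ≤ C) (η : Lattice n) :
    ‖torusCoeff g η‖ ≤ C := by
  have := norm_integral_le_of_norm_le_const (μ := torusMeasure n) (C := C)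
    (f := fun x => mFourier (-η) x * g x)
    (Filter.Eventually.of_forall fun x => by rw [norm_mul, norm_mFourier_apply, one_mul]; exact hC x)
  simpa [torusCoeff] using this

lemma integral_mFourier_mul_translate (g : Torus n → ℂ) (j : Fin n) (η : Lattice n) (t : ℝ) :
    ∫ x, mFourier (-η) x * g (x + Pi.single j (t : UnitAddCircle)) ∂(torusMeasure n) =
      Complex.exp (2 * Real.pi * Complex.I * (η j * t)) * torusCoeff g η := by
  rw [torusCoeff, ← integral_const_mul]
  refine Eq.trans ?_ (integral_add_right_eq_self (μ := torusMeasure n)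
    (fun x => Complex.exp (2 * Real.pi * Complex.I * (η j * t)) * (mFourier (-η) x * g x))
    (Pi.single j (t : UnitAddCircle)))
  congr 1
  ext x
  rw [mFourier_apply_add, mFourier_single_apply]
  have : Complex.exp (2 * Real.pi * Complex.I * (η j * t)) *
      Complex.exp (2 * Real.pi * Complex.I * ((-η) j * t)) = 1 := by
    rw [← Complex.exp_add, Complex.exp_eq_one_iff]
    exact ⟨0, by simp⟩
  linear_combination -(mFourier (-η) x * g (x + Pi.single j (t : UnitAddCircle))) * this

/-- Replaces integration by parts: the coefficient of a translate is differentiated under the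
integral here, and through its explicit exponential factor in `torusCoeff_torusD`; the two
derivatives must agree. -/
lemma hasDerivAt_integral_translate {g : Torus n → ℂ} (hg : IsSmoothOnTorus g) (j : Fin n)
    (η : Lattice n) :
    HasDerivAt (fun t : ℝ => ∫ x, mFourier (-η) x * g (x + Pi.single j (t : UnitAddCircle))
      ∂(torusMeasure n)) (2 * Real.pi * Complex.I * torusCoeff (torusD j g) η) 0 := by
  have hD := (hg.torusD j).continuous
  have hc := hg.continuous
  obtain ⟨B, hB⟩ : ∃ B, ∀ x, ‖torusD j g x‖ ≤ B := by
    obtain ⟨B, hB⟩ := isCompact_univ.exists_bound_of_continuousOn hD.continuousOn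
    exact ⟨B, fun x => hB x trivial⟩
  have c1 : ∀ y : Torus n, Continuous fun x => g (x + y) := fun y =>
    hc.comp (continuous_add_const y)
  have c2 : Continuous fun x : Torus n => 2 * (Real.pi : ℂ) * Complex.I *
      torusD j g (x + Pi.single j ((0 : ℝ) : UnitAddCircle)) :=
    continuous_const.mul (hD.comp (continuous_add_const _))
  have hbound : ∀ (x : Torus n) (t : ℝ), ‖mFourier (-η) x *
      (2 * Real.pi * Complex.I * torusD j g (x + Pi.single j (t : UnitAddCircle)))‖ ≤
        ‖2 * (Real.pi : ℂ) * Complex.I‖ * B := fun x t => by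
    rw [norm_mul, norm_mFourier_apply, one_mul, norm_mul]
    exact mul_le_mul_of_nonneg_left (hB _) (norm_nonneg _)
  have i1 : ∀ t : ℝ, Integrable (fun x => mFourier (-η) x *
      g (x + Pi.single j (t : UnitAddCircle))) (torusMeasure n) := fun t =>
    integrable_mFourier_mul (c1 _) _
  have i2 : Integrable (fun x => mFourier (-η) x * (2 * (Real.pi : ℂ) * Complex.I *
      torusD j g (x + Pi.single j ((0 : ℝ) : UnitAddCircle)))) (torusMeasure n) :=
    integrable_mFourier_mul c2 _
  have hd : ∀ (x : Torus n) (t : ℝ), HasDerivAt (fun t : ℝ => mFourier (-η) x *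
      g (x + Pi.single j (t : UnitAddCircle))) (mFourier (-η) x *
      (2 * Real.pi * Complex.I * torusD j g (x + Pi.single j (t : UnitAddCircle)))) t :=
    fun x t => (hg.hasDerivAt_line j x t).const_mul _
  have h1 := (hasDerivAt_integral_of_dominated_loc_of_deriv_le (μ := torusMeasure n) (𝕜 := ℝ)
    (bound := fun _ => ‖2 * (Real.pi : ℂ) * Complex.I‖ * B) (s := Set.univ) (x₀ := 0)
    Filter.univ_mem (Filter.Eventually.of_forall fun t => (i1 t).aestronglyMeasurable)
    (i1 0) i2.aestronglyMeasurable (Filter.Eventually.of_forall fun x t _ => hbound x t)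
    (integrable_const _) (Filter.Eventually.of_forall fun x t _ => hd x t)).2
  refine h1.congr_deriv ?_
  rw [torusCoeff, ← integral_const_mul]
  congr 1
  ext x
  rw [AddCircle.coe_zero, Pi.single_zero, add_zero]
  ring

lemma torusCoeff_torusD {g : Torus n → ℂ} (hg : IsSmoothOnTorus g) (j : Fin n) (η : Lattice n) :
    torusCoeff (torusD j g) η = η j * torusCoeff g η := by
  have h1 := hasDerivAt_integral_translate hg j η
  simp only [integral_mFourier_mul_translate] at h1
  have h2 : HasDerivAt (fun t : ℝ => Complex.exp (2 * Real.pi * Complex.I * (η j * t)) *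
      torusCoeff g η) (2 * Real.pi * Complex.I * (η j * torusCoeff g η)) 0 := by
    have h3 : HasDerivAt (fun t : ℝ => 2 * (Real.pi : ℂ) * Complex.I * (η j * (t : ℂ)))
        (2 * (Real.pi : ℂ) * Complex.I * (η j * 1)) 0 :=
      ((Complex.ofRealCLM.hasDerivAt (x := (0 : ℝ))).const_mul _).const_mul _
    refine (h3.cexp.mul_const (torusCoeff g η)).congr_deriv ?_
    rw [Complex.ofReal_zero, mul_zero, mul_zero, Complex.exp_zero]
    ring
  exact mul_left_cancel₀ two_pi_I_ne_zero (h1.unique h2)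

end

/-! ### Decay of Fourier coefficients and the correspondence of classes. -/

section

open MeasureTheory UnitAddTorus

variable {n : ℕ}

/-- Pigeonhole: one of the `n + 1` summands `1, |η₁|, …, |ηₙ|` is at least their average. Powers of
single frequencies therefore suffice for rapid decay. -/
lemma bracket_le_or_exists (η : Lattice n) :
    bracket η ≤ n + 1 ∨ ∃ j, bracket η ≤ (n + 1) * |(η j : ℝ)| := by
  by_contra! h
  obtain ⟨h1, h2⟩ := h
  have h3 : ∑ j, (n + 1) * |(η j : ℝ)| ≤ ∑ _j : Fin n, bracket η :=
    Finset.sum_le_sum fun j _ => (h2 j).le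
  rw [← Finset.mul_sum, Finset.sum_const, Finset.card_univ, Fintype.card_fin, nsmul_eq_mul] at h3
  have h4 : bracket η = 1 + ∑ i, |(η i : ℝ)| := rfl
  have h5 : ∑ i, |(η i : ℝ)| = bracket η - 1 := by rw [h4]; ring
  rw [h5] at h3
  linarith

lemma bracket_pow_le (η : Lattice n) (N : ℕ) :
    bracket η ^ N ≤ (n + 1) ^ N * (1 + ∑ j, |(η j : ℝ)| ^ N) := by
  have h0 : 0 ≤ ∑ j, |(η j : ℝ)| ^ N := Finset.sum_nonneg fun j _ => by positivity
  have hb := bracket_pos η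
  rcases bracket_le_or_exists η with h | ⟨j, h⟩
  · calc bracket η ^ N ≤ (n + 1) ^ N * 1 := by rw [mul_one]; gcongr
      _ ≤ _ := by gcongr; linarith
  · calc bracket η ^ N ≤ ((n + 1) * |(η j : ℝ)|) ^ N := by gcongr
      _ = (n + 1) ^ N * |(η j : ℝ)| ^ N := mul_pow _ _ _
      _ ≤ _ := by
        gcongr
        have := Finset.single_le_sum (f := fun j => |(η j : ℝ)| ^ N) (fun _ _ => by positivity)
          (Finset.mem_univ j)
        linarith

/-- Rapid decay follows from bounds on the products with powers of single frequencies. -/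
lemma hasOrder_of_coord_bounds {Λ : Lattice n → ℝ} {m : ℝ} {a : Kernel n}
    (h0 : ∃ C : ℝ, ∀ k η, ‖a k η‖ ≤ C * Λ k ^ m)
    (h : ∀ (j : Fin n) (N : ℕ), ∃ C : ℝ, ∀ k η, |(η j : ℝ)| ^ N * ‖a k η‖ ≤ C * Λ k ^ m) :
    HasOrder Λ m a := by
  intro N
  obtain ⟨A, hA⟩ := h0
  choose B hB using fun j => h j N
  refine ⟨(n + 1) ^ N * (A + ∑ j, B j), fun k η => ?_⟩
  calc ‖a k η‖ * bracket η ^ N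
      ≤ ‖a k η‖ * ((n + 1) ^ N * (1 + ∑ j, |(η j : ℝ)| ^ N)) := by
        gcongr; exact bracket_pow_le η N
    _ = (n + 1) ^ N * (‖a k η‖ + ∑ j, |(η j : ℝ)| ^ N * ‖a k η‖) := by
        rw [← Finset.sum_mul]; ring
    _ ≤ (n + 1) ^ N * (A * Λ k ^ m + ∑ j, B j * Λ k ^ m) := by
        exact mul_le_mul_of_nonneg_left (add_le_add (hA k η)
          (Finset.sum_le_sum fun j _ => hB j k η)) (by positivity)
    _ = _ := by rw [← Finset.sum_mul]; ring

/-- With a constant weight, the estimates for families specialize to a single function. -/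
lemma hasOrder_const_iff_rapid {c : Lattice n → ℂ} :
    HasOrder (fun _ => 1) 0 (fun _ : Lattice n => c) ↔ Rapid c := by
  simp only [HasOrder, Rapid, Real.rpow_zero, mul_one]
  exact forall_congr' fun N => exists_congr fun C => ⟨fun h => h 0, fun h _ => h⟩

lemma IsSmoothOnTorus.iterate_torusD {g : Torus n → ℂ} (hg : IsSmoothOnTorus g) (j : Fin n)
    (N : ℕ) : IsSmoothOnTorus ((LatticePDO.torusD j)^[N] g) := by
  induction N with
  | zero => exact hg
  | succ N ih => rw [Function.iterate_succ_apply']; exact ih.torusD j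

lemma torusCoeff_iterate_torusD {g : Torus n → ℂ} (hg : IsSmoothOnTorus g) (j : Fin n) (N : ℕ)
    (η : Lattice n) : torusCoeff ((torusD j)^[N] g) η = (η j : ℂ) ^ N * torusCoeff g η := by
  induction N with
  | zero => simp
  | succ N ih =>
    rw [Function.iterate_succ_apply', torusCoeff_torusD (hg.iterate_torusD j N), ih]
    ring

/-- Bounds on the derivatives of a family of smooth functions bound its Fourier coefficients. -/
lemma hasOrder_torusCoeff {Λ : Lattice n → ℝ} {m : ℝ} {g : Lattice n → Torus n → ℂ}
    (hg : ∀ k, IsSmoothOnTorus (g k)) (h0 : ∃ C : ℝ, ∀ k x, ‖g k x‖ ≤ C * Λ k ^ m)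
    (h : ∀ (j : Fin n) (N : ℕ), ∃ C : ℝ, ∀ k x, ‖(torusD j)^[N] (g k) x‖ ≤ C * Λ k ^ m) :
    HasOrder Λ m fun k => torusCoeff (g k) := by
  refine hasOrder_of_coord_bounds ?_ fun j N => ?_
  · obtain ⟨C, hC⟩ := h0
    exact ⟨C, fun k η => norm_torusCoeff_le (hC k) η⟩
  · obtain ⟨C, hC⟩ := h j N
    refine ⟨C, fun k η => ?_⟩
    have := norm_torusCoeff_le (hC k) η
    rw [torusCoeff_iterate_torusD (hg k), norm_mul, norm_pow] at this
    simpa using this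

lemma IsSmoothOnTorus.exists_bound {g : Torus n → ℂ} (hg : IsSmoothOnTorus g) :
    ∃ C : ℝ, ∀ x, ‖g x‖ ≤ C := by
  obtain ⟨B, hB⟩ := isCompact_univ.exists_bound_of_continuousOn hg.continuous.continuousOn
  exact ⟨B, fun x => hB x trivial⟩

lemma IsSmoothOnTorus.rapid {g : Torus n → ℂ} (hg : IsSmoothOnTorus g) : Rapid (torusCoeff g) := by
  rw [← hasOrder_const_iff_rapid]
  refine hasOrder_torusCoeff (fun _ => hg) ?_ fun j N => ?_
  · obtain ⟨C, hC⟩ := hg.exists_bound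
    exact ⟨C, fun _ x => by simpa using hC x⟩
  · obtain ⟨C, hC⟩ := (hg.iterate_torusD j N).exists_bound
    exact ⟨C, fun _ x => by simpa using hC x⟩

lemma IsSmoothOnTorus.fourierSeries_torusCoeff {g : Torus n → ℂ} (hg : IsSmoothOnTorus g) :
    fourierSeries (torusCoeff g) = g := by
  have hs : Summable (mFourierCoeff (⟨g, hg.continuous⟩ : C(Torus n, ℂ))) :=
    hg.rapid.summable_norm.of_norm
  ext x
  exact (hasSum_mFourier_series_apply_of_summable hs x).tsum_eq

lemma torusCoeff_mul {f g : Torus n → ℂ} (hf : IsSmoothOnTorus f) (hg : Continuous g)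
    (ζ : Lattice n) :
    torusCoeff (f * g) ζ = ∑' η, torusCoeff f η * torusCoeff g (ζ - η) := by
  have h := integral_fourierSeries_mul hf.rapid (g := fun x => mFourier (-ζ) x * g x)
    ((mFourier (-ζ)).continuous.mul hg)
  rw [hf.fourierSeries_torusCoeff] at h
  have e : torusCoeff (f * g) ζ = ∫ x, f x * (mFourier (-ζ) x * g x) ∂(torusMeasure n) := by
    rw [torusCoeff]
    congr 1
    ext x
    rw [Pi.mul_apply]; ring
  rw [e, h]
  congr 1
  ext η
  rw [torusCoeff]
  congr 2
  ext x
  rw [neg_sub, sub_eq_add_neg, mFourier_add, mul_assoc]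

/-! ### Multi-index differences -/

section diffOp

variable {G H : Type*} [AddCommGroup G] [AddCommGroup H]

/-- The product of the operators `Δⱼ^αⱼ` over a list of directions. -/
def listDiff (α : Fin n → ℕ) (l : List (Fin n)) (f : Lattice n → G) : Lattice n → G :=
  l.foldr (fun j g => (coordDiff j)^[α j] g) f

lemma diffOp_eq_listDiff (α : Fin n → ℕ) (f : Lattice n → G) :
    diffOp α f = listDiff α (List.finRange n) f := rfl

lemma listDiff_cons (α : Fin n → ℕ) (j : Fin n) (l : List (Fin n)) (f : Lattice n → G) :
    listDiff α (j :: l) f = (coordDiff j)^[α j] (listDiff α l f) := rfl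

/-- Transfers an operator across `Δ^α`. `P` carries the side condition under which it commutes with
a difference, and only directions with `0 < α j` are tested, so multiplication by `kⱼ` is allowed
when `α j = 0`. -/
lemma listDiff_map (F : (Lattice n → G) → Lattice n → H) (P : (Lattice n → G) → Prop)
    (α : Fin n → ℕ) (l : List (Fin n))
    (hP : ∀ j f, P f → P (coordDiff j f))
    (hF : ∀ j f, j ∈ l → 0 < α j → P f → F (coordDiff j f) = coordDiff j (F f))
    {f : Lattice n → G} (hf : P f) :
    P (listDiff α l f) ∧ F (listDiff α l f) = listDiff α l (F f) := by
  induction l with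
  | nil => exact ⟨hf, rfl⟩
  | cons j l ih =>
    obtain ⟨ih1, ih2⟩ := ih fun i f hi => hF i f (List.mem_cons_of_mem _ hi)
    rw [listDiff_cons, listDiff_cons, ← ih2]
    have : ∀ s ≤ α j, P ((coordDiff j)^[s] (listDiff α l f)) ∧
        F ((coordDiff j)^[s] (listDiff α l f)) = (coordDiff j)^[s] (F (listDiff α l f)) := by
      intro s hs
      induction s with
      | zero => exact ⟨ih1, rfl⟩
      | succ s ihs =>
        obtain ⟨h1, h2⟩ := ihs (by omega)
        rw [Function.iterate_succ_apply', Function.iterate_succ_apply']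
        exact ⟨hP _ _ h1, by rw [hF _ _ List.mem_cons_self (by omega) h1, h2]⟩
    exact this _ le_rfl

lemma coordDiff_diffOp (α : Fin n → ℕ) (j : Fin n) (f : Lattice n → G) :
    coordDiff j (diffOp α f) = diffOp α (coordDiff j f) :=
  (listDiff_map (coordDiff j) (fun _ => True) α (List.finRange n) (fun _ _ _ => trivial)
    (fun i f _ _ _ => coordDiff_comm j i f) trivial).2

lemma listDiff_congr {α β : Fin n → ℕ} {l : List (Fin n)} (h : ∀ j ∈ l, α j = β j)
    (f : Lattice n → G) : listDiff α l f = listDiff β l f := by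
  induction l with
  | nil => rfl
  | cons i l ih =>
    rw [listDiff_cons, listDiff_cons, ih fun j hj => h j (List.mem_cons_of_mem _ hj),
      h i List.mem_cons_self]

lemma listDiff_add_single (α : Fin n → ℕ) (j : Fin n) {l : List (Fin n)} (hl : l.Nodup)
    (hj : j ∈ l) (f : Lattice n → G) :
    listDiff (α + Pi.single j 1) l f = coordDiff j (listDiff α l f) := by
  induction l with
  | nil => simp at hj
  | cons i l ih =>
    obtain ⟨hil, hl⟩ := List.nodup_cons.1 hl
    rw [listDiff_cons, listDiff_cons]
    by_cases h : j = i
    · subst h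
      rw [listDiff_congr (β := α) fun i hi => by
        have : i ≠ j := fun h => hil (h ▸ hi)
        simp [this]]
      rw [Pi.add_apply, Pi.single_eq_same, Function.iterate_succ_apply']
    · rw [ih hl ((List.mem_cons.1 hj).resolve_left h), Pi.add_apply,
        Pi.single_eq_of_ne (Ne.symm h), add_zero]
      have hc : Function.Commute (coordDiff (G := G) i) (coordDiff j) := fun f =>
        coordDiff_comm i j f
      exact (hc.iterate_left (α i)) _

lemma diffOp_add_single (α : Fin n → ℕ) (j : Fin n) (f : Lattice n → G) :
    diffOp (α + Pi.single j 1) f = diffOp α (coordDiff j f) := by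
  rw [← coordDiff_diffOp]
  exact listDiff_add_single α j (List.nodup_finRange n) (List.mem_finRange j) f

lemma diffOp_zero (f : Lattice n → G) : diffOp (0 : Fin n → ℕ) f = f := by
  rw [diffOp_eq_listDiff]
  induction List.finRange n with
  | nil => rfl
  | cons i l ih => rw [listDiff_cons, ih]; rfl

lemma multiLength_add_single (α : Fin n → ℕ) (j : Fin n) :
    multiLength (α + Pi.single j 1) = multiLength α + 1 := by
  simp [multiLength, Finset.sum_add_distrib]

end diffOp

/-! ### Symbol classes as classes of kernels. -/

section classes

variable {Λ : Lattice n → ℝ} {ρ m : ℝ} {a : Kernel n}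

lemma hasOrder_diffOp (h : ∀ p, DiffOrder Λ ρ p m a) (α : Fin n → ℕ) :
    HasOrder Λ (m - ρ * (multiLength α : ℝ)) (diffOp α a) := by
  suffices key : ∀ (l : List (Fin n)) (p : ℕ),
      DiffOrder Λ ρ p (m - ρ * ((l.map α).sum : ℕ)) (listDiff α l a) by
    have := key (List.finRange n) 0
    rw [multiLength, Fin.sum_univ_def]
    exact this
  intro l
  induction l with
  | nil => simpa [listDiff] using h
  | cons j l ih =>
    rw [listDiff_cons, List.map_cons, List.sum_cons]
    induction α j with
    | zero => simpa using ih
    | succ s ihs =>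
      intro p
      rw [Function.iterate_succ_apply']
      convert (ihs (p + 1)).2 j using 1
      push_cast
      ring

lemma diffOrder_of_diffOp
    (h : ∀ α : Fin n → ℕ, HasOrder Λ (m - ρ * (multiLength α : ℝ)) (diffOp α a)) (p : ℕ) :
    DiffOrder Λ ρ p m a := by
  have h0 : ∀ {m : ℝ} {a : Kernel n},
      (∀ α : Fin n → ℕ, HasOrder Λ (m - ρ * (multiLength α : ℝ)) (diffOp α a)) →
      HasOrder Λ m a := fun h => by
    have := h 0
    rwa [diffOp_zero, show multiLength (0 : Fin n → ℕ) = 0 by simp [multiLength], Nat.cast_zero,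
      mul_zero, sub_zero] at this
  induction p generalizing m a with
  | zero => exact h0 h
  | succ p ih =>
    refine ⟨h0 h, fun j => ih fun α => ?_⟩
    have := h (α + Pi.single j 1)
    rw [diffOp_add_single, multiLength_add_single] at this
    convert this using 1
    push_cast
    ring

/-- The kernel `k^γ Δ^γ a`. -/
def monoDiff (γ : Fin n → ℕ) (a : Kernel n) : Kernel n :=
  fun k η => (latticeMonomial γ k : ℂ) * diffOp γ a k η

lemma monoDiff_zero (a : Kernel n) : monoDiff 0 a = a := by
  ext k η
  simp [monoDiff, latticeMonomial, diffOp_zero]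

/-- As `γ j = 0`, the operator `Δ^γ` does not move the `j`-th coordinate and commutes with
multiplication by `kⱼ`. -/
lemma monoDiff_add_single {γ : Fin n → ℕ} {j : Fin n} (hγ : γ j = 0) (a : Kernel n) :
    monoDiff (γ + Pi.single j 1) a = monoDiff γ (eulerDiff j a) := by
  have h1 : diffOp γ (eulerDiff j a) = fun k η => (k j : ℂ) * diffOp γ (coordDiff j a) k η := by
    refine ((listDiff_map (fun (f : Kernel n) k η => (k j : ℂ) * f k η) (fun _ => True) γ
      (List.finRange n) (fun _ _ _ => trivial) (fun i f _ hi _ => ?_) trivial).2).symm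
    have hij : j ≠ i := fun h => by rw [← h, hγ] at hi; exact lt_irrefl _ hi
    ext k η
    simp only [coordDiff, fwdDiff, Pi.sub_apply, Pi.add_apply, Pi.single_eq_of_ne hij, add_zero]
    ring
  ext k η
  have h2 : latticeMonomial (γ + Pi.single j 1) k = latticeMonomial γ k * k j := by
    simp only [latticeMonomial, Pi.add_apply, pow_add, Finset.prod_mul_distrib]
    congr 1
    rw [Finset.prod_eq_single j (by intro i _ hi; simp [hi]) (by simp)]
    simp
  rw [monoDiff, monoDiff, h1, diffOp_add_single, h2]
  push_cast
  ring

/-- Each entry of the list chooses whether `kⱼ Δⱼ` is applied, so the recursion runs over the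
exponents `γ ∈ {0,1}ⁿ` supported on the list. Distinct entries keep every `γ j ≤ 1`. -/
lemma eulerOrder_iff_monoDiff {L : List (Fin n)} (hL : L.Nodup) :
    EulerOrder Λ ρ L m a ↔ ∀ γ : Fin n → ℕ, (∀ i, γ i ≤ 1) → (∀ i, i ∉ L → γ i = 0) →
      ∀ p, DiffOrder Λ ρ p m (monoDiff γ a) := by
  induction L generalizing a with
  | nil =>
    constructor
    · intro h γ _ h0
      rw [show γ = 0 from funext fun i => h0 i (by simp), monoDiff_zero]
      exact h
    · intro h
      have := h 0 (by simp) (by simp)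
      rwa [monoDiff_zero] at this
  | cons j L ih =>
    obtain ⟨hj, hL⟩ := List.nodup_cons.1 hL
    constructor
    · rintro ⟨h1, h2⟩ γ hγ h0
      by_cases hγj : γ j = 0
      · refine (ih hL).1 h1 γ hγ fun i hi => ?_
        by_cases hij : i = j
        · rw [hij, hγj]
        · exact h0 i (by simp [hi, hij])
      · have hγ1 : γ j = 1 := by have := hγ j; omega
        have e : γ = Function.update γ j 0 + Pi.single j 1 := by
          ext i
          by_cases hij : i = j
          · subst hij; simp [hγ1]
          · simp [hij]
        rw [e, monoDiff_add_single (by simp)]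
        refine (ih hL).1 h2 _ (fun i => ?_) fun i hi => ?_
        · by_cases hij : i = j
          · subst hij; simp
          · simpa [hij] using hγ i
        · by_cases hij : i = j
          · subst hij; simp
          · simpa [hij] using h0 i (by simp [hi, hij])
    · intro h
      refine ⟨(ih hL).2 fun γ hγ h0 => h γ hγ fun i hi => h0 i fun hi' =>
        hi (List.mem_cons_of_mem _ hi'), (ih hL).2 fun γ hγ h0 => ?_⟩
      rw [← monoDiff_add_single (h0 j hj)]
      refine h _ (fun i => ?_) fun i hi => ?_
      · by_cases hij : i = j
        · subst hij; simp [h0 i hj]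
        · simpa [hij] using hγ i
      · have hij : i ≠ j := fun h => hi (by simp [h])
        simpa [hij] using h0 i fun hi' => hi (List.mem_cons_of_mem _ hi')

/-! ### Symbols as Fourier series of kernels -/

/-- The symbol with a given kernel. -/
def kernelSymbol (a : Kernel n) : Lattice n → Torus n → ℂ := fun k => fourierSeries (a k)

/-- The falling factorial `z (z - 1) ⋯ (z - l + 1)`. -/
def fallingFactorial (z : ℂ) : ℕ → ℂ
  | 0 => 1
  | l + 1 => (z - l) * fallingFactorial z l

lemma fallingFactorial_succ_mul (z w : ℂ) (l : ℕ) : fallingFactorial z (l + 1) * w =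
    z * (fallingFactorial z l * w) - l * (fallingFactorial z l * w) := by
  rw [fallingFactorial]; ring

/-- Either `|z| ≤ 2l`, and the constant suffices, or every factor satisfies `|z - s| ≥ |z| / 2`.
Bounds for `D^{(β)}` therefore control ordinary powers of the frequencies. -/
lemma abs_pow_le_fallingFactorial (z : ℤ) (l : ℕ) :
    |(z : ℝ)| ^ l ≤ 2 ^ l * ‖fallingFactorial z l‖ + (2 * l) ^ l := by
  by_cases h : |(z : ℝ)| ≤ 2 * l
  · have h1 : |(z : ℝ)| ^ l ≤ (2 * l) ^ l := by gcongr
    have h2 : 0 ≤ 2 ^ l * ‖fallingFactorial z l‖ := by positivity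
    linarith
  · have key : ∀ s ≤ l, |(z : ℝ)| ^ s ≤ 2 ^ s * ‖fallingFactorial z s‖ := by
      intro s hs
      induction s with
      | zero => simp [fallingFactorial]
      | succ s ih =>
        have h1 : |(z : ℝ)| ≤ 2 * ‖(z : ℂ) - s‖ := by
          have e : ‖(z : ℂ) - s‖ = |(z : ℝ) - s| := by
            rw [← Real.norm_eq_abs, ← Complex.norm_real]; push_cast; rfl
          have h2 : |(z : ℝ)| - s ≤ |(z : ℝ) - s| := by
            have := abs_sub_abs_le_abs_sub (z : ℝ) s
            rwa [Nat.abs_cast] at this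
          have h3 : (s : ℝ) ≤ l := by exact_mod_cast (by omega : s ≤ l)
          rw [e]
          linarith
        rw [fallingFactorial, norm_mul, pow_succ, pow_succ]
        calc |(z : ℝ)| ^ s * |(z : ℝ)|
            ≤ (2 ^ s * ‖fallingFactorial z s‖) * (2 * ‖(z : ℂ) - s‖) := by
              gcongr
              exact ih (by omega)
          _ = _ := by ring
    have : (0 : ℝ) ≤ (2 * l) ^ l := by positivity
    linarith [key l le_rfl]

lemma Rapid.fallingFactorial_mul {c : Lattice n → ℂ} (hc : Rapid c) (j : Fin n) (l : ℕ) :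
    Rapid fun η => fallingFactorial (η j) l * c η := by
  induction l with
  | zero => simpa [fallingFactorial] using hc
  | succ l ih =>
    simp only [fallingFactorial_succ_mul]
    exact (ih.coord_mul j).sub (ih.const_mul _)

lemma torusDFactorial_fourierSeries {c : Lattice n → ℂ} (hc : Rapid c) (j : Fin n) (l : ℕ) :
    torusDFactorial j l (fourierSeries c) =
      fourierSeries fun η => fallingFactorial (η j) l * c η := by
  induction l with
  | zero => simp [torusDFactorial, fallingFactorial]
  | succ l ih =>
    have h1 := hc.fallingFactorial_mul j l
    ext x
    simp only [torusDFactorial, ih, fallingFactorial_succ_mul]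
    rw [torusD_fourierSeries h1]
    have h2 := congrFun (fourierSeries_sub (h1.coord_mul j) (h1.const_mul (l : ℂ))) x
    rw [fourierSeries_const_mul] at h2
    exact h2.symm

/-- The Fourier multiplier of `D^{(β)}`, restricted to a list of directions. -/
def listFactorial (β : Fin n → ℕ) (l : List (Fin n)) (c : Lattice n → ℂ) : Lattice n → ℂ :=
  l.foldr (fun j c η => fallingFactorial (η j) (β j) * c η) c

lemma Rapid.listFactorial {c : Lattice n → ℂ} (hc : Rapid c) (β : Fin n → ℕ)
    (l : List (Fin n)) : Rapid (listFactorial β l c) := by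
  induction l with
  | nil => exact hc
  | cons j l ih => exact ih.fallingFactorial_mul j (β j)

lemma torusDMulti_fourierSeries {c : Lattice n → ℂ} (hc : Rapid c) (β : Fin n → ℕ) :
    torusDMulti β (fourierSeries c) = fourierSeries (listFactorial β (List.finRange n) c) := by
  rw [torusDMulti]
  induction List.finRange n with
  | nil => rfl
  | cons j l ih =>
    rw [List.foldr_cons, ih, torusDFactorial_fourierSeries (hc.listFactorial β l)]
    rfl

lemma listFactorial_single (j : Fin n) (N : ℕ) (c : Lattice n → ℂ) :
    listFactorial (Pi.single j N) (List.finRange n) c =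
      fun η => fallingFactorial (η j) N * c η := by
  have key : ∀ l : List (Fin n), l.Nodup → listFactorial (Pi.single j N) l c =
      if j ∈ l then fun η => fallingFactorial (η j) N * c η else c := by
    intro l hl
    induction l with
    | nil => rfl
    | cons i l ih =>
      have e : listFactorial (Pi.single j N) (i :: l) c = fun η =>
        fallingFactorial (η i) ((Pi.single j N : Fin n → ℕ) i) *
          listFactorial (Pi.single j N) l c η := rfl
      rw [e, ih (List.nodup_cons.1 hl).2]
      by_cases h : i = j
      · subst h
        simp [(List.nodup_cons.1 hl).1]
      · simp [h, Ne.symm h, fallingFactorial]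
  rw [key _ (List.nodup_finRange n), if_pos (List.mem_finRange j)]

lemma HasOrder.const_mul (ha : HasOrder Λ m a) (z : ℂ) : HasOrder Λ m fun k η => z * a k η := by
  intro N
  obtain ⟨A, hA⟩ := ha N
  refine ⟨‖z‖ * A, fun k η => ?_⟩
  rw [norm_mul, mul_assoc, mul_assoc]
  exact mul_le_mul_of_nonneg_left (hA k η) (norm_nonneg z)

lemma HasOrder.listFactorial (ha : HasOrder Λ m a) (β : Fin n → ℕ) (l : List (Fin n)) :
    HasOrder Λ m fun k => listFactorial β l (a k) := by
  induction l with
  | nil => exact ha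
  | cons j l ih =>
    change HasOrder Λ m fun k η => fallingFactorial (η j) (β j) * LatticePDO.listFactorial β l (a k) η
    induction β j with
    | zero => simpa [fallingFactorial] using ih
    | succ s ihs =>
      simp only [fallingFactorial_succ_mul]
      exact (ihs.freq j).sub (ihs.const_mul _)

lemma diffOp_kernelSymbol (ha : ∀ k, Rapid (a k)) (α : Fin n → ℕ) :
    (∀ k, Rapid (diffOp α a k)) ∧ kernelSymbol (diffOp α a) = diffOp α (kernelSymbol a) :=
  listDiff_map kernelSymbol (fun a => ∀ k, Rapid (a k)) α (List.finRange n)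
    (fun _ _ h k => (h _).sub (h k)) (fun _ _ _ _ h => funext fun k =>
      fourierSeries_sub (h _) (h k)) ha

/-- From symbols to kernels, a sup bound on `D^{(β)}` bounds its Fourier coefficients, and `β = 0`
and `β = N eⱼ` already give rapid decay. Conversely, decay of order `2n` makes the differentiated
series converge with a uniform bound. -/
lemma kernelSymbol_mem_symbolS_iff (hΛ : ∀ k, 0 < Λ k) (ha : ∀ k, Rapid (a k)) :
    kernelSymbol a ∈ SymbolS Λ ρ m ↔
      ∀ α : Fin n → ℕ, HasOrder Λ (m - ρ * (multiLength α : ℝ)) (diffOp α a) := by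
  have hD : ∀ (α β : Fin n → ℕ) k, torusDMulti β (diffOp α (kernelSymbol a) k) =
      fourierSeries (listFactorial β (List.finRange n) (diffOp α a k)) := by
    intro α β k
    rw [← (diffOp_kernelSymbol ha α).2, kernelSymbol,
      torusDMulti_fourierSeries ((diffOp_kernelSymbol ha α).1 k)]
  constructor
  · rintro ⟨-, h⟩ α
    have hb : ∀ β : Fin n → ℕ, ∃ C : ℝ, ∀ k η,
        ‖listFactorial β (List.finRange n) (diffOp α a k) η‖ ≤
          C * Λ k ^ (m - ρ * (multiLength α : ℝ)) := by
      intro β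
      obtain ⟨C, -, hC⟩ := h α β
      refine ⟨C, fun k η => ?_⟩
      rw [← torusCoeff_fourierSeries (((diffOp_kernelSymbol ha α).1 k).listFactorial β _)]
      refine norm_torusCoeff_le (fun x => ?_) η
      rw [← hD]
      exact hC k x
    have h0 : ∃ C : ℝ, ∀ k η, ‖diffOp α a k η‖ ≤ C * Λ k ^ (m - ρ * (multiLength α : ℝ)) := by
      obtain ⟨C, hC⟩ := hb 0
      refine ⟨C, fun k η => ?_⟩
      have e : ∀ l : List (Fin n), listFactorial 0 l (diffOp α a k) = diffOp α a k := by
        intro l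
        induction l with
        | nil => rfl
        | cons j l ih =>
          change (fun η => fallingFactorial (η j) 0 * listFactorial 0 l (diffOp α a k) η) = _
          simp [ih, fallingFactorial]
      have := hC k η
      rwa [e] at this
    refine hasOrder_of_coord_bounds h0 fun j N => ?_
    obtain ⟨C₀, hC₀⟩ := h0
    obtain ⟨C, hC⟩ := hb (Pi.single j N)
    refine ⟨2 ^ N * C + (2 * N) ^ N * C₀, fun k η => ?_⟩
    have h1 := hC k η
    rw [listFactorial_single, norm_mul] at h1
    calc |(η j : ℝ)| ^ N * ‖diffOp α a k η‖
        ≤ (2 ^ N * ‖fallingFactorial (η j) N‖ + (2 * N) ^ N) * ‖diffOp α a k η‖ := by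
          gcongr
          exact abs_pow_le_fallingFactorial _ _
      _ = 2 ^ N * (‖fallingFactorial (η j) N‖ * ‖diffOp α a k η‖) +
            (2 * N) ^ N * ‖diffOp α a k η‖ := by ring
      _ ≤ 2 ^ N * (C * Λ k ^ (m - ρ * (multiLength α : ℝ))) +
            (2 * N) ^ N * (C₀ * Λ k ^ (m - ρ * (multiLength α : ℝ))) := by
          gcongr
          exact hC₀ k η
      _ = _ := by ring
  · intro h
    refine ⟨fun k => isSmoothOnTorus_fourierSeries (ha k), fun α β => ?_⟩
    obtain ⟨C, hC⟩ := ((h α).listFactorial β (List.finRange n)) (2 * n)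
    refine ⟨|C * ∑' η : Lattice n, (bracket η ^ (2 * n))⁻¹| + 1, by positivity, fun k x => ?_⟩
    rw [hD]
    refine (norm_fourierSeries_le (hC k) x).trans ?_
    have := Real.rpow_pos_of_pos (hΛ k) (m - ρ * (multiLength α : ℝ))
    rw [mul_right_comm]
    gcongr
    exact (le_abs_self _).trans (by linarith)

/-- The Fourier coefficients identify the class `M^m` with a class of kernels. -/
theorem kernelSymbol_mem_symbolM_iff (hΛ : ∀ k, 0 < Λ k) (ha : ∀ k, Rapid (a k)) :
    kernelSymbol a ∈ SymbolM Λ ρ m ↔ EulerOrder Λ ρ (List.finRange n) m a := by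
  rw [eulerOrder_iff_monoDiff (List.nodup_finRange n)]
  have e : ∀ γ : Fin n → ℕ, (fun k x => (latticeMonomial γ k : ℂ) *
      diffOp γ (kernelSymbol a) k x) = kernelSymbol (monoDiff γ a) := by
    intro γ
    ext k x
    rw [← (diffOp_kernelSymbol ha γ).2]
    exact (congrFun (fourierSeries_const_mul _ _) x).symm
  have hr : ∀ γ k, Rapid (monoDiff γ a k) := fun γ k =>
    ((diffOp_kernelSymbol ha γ).1 k).const_mul _
  constructor
  · rintro ⟨-, h⟩ γ hγ - p
    have := h γ hγ
    rw [e, kernelSymbol_mem_symbolS_iff hΛ (hr γ)] at this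
    exact diffOrder_of_diffOp this p
  · intro h
    refine ⟨fun k => isSmoothOnTorus_fourierSeries (ha k), fun γ hγ => ?_⟩
    rw [e, kernelSymbol_mem_symbolS_iff hΛ (hr γ)]
    exact hasOrder_diffOp (h γ hγ fun i hi => absurd (List.mem_finRange i) hi)

end classes

end

/-! ### Action on rapidly decreasing sequences. -/

section

open MeasureTheory UnitAddTorus

variable {n : ℕ}

lemma mem_schwartzLattice_iff {f : Lattice n → ℂ} : f ∈ SchwartzLattice n ↔ Rapid f := by
  refine forall_congr' fun N => ⟨?_, ?_⟩
  · rintro ⟨C, hC⟩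
    refine ⟨(n + 1) ^ N * C, fun k => ?_⟩
    calc ‖f k‖ * bracket k ^ N ≤ ‖f k‖ * ((n + 1) * (1 + latticeNorm k)) ^ N := by
          have := (bracket_pos k).le
          gcongr
          exact bracket_le_latticeNorm k
      _ = (n + 1) ^ N * ((1 + latticeNorm k) ^ N * ‖f k‖) := by rw [mul_pow]; ring
      _ ≤ _ := by gcongr; exact hC k
  · rintro ⟨C, hC⟩
    refine ⟨C, fun k => le_trans ?_ (hC k)⟩
    rw [mul_comm]
    have := latticeNorm_nonneg k
    gcongr
    exact latticeNorm_le_bracket k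

lemma Rapid.comp_neg {f : Lattice n → ℂ} (hf : Rapid f) : Rapid fun η => f (-η) := fun N =>
  (hf N).imp fun C hC η => by simpa using hC (-η)

lemma latticeFourier_eq (f : Lattice n → ℂ) :
    latticeFourier f = fourierSeries fun η => f (-η) := by
  ext x
  rw [latticeFourier, fourierSeries, ← (Equiv.neg (Lattice n)).tsum_eq]
  simp [mul_comm]

/-- A pseudo-difference operator acts through the Fourier coefficients of its symbol. -/
lemma pdo_kernelSymbol {a : Kernel n} (ha : ∀ k, Rapid (a k)) {f : Lattice n → ℂ}
    (hf : Rapid f) : pdo (kernelSymbol a) f = kernelOp a f := by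
  ext k
  have hc := (isSmoothOnTorus_fourierSeries (ha k)).continuous
  have h := integral_fourierSeries_mul hf.comp_neg
    (g := fun x => mFourier k x * fourierSeries (a k) x) ((mFourier k).continuous.mul hc)
  have e : pdo (kernelSymbol a) f k = ∫ x, fourierSeries (fun η => f (-η)) x *
      (mFourier k x * fourierSeries (a k) x) ∂(torusMeasure n) := by
    simp only [pdo, latticeFourier_eq, kernelSymbol, mul_comm (fourierSeries (fun η => f (-η)) _)]
  -- The series of `f̂` has coefficients `f (-η)`; substituting `η = -(k + ζ)` produces `f (k + ζ)`
  -- against the `ζ`-th coefficient of the symbol.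
  let r : Lattice n ≃ Lattice n := (Equiv.addLeft k).trans (Equiv.neg _)
  rw [e, h, ← r.tsum_eq, kernelOp]
  congr 1
  ext ζ
  have hr : r ζ = -(k + ζ) := rfl
  rw [hr, neg_neg, mul_comm]
  congr 1
  rw [← congrFun (torusCoeff_fourierSeries (ha k)) ζ, torusCoeff]
  congr 1
  ext x
  rw [← mul_assoc, ← mFourier_add]
  congr 3
  abel

/-- Decay in `k` is obtained from decay of `f` at `k + η` and of `a` in `η`; the growth `Λ(k)^m` is
polynomial and costs `q` more powers of each. -/
lemma HasOrder.rapid_kernelOp {Λ : Lattice n → ℝ} (T : TameWeight Λ) {m : ℝ} {a : Kernel n}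
    (ha : HasOrder Λ m a) {f : Lattice n → ℂ} (hf : Rapid f) : Rapid (kernelOp a f) := by
  intro N
  obtain ⟨C, q, hC, hΛ⟩ := T.le_bracket m
  obtain ⟨A, hA0, hA⟩ := ha.exists_pos T (N + q + 2 * n)
  obtain ⟨B, hB⟩ := hf (N + q)
  have hB0 : 0 ≤ B := le_trans
    (mul_nonneg (norm_nonneg _) (pow_nonneg (bracket_pos _).le _)) (hB 0)
  refine ⟨A * C * B * ∑' η : Lattice n, (bracket η ^ (2 * n))⁻¹, fun k => ?_⟩
  have hk := bracket_pos k
  have hterm : ∀ η, ‖a k η * f (k + η)‖ ≤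
      A * C * B * (bracket k ^ N)⁻¹ * (bracket η ^ (2 * n))⁻¹ := by
    intro η
    have p1 := bracket_pos η
    have p2 := bracket_pos (k + η)
    have hsub : bracket k ^ (N + q) ≤ bracket (k + η) ^ (N + q) * bracket η ^ (N + q) := by
      rw [← mul_pow]
      refine pow_le_pow_left₀ hk.le ?_ _
      simpa using bracket_add_le (k + η) (-η)
    rw [← div_eq_mul_inv, ← div_eq_mul_inv, le_div_iff₀ (by positivity),
      le_div_iff₀ (by positivity), norm_mul]
    refine le_of_mul_le_mul_right ?_ (show 0 < bracket k ^ q by positivity)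
    calc ‖a k η‖ * ‖f (k + η)‖ * bracket η ^ (2 * n) * bracket k ^ N * bracket k ^ q
        = ‖a k η‖ * ‖f (k + η)‖ * bracket η ^ (2 * n) * bracket k ^ (N + q) := by
          rw [pow_add]; ring
      _ ≤ ‖a k η‖ * ‖f (k + η)‖ * bracket η ^ (2 * n) *
            (bracket (k + η) ^ (N + q) * bracket η ^ (N + q)) := by gcongr
      _ = (‖a k η‖ * bracket η ^ (N + q + 2 * n)) * (‖f (k + η)‖ * bracket (k + η) ^ (N + q)) := by
          rw [pow_add _ (N + q)]; ring
      _ ≤ (A * Λ k ^ m) * B := by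
          have := Real.rpow_nonneg (T.pos k).le m
          exact mul_le_mul (hA k η) (hB _) (by positivity) (by positivity)
      _ ≤ (A * (C * bracket k ^ q)) * B := by gcongr; exact hΛ k
      _ = _ := by ring
  have := tsum_of_norm_bounded (summable_bracket.hasSum.mul_left _) hterm
  calc ‖kernelOp a f k‖ * bracket k ^ N
      ≤ (A * C * B * (bracket k ^ N)⁻¹ * ∑' η : Lattice n, (bracket η ^ (2 * n))⁻¹) *
          bracket k ^ N := by gcongr; exact this
    _ = _ := by field_simp

lemma kernelOp_add {a b : Kernel n} (ha : ∀ k, Rapid (a k)) (hb : ∀ k, Rapid (b k))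
    {f : Lattice n → ℂ} (hf : Rapid f) : kernelOp (a + b) f = kernelOp a f + kernelOp b f := by
  obtain ⟨B, hB⟩ := hf 0
  have hs : ∀ {c : Lattice n → ℂ} (k : Lattice n), Rapid c → Summable fun η => c η * f (k + η) :=
    fun k hc => Summable.of_norm_bounded (hc.summable_norm.mul_right B) fun η => by
      rw [norm_mul]
      exact mul_le_mul_of_nonneg_left (by simpa using hB (k + η)) (norm_nonneg _)
  ext k
  simp only [kernelOp, Pi.add_apply, add_mul]
  exact (hs k (ha k)).tsum_add (hs k (hb k))

/-! ### Pointwise inversion of a symbol bounded below. -/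

section inverse

variable {Λ : Lattice n → ℝ}

/-- A family of functions is bounded of order `m` together with `p` derivatives in the
direction `j`. -/
def DerivOrder (Λ : Lattice n → ℝ) (j : Fin n) : ℕ → ℝ → (Lattice n → Torus n → ℂ) → Prop
  | 0, m, g => ∃ C : ℝ, ∀ k x, ‖g k x‖ ≤ C * Λ k ^ m
  | p + 1, m, g => (∃ C : ℝ, ∀ k x, ‖g k x‖ ≤ C * Λ k ^ m) ∧
      DerivOrder Λ j p m fun k => torusD j (g k)

lemma DerivOrder.bound {j : Fin n} {p : ℕ} {m : ℝ} {g : Lattice n → Torus n → ℂ}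
    (h : DerivOrder Λ j p m g) : ∃ C : ℝ, ∀ k x, ‖g k x‖ ≤ C * Λ k ^ m := by
  cases p with
  | zero => exact h
  | succ p => exact h.1

lemma DerivOrder.of_succ {j : Fin n} {p : ℕ} {m : ℝ} {g : Lattice n → Torus n → ℂ}
    (h : DerivOrder Λ j (p + 1) m g) : DerivOrder Λ j p m g := by
  induction p generalizing g with
  | zero => exact h.1
  | succ p ih => exact ⟨h.1, ih h.2⟩

lemma derivOrder_iff {j : Fin n} {m : ℝ} {g : Lattice n → Torus n → ℂ} {p : ℕ} :
    DerivOrder Λ j p m g ↔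
      ∀ N ≤ p, ∃ C : ℝ, ∀ k x, ‖(torusD j)^[N] (g k) x‖ ≤ C * Λ k ^ m := by
  induction p generalizing g with
  | zero => simp [DerivOrder]
  | succ p ih =>
    rw [DerivOrder, ih]
    constructor
    · rintro ⟨h1, h2⟩ N hN
      cases N with
      | zero => exact h1
      | succ N => exact h2 N (by omega)
    · exact fun h => ⟨h 0 (by omega), fun N hN => h (N + 1) (by omega)⟩

lemma torusD_add {f g : Torus n → ℂ} (hf : IsSmoothOnTorus f) (hg : IsSmoothOnTorus g)
    (j : Fin n) : torusD j (f + g) = torusD j f + torusD j g := by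
  ext x
  refine torusD_eq_of_hasDerivAt ?_
  refine ((hf.hasDerivAt_line j x 0).add (hg.hasDerivAt_line j x 0)).congr_deriv ?_
  simp only [AddCircle.coe_zero, Pi.single_zero, add_zero, Pi.add_apply]
  ring

lemma torusD_neg {f : Torus n → ℂ} (hf : IsSmoothOnTorus f) (j : Fin n) :
    torusD j (-f) = -torusD j f := by
  ext x
  refine torusD_eq_of_hasDerivAt ((hf.hasDerivAt_line j x 0).neg.congr_deriv ?_)
  simp only [AddCircle.coe_zero, Pi.single_zero, add_zero, Pi.neg_apply]
  ring

lemma DerivOrder.add {j : Fin n} {p : ℕ} {m : ℝ} {f g : Lattice n → Torus n → ℂ}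
    (hf : ∀ k, IsSmoothOnTorus (f k)) (hg : ∀ k, IsSmoothOnTorus (g k))
    (h₁ : DerivOrder Λ j p m f) (h₂ : DerivOrder Λ j p m g) :
    DerivOrder Λ j p m fun k => f k + g k := by
  have hb : ∃ C : ℝ, ∀ k x, ‖(f k + g k) x‖ ≤ C * Λ k ^ m := by
    obtain ⟨A, hA⟩ := h₁.bound
    obtain ⟨B, hB⟩ := h₂.bound
    exact ⟨A + B, fun k x => (norm_add_le _ _).trans (by linarith [hA k x, hB k x])⟩
  induction p generalizing f g with
  | zero => exact hb
  | succ p ih =>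
    refine ⟨hb, ?_⟩
    simp only [torusD_add (hf _) (hg _)]
    obtain ⟨A, hA⟩ := h₁.2.bound
    obtain ⟨B, hB⟩ := h₂.2.bound
    exact ih (fun k => (hf k).torusD j) (fun k => (hg k).torusD j) h₁.2 h₂.2
      ⟨A + B, fun k x => (norm_add_le _ _).trans (by linarith [hA k x, hB k x])⟩

lemma DerivOrder.neg {j : Fin n} {p : ℕ} {m : ℝ} {f : Lattice n → Torus n → ℂ}
    (hf : ∀ k, IsSmoothOnTorus (f k)) (h : DerivOrder Λ j p m f) :
    DerivOrder Λ j p m fun k => -f k := by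
  induction p generalizing f with
  | zero => simpa [DerivOrder] using h
  | succ p ih =>
    refine ⟨by simpa using h.1, ?_⟩
    simp only [torusD_neg (hf _)]
    exact ih (fun k => (hf k).torusD j) h.2

lemma DerivOrder.mul (T : TameWeight Λ) {j : Fin n} {p : ℕ} {m₁ m₂ : ℝ}
    {f g : Lattice n → Torus n → ℂ}
    (hf : ∀ k, IsSmoothOnTorus (f k)) (hg : ∀ k, IsSmoothOnTorus (g k))
    (h₁ : DerivOrder Λ j p m₁ f) (h₂ : DerivOrder Λ j p m₂ g) :
    DerivOrder Λ j p (m₁ + m₂) fun k => f k * g k := by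
  induction p generalizing f g with
  | zero =>
    obtain ⟨A, hA⟩ := h₁
    obtain ⟨B, hB⟩ := h₂
    refine ⟨A * B, fun k x => ?_⟩
    change ‖f k x * g k x‖ ≤ _
    rw [norm_mul, Real.rpow_add (T.pos k)]
    calc ‖f k x‖ * ‖g k x‖ ≤ (A * Λ k ^ m₁) * (B * Λ k ^ m₂) :=
          mul_le_mul (hA k x) (hB k x) (norm_nonneg _) ((norm_nonneg _).trans (hA k x))
      _ = _ := by ring
  | succ p ih =>
    refine ⟨(ih hf hg h₁.of_succ h₂.of_succ).bound, ?_⟩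
    simp only [torusD_mul (hf _) (hg _)]
    have hf' := fun k => (hf k).torusD j
    have hg' := fun k => (hg k).torusD j
    exact DerivOrder.add (fun k => (hf' k).mul (hg k)) (fun k => (hf k).mul (hg' k))
      (ih hf' hg h₁.2 h₂.of_succ) (ih hf hg' h₁.of_succ h₂.2)

/-- Induction through `D(1/f) = -(Df) f⁻²`, whose order is `m - 2m = -m` again. -/
lemma DerivOrder.inv (T : TameWeight Λ) {j : Fin n} {m c : ℝ} {f : Lattice n → Torus n → ℂ}
    (hf : ∀ k, IsSmoothOnTorus (f k)) (hc : 0 < c) (hlow : ∀ k x, c * Λ k ^ m ≤ ‖f k x‖)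
    (h : ∀ p, DerivOrder Λ j p m f) (p : ℕ) : DerivOrder Λ j p (-m) fun k => (f k)⁻¹ := by
  have h0 : ∀ k x, f k x ≠ 0 := fun k x => norm_pos_iff.1
    ((mul_pos hc (Real.rpow_pos_of_pos (T.pos k) m)).trans_le (hlow k x))
  have hb : ∃ C : ℝ, ∀ k x, ‖(f k)⁻¹ x‖ ≤ C * Λ k ^ (-m) := by
    refine ⟨c⁻¹, fun k x => ?_⟩
    have := Real.rpow_pos_of_pos (T.pos k) m
    rw [Pi.inv_apply, norm_inv, Real.rpow_neg (T.pos k).le, ← mul_inv]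
    exact inv_anti₀ (by positivity) (hlow k x)
  have hi := fun k => (hf k).inv (h0 k)
  induction p with
  | zero => exact hb
  | succ p ih =>
    refine ⟨hb, ?_⟩
    simp only [torusD_inv (hf _) (h0 _)]
    have := ((h (p + 1)).2.mul T (fun k => (hf k).torusD j)
      (fun k => (hi k).mul (hi k)) (DerivOrder.mul T hi hi ih ih)).neg
      (fun k => ((hf k).torusD j).mul ((hi k).mul (hi k)))
    rwa [add_neg_cancel_left] at this

lemma derivOrder_kernelSymbol {m : ℝ} {a : Kernel n} (ha : HasOrder Λ m a) (j : Fin n) (p : ℕ) :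
    DerivOrder Λ j p m (kernelSymbol a) := by
  rw [derivOrder_iff]
  intro N _
  have h : ∀ N : ℕ, HasOrder Λ m ((freqMul j)^[N] a) ∧
      ∀ k, (torusD j)^[N] (kernelSymbol a k) = fourierSeries ((freqMul j)^[N] a k) := by
    intro N
    induction N with
    | zero => exact ⟨ha, fun k => rfl⟩
    | succ N ih =>
      refine ⟨by rw [Function.iterate_succ_apply']; exact ih.1.freq j, fun k => ?_⟩
      rw [Function.iterate_succ_apply', ih.2, Function.iterate_succ_apply',
        torusD_fourierSeries (ih.1.rapid k)]
      rfl
  obtain ⟨C, hC⟩ := (h N).1 (2 * n)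
  refine ⟨C * ∑' η : Lattice n, (bracket η ^ (2 * n))⁻¹, fun k x => ?_⟩
  rw [(h N).2, mul_right_comm]
  exact norm_fourierSeries_le (hC k) x

lemma fourierSeries_unitKernel (k : Lattice n) : fourierSeries (unitKernel k) = 1 := by
  ext x
  rw [fourierSeries, tsum_eq_single 0 (by intro η hη; simp [unitKernel, hη])]
  simp [unitKernel, mFourier_zero]

/-- A symbol bounded below has a convolution inverse of the opposite order. -/
lemma exists_conv_inverse (T : TameWeight Λ) {m c : ℝ} {a : Kernel n} (ha : HasOrder Λ m a)
    (hc : 0 < c) (hlow : ∀ k x, c * Λ k ^ m ≤ ‖kernelSymbol a k x‖) :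
    ∃ b : Kernel n, HasOrder Λ (-m) b ∧ conv a b = unitKernel := by
  have hf : ∀ k, IsSmoothOnTorus (kernelSymbol a k) := fun k =>
    isSmoothOnTorus_fourierSeries (ha.rapid k)
  have h0 : ∀ k x, kernelSymbol a k x ≠ 0 := fun k x => norm_pos_iff.1
    ((mul_pos hc (Real.rpow_pos_of_pos (T.pos k) m)).trans_le (hlow k x))
  have hi := fun k => (hf k).inv (h0 k)
  refine ⟨fun k => torusCoeff (kernelSymbol a k)⁻¹, ?_, ?_⟩
  · refine hasOrder_torusCoeff hi ?_ fun j N => ?_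
    · refine ⟨c⁻¹, fun k x => ?_⟩
      have := Real.rpow_pos_of_pos (T.pos k) m
      rw [Pi.inv_apply, norm_inv, Real.rpow_neg (T.pos k).le, ← mul_inv]
      exact inv_anti₀ (by positivity) (hlow k x)
    · exact derivOrder_iff.1 (DerivOrder.inv T hf hc hlow
        (fun p => derivOrder_kernelSymbol ha j p) N) N le_rfl
  · ext k ζ
    have h1 := torusCoeff_mul (hf k) (hi k).continuous ζ
    rw [show kernelSymbol a k * (kernelSymbol a k)⁻¹ = 1 from
      funext fun x => mul_inv_cancel₀ (h0 k x), ← fourierSeries_unitKernel k,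
      torusCoeff_fourierSeries ((hasOrder_unitKernel (Λ := Λ)).rapid k),
      kernelSymbol, torusCoeff_fourierSeries (ha.rapid k)] at h1
    exact h1.symm

end inverse

end

/-! ### From kernels back to symbols and operators. -/

section

open MeasureTheory UnitAddTorus

variable {n : ℕ} {Λ : Lattice n → ℝ} {ρ m : ℝ}

lemma SymbolM.exists_kernel (hΛ : ∀ k, 0 < Λ k) {σ : Lattice n → Torus n → ℂ}
    (hσ : σ ∈ SymbolM Λ ρ m) :
    ∃ a : Kernel n, kernelSymbol a = σ ∧ EulerOrder Λ ρ (List.finRange n) m a := by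
  have e : kernelSymbol (fun k => torusCoeff (σ k)) = σ :=
    funext fun k => (hσ.1 k).fourierSeries_torusCoeff
  refine ⟨_, e, (kernelSymbol_mem_symbolM_iff hΛ fun k => (hσ.1 k).rapid).1 ?_⟩
  rwa [e]

lemma IsSmoothing.kernelSymbol_mem (T : TameWeight Λ) {a : Kernel n} (ha : IsSmoothing Λ a) :
    kernelSymbol a ∈ SymbolMNegInf Λ ρ :=
  Set.mem_iInter.2 fun m => (kernelSymbol_mem_symbolM_iff T.pos fun k => (ha 0).rapid k).2
    (EulerOrder.of_forall_hasOrder T ha m)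

/-- An elliptic kernel may be modified on a finite set so that its symbol is bounded below
everywhere. -/
lemma exists_uniformly_elliptic (T : TameWeight Λ) {a : Kernel n}
    (ha : HasOrder Λ m a) (hell : IsMElliptic Λ m (kernelSymbol a)) :
    ∃ (a₀ : Kernel n) (c : ℝ), IsSmoothing Λ (a - a₀) ∧ 0 < c ∧
      ∀ k x, c * Λ k ^ m ≤ ‖kernelSymbol a₀ k x‖ := by
  classical
  obtain ⟨C, R, hC, -, hlow⟩ := hell
  -- On the finite ball the symbol is replaced by the constant `1`.
  set a₀ : Kernel n := fun k => if latticeNorm k < R then unitKernel k else a k with ha₀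
  obtain ⟨B, hB⟩ := ((finite_latticeNorm_lt (n := n) R).image Λ).bddAbove
  obtain ⟨D, hD⟩ := ((finite_latticeNorm_lt (n := n) R).image fun k => Λ k ^ m).bddAbove
  have hD1 : 0 < max D 1 := lt_max_of_lt_right one_pos
  -- `D` bounds `Λ^m` on the ball, so `Λ^m / max D 1 ≤ 1` there; outside the ball the elliptic
  -- constant `C` applies.
  refine ⟨a₀, min C (max D 1)⁻¹, ?_, lt_min hC (inv_pos.2 hD1), fun k x => ?_⟩
  · have h : HasOrder Λ (max m 0) (a - unitKernel) :=
      (ha.mono T (le_max_left _ _)).sub (hasOrder_unitKernel.mono T (le_max_right _ _))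
    have h' : HasOrder Λ (max m 0) (a - a₀) := h.of_norm_le fun k η => by
      simp only [ha₀, Pi.sub_apply]
      split_ifs <;> simp
    refine h'.isSmoothing_of_bounded T (B := B) fun k hk => ?_
    have hkR : ¬ latticeNorm k < R := fun hkR =>
      absurd (hB (Set.mem_image_of_mem Λ hkR)) (not_le.2 hk)
    simp [ha₀, hkR]
  · have hk := Real.rpow_pos_of_pos (T.pos k) m
    by_cases hkR : latticeNorm k < R
    · have e : kernelSymbol a₀ k = 1 := by
        simp only [kernelSymbol, ha₀, hkR, if_true, fourierSeries_unitKernel]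
      rw [e, Pi.one_apply, norm_one]
      calc min C (max D 1)⁻¹ * Λ k ^ m ≤ (max D 1)⁻¹ * max D 1 := by
            gcongr
            · exact min_le_right _ _
            · exact (hD (Set.mem_image_of_mem (fun k => Λ k ^ m) hkR)).trans (le_max_left _ _)
        _ = 1 := inv_mul_cancel₀ hD1.ne'
    · have e : kernelSymbol a₀ k = kernelSymbol a k := by
        simp only [kernelSymbol, ha₀, hkR, if_false]
      rw [e]
      refine le_trans ?_ (hlow k (not_lt.1 hkR) x)
      gcongr
      exact min_le_left _ _

lemma pdo_comp (T : TameWeight Λ) {m₁ m₂ : ℝ} {a b : Kernel n} (ha : HasOrder Λ m₁ a)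
    (hb : HasOrder Λ m₂ b) (hab : IsSmoothing Λ (comp a b - unitKernel)) {f : Lattice n → ℂ}
    (hf : Rapid f) :
    pdo (kernelSymbol a) (pdo (kernelSymbol b) f) =
      f + pdo (kernelSymbol (comp a b - unitKernel)) f := by
  obtain ⟨C, hC⟩ := hf 0
  rw [pdo_kernelSymbol hb.rapid hf, pdo_kernelSymbol ha.rapid (hb.rapid_kernelOp T hf),
    pdo_kernelSymbol (hab 0).rapid hf,
    ← kernelOp_comp T ha hb (C := C) fun k => by simpa using hC k]
  have := kernelOp_add (hasOrder_unitKernel (Λ := Λ)).rapid (hab 0).rapid hf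
  rwa [add_sub_cancel, kernelOp_unitKernel] at this

end

end LatticePDO

end

theorem mainTheorem2 (n : ℕ) (Λ : LatticePDO.Lattice n → ℝ) (μ : ℝ)
    (hΛ : LatticePDO.IsWeight Λ μ) (ρ : ℝ) (hρ : 0 < ρ) (hρμ : ρ ≤ 1 / μ) (m : ℝ)
    (σ : LatticePDO.Lattice n → LatticePDO.Torus n → ℂ)
    (hσ : σ ∈ LatticePDO.SymbolM Λ ρ m) (hell : LatticePDO.IsMElliptic Λ m σ) :
    ∃ τ ∈ LatticePDO.SymbolM Λ ρ (-m),
      ∃ r ∈ LatticePDO.SymbolMNegInf Λ ρ, ∃ s ∈ LatticePDO.SymbolMNegInf Λ ρ,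
        ∀ f ∈ LatticePDO.SchwartzLattice n,
          LatticePDO.pdo σ f ∈ LatticePDO.SchwartzLattice n ∧
          LatticePDO.pdo τ f ∈ LatticePDO.SchwartzLattice n ∧
          LatticePDO.pdo τ (LatticePDO.pdo σ f) = f + LatticePDO.pdo r f ∧
          LatticePDO.pdo σ (LatticePDO.pdo τ f) = f + LatticePDO.pdo s f := by
  open LatticePDO in
  have T := hΛ.tame
  obtain ⟨a, rfl, ha⟩ := SymbolM.exists_kernel T.pos hσ
  obtain ⟨a₀, c, haa, hc, hlow⟩ := exists_uniformly_elliptic T ha.hasOrder hell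
  -- `a₀` differs from `a` by a smoothing kernel, so it stays in the class although the cutoff in
  -- `k` is sharp.
  have ha₀ : EulerOrder Λ ρ (List.finRange n) m a₀ := by
    rw [← sub_sub_cancel a a₀]
    exact ha.sub (EulerOrder.of_forall_hasOrder T haa m)
  obtain ⟨b₀, hb₀, hab⟩ := exists_conv_inverse T ha₀.hasOrder hc hlow
  obtain ⟨b, hb, hs, hr⟩ :=
    exists_kernel_parametrix T hρ ha ha₀ (ha₀.inverse T hρ.le hb₀ hab) hab haa
  refine ⟨kernelSymbol b, (kernelSymbol_mem_symbolM_iff T.pos hb.hasOrder.rapid).2 hb,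
    _, hr.kernelSymbol_mem T, _, hs.kernelSymbol_mem T, fun f hf => ?_⟩
  rw [mem_schwartzLattice_iff] at hf
  refine ⟨?_, ?_, pdo_comp T hb.hasOrder ha.hasOrder hr hf,
    pdo_comp T ha.hasOrder hb.hasOrder hs hf⟩
  · rw [pdo_kernelSymbol ha.hasOrder.rapid hf, mem_schwartzLattice_iff]
    exact ha.hasOrder.rapid_kernelOp T hf
  · rw [pdo_kernelSymbol hb.hasOrder.rapid hf, mem_schwartzLattice_iff]
    exact hb.hasOrder.rapid_kernelOp T hf
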